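/- **Conventions.** All matrices are over $\mathbb F_2$, $|x|$ is the Hamming weight, $V(a,b)=\sum_{j\le b}\binom aj$. "Efficient" means polynomial-time on a classical machine with uniform random bits; a QPT algorithm is a (uniform) quantum polynomial-time algorithm. A function is negligible if it is eventually smaller than every inverse polynomial; "with overwhelming probability" means up to a negligible failure probability. **Dense-Sparse LPN.** Let $m,h,d,t,k,w$ be functions of a security parameter $\lambda$, with $m,h,d,t$ efficiently computable in unary (hence polynomially bounded), $t=\omega(\log\lambda)$ and $t=o(m)$. Let $T\in\mathbb F_2^{h\times d}$ and $S\in\mathbb F_2^{h\times h}$ be uniformly random, and let $K\in\mathbb F_2^{d\times m}$, $E,C\in\mathbb F_2^{h\times m}$ be drawn from efficiently samplable distributions, all five independent, where (i) every column of $K$ has at most $k$ nonzero entries; (ii) with overwhelming probability $|Ex|\le w$ for all $x$ with $|x|\le t$ (sparse noise); (iii) with overwhelming probability $C$ is a compressed sensing matrix: every $x$ with $|x|\le t$ is determined by $Cx+e$, whatever the perturbation $e$ with $|e|\le w$; (iv) for some constant $\Gamma>1$ and all large $\lambda$, $\Gamma\log_2\big(V(d,kt)\,V(h,w)\big)\le\log_2V(m,t)$.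 Put $A=TK$, $B^{low}=SA+E$, $B^{high}=SA+E+C$. *Dense-Sparse LPN is intractable for QPT adversaries* if for some such choice of parameters and distributions, $|\Pr[\mathcal A(1^\lambda,A,B^{high})=1]-\Pr[\mathcal A(1^\lambda,A,B^{low})=1]|$ is negligible for every QPT algorithm $\mathcal A$. **Hamiltonians.** A 2D $k$-local Hamiltonian on $n$ qubits is $H=\sum_jh_j$, where the qubits sit at distinct sites of the square lattice and each Hermitian term $h_j$ acts on at most $k$ qubits of lattice diameter at most $k$; it is described by the sites and the list of the terms, with matrix entries in $\mathbb Q(i)$. It is frustration-free if all $h_j\ge0$ and its ground energy is $0$. Its spectral gap is $\lambda_1-\lambda_0$, with eigenvalues in nondecreasing order and repeated by multiplicity. $\mathsf S(\rho)=-\mathrm{Tr}\,\rho\log_2\rho$. **Theorem.** Assume that Dense-Sparse LPN is intractable for QPT adversaries. Then there are a constant $k>0$ and, for all sufficiently large $n$, a distribution over tuples $(H_n^{low},H_n^{high},W_n)$, samplable in polynomial time from $1^n$, where $H_n^{low},H_n^{high}$ are 2D $k$-local Hamiltonians on $n$ qubits and $W_n\subseteq[n]$, and a function $\Delta:\mathbb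 N\to\mathbb R_{\ge1}$ with $\Delta(n)=\omega(\log n)$, such that: 1. With overwhelming probability, each $H_n^b$ is frustration-free, has a unique ground state $|\phi_n^b\rangle$ (up to phase), and has spectral gap $1$. 2. With overwhelming probability, $\mathsf S(\mathrm{Tr}_{W_n}|\phi_n^{high}\rangle\langle\phi_n^{high}|)\ge\mathsf S(\mathrm{Tr}_{W_n}|\phi_n^{low}\rangle\langle\phi_n^{low}|)+\Delta(n)$. 3. For every QPT algorithm $\mathcal A$, $|\Pr[\mathcal A(H_n^{high},W_n)=1]-\Pr[\mathcal A(H_n^{low},W_n)=1]|$ is negligible in $n$. Consequently, fixed-cut ground-state entanglement learning is quantumly hard: 4. There are $a,b:\mathbb N\to\mathbb R_{\ge0}$ with $b(n)\ge a(n)+\Delta(n)$ such that, with overwhelming probability, the entropy across $W_n$ is at most $a(n)$ for $H_n^{low}$ and at least $b(n)$ for $H_n^{high}$; and for every QPT algorithm and all sufficiently large $n$, the algorithm fails to decide, with error at most $1/3$, whether the ground-state entropy across a given cut is $\le a(n)$ or $\ge b(n)$, on some 2D $k$-local frustration-free Hamiltonian on $n$ qubits with a unique ground state and spectral gap $1$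 that satisfies one of the two. 5. For every constant $\varepsilon>0$ and every QPT algorithm: on $(H_n^b,W_n)$ with a uniformly random $b\in\{low,high\}$, it outputs the ground-state entropy across $W_n$ up to additive error $\varepsilon$ with probability at most $1/2$ plus a negligible function of $n$; and for all sufficiently large $n$ there are a 2D $k$-local frustration-free Hamiltonian on $n$ qubits with a unique ground state and spectral gap $1$, and a cut, on which it succeeds with probability less than $2/3$. -/

import Mathlib

open Filter Asymptotics
open scoped ComplexOrder

namespace HamLearn

noncomputable section

/-! ### Binary trees and a step-counted programming language -/

/-- Data values: binary trees. -/
inductive Val : Type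
  | nil : Val
  | cons : Val → Val → Val

namespace Val

/-- The number of nodes of a tree: the length of an input. -/
def size : Val → ℕ
  | nil => 1
  | cons a b => a.size + b.size + 1

def hd : Val → Val
  | nil => nil
  | cons a _ => a

def tl : Val → Val
  | nil => nil
  | cons _ b => b

/-- Unary code of a natural number. -/
def ofNat : ℕ → Val
  | 0 => nil
  | n + 1 => cons nil (ofNat n)

/-- Length of the right spine; a left inverse of `ofNat`. -/
def toNat : Val → ℕ
  | nil => 0
  | cons _ b => b.toNat + 1

def ofBool : Bool → Val
  | false => nil
  | true => cons nil nil

/-- Right-nested list of values. -/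
def ofList : List Val → Val
  | [] => nil
  | a :: l => cons a (ofList l)

def toList : Val → List Val
  | nil => []
  | cons a b => a :: b.toList

/-- Code of a finite bit string. -/
def ofBits {N : ℕ} (z : Fin N → Bool) : Val := ofList (List.ofFn fun i => ofBool (z i))

/-- Code of a rational number: sign, numerator and denominator in unary. -/
def ofRat (x : ℚ) : Val :=
  cons (ofBool (decide (x < 0))) (cons (ofNat x.num.natAbs) (ofNat x.den))

/-- The rational number, as a real, named by a pair of unary numbers (numerator, denominator). -/
def toReal (v : Val) : ℝ := (v.hd.toNat : ℝ) / (v.tl.toNat : ℝ)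

/-- Code of a matrix over `𝔽₂`: the list of its rows. -/
def ofMatrix {a b : ℕ} (M : Matrix (Fin a) (Fin b) (ZMod 2)) : Val :=
  ofList (List.ofFn fun i => ofBits fun j => decide (M i j ≠ 0))

end Val

/-- Expressions over registers `0, 1, 2, …` that hold trees. -/
inductive Exp : Type
  | reg : ℕ → Exp
  | nil : Exp
  | cons : Exp → Exp → Exp
  | hd : Exp → Exp
  | tl : Exp → Exp

abbrev Store := ℕ → Val

def Exp.eval (σ : Store) : Exp → Val
  | .reg i => σ i
  | .nil => .nil
  | .cons e f => .cons (e.eval σ) (f.eval σ)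
  | .hd e => (e.eval σ).hd
  | .tl e => (e.eval σ).tl

/-- While-programs; every value other than `nil` counts as true. -/
inductive Cmd : Type
  | assign : ℕ → Exp → Cmd
  | seq : Cmd → Cmd → Cmd
  | ite : Exp → Cmd → Cmd → Cmd
  | loop : Exp → Cmd → Cmd

/-- `Runs c σ t τ`: started in store `σ`, the program `c` halts after `t` steps in store `τ`.
A test costs one step and an assignment costs the size of the assigned tree plus one, so that
running time agrees with Turing machine time up to a polynomial, and no value can be larger than
the input and the time spent. -/
inductive Runs : Cmd → Store → ℕ → Store → Prop
  | assign (i : ℕ) (e : Exp) (σ : Store) :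
      Runs (.assign i e) σ ((e.eval σ).size + 1) (Function.update σ i (e.eval σ))
  | seq {c d : Cmd} {σ τ υ : Store} {s t : ℕ} :
      Runs c σ s τ → Runs d τ t υ → Runs (.seq c d) σ (s + t) υ
  | iteTrue {e : Exp} {c d : Cmd} {σ τ : Store} {t : ℕ} :
      e.eval σ ≠ .nil → Runs c σ t τ → Runs (.ite e c d) σ (t + 1) τ
  | iteFalse {e : Exp} {c d : Cmd} {σ τ : Store} {t : ℕ} :
      e.eval σ = .nil → Runs d σ t τ → Runs (.ite e c d) σ (t + 1) τ
  | loopDone {e : Exp} {c : Cmd} {σ : Store} :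
      e.eval σ = .nil → Runs (.loop e c) σ 1 σ
  | loopStep {e : Exp} {c : Cmd} {σ τ υ : Store} {s t : ℕ} :
      e.eval σ ≠ .nil → Runs c σ s τ → Runs (.loop e c) τ t υ →
        Runs (.loop e c) σ (s + t + 1) υ

/-- The input stands in register `0`, all other registers hold `nil`. -/
def initStore (x : Val) : Store := fun i => if i = 0 then x else .nil

/-- `f` is computed by one program, in time polynomial in the size of the input; the output is
read from register `0`. -/
def PolyTime (f : Val → Val) : Prop :=
  ∃ (c : Cmd) (p : Polynomial ℕ), ∀ x : Val, ∃ t ≤ p.eval x.size, ∃ τ : Store,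
    Runs c (initStore x) t τ ∧ τ 0 = f x

/-- `1^l ↦ 1^(f l)` is computable in polynomial time; in particular `f` is polynomially
bounded. -/
def EffNat (f : ℕ → ℕ) : Prop :=
  ∃ g : Val → Val, PolyTime g ∧ ∀ l, g (.ofNat l) = .ofNat (f l)

/-! ### Probabilities over finite uniform sample spaces, negligible functions -/

/-- Expectation under the uniform distribution on a finite type. -/
def unifE {Ω : Type} [Fintype Ω] (f : Ω → ℝ) : ℝ := (∑ ω, f ω) / (Fintype.card Ω : ℝ)

open Classical in
/-- Probability under the uniform distribution on a finite type. -/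
def unifP {Ω : Type} [Fintype Ω] (P : Ω → Prop) : ℝ := unifE fun ω => if P ω then 1 else 0

def Negligible (μ : ℕ → ℝ) : Prop :=
  ∀ c : ℕ, ∀ᶠ n : ℕ in atTop, |μ n| ≤ ((n : ℝ) ^ c)⁻¹

/-! ### Quantum circuits and quantum polynomial time -/

/-- Hadamard, `T = diag(1, exp(iπ/4))` and controlled-NOT (control first). -/
inductive Gate : Type
  | had : ℕ → Gate
  | phase : ℕ → Gate
  | cnot : ℕ → ℕ → Gate

/-- State vectors of `N` qubits, in the computational basis. -/
abbrev QState (N : ℕ) := (Fin N → Bool) → ℂ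

/-- Action of a gate; a gate that names a wire which does not exist, or a controlled-NOT whose
control is its target, does nothing. -/
def Gate.apply {N : ℕ} (ψ : QState N) : Gate → QState N
  | .had i =>
      if h : i < N then fun x =>
        (ψ (Function.update x ⟨i, h⟩ false)
          + (if x ⟨i, h⟩ then -1 else 1) * ψ (Function.update x ⟨i, h⟩ true)) / (√2 : ℝ)
      else ψ
  | .phase i =>
      if h : i < N then fun x =>
        (if x ⟨i, h⟩ then Complex.exp (Real.pi / 4 * Complex.I) else 1) * ψ x
      else ψ
  | .cnot i j =>
      if h : i < N ∧ j < N ∧ i ≠ j then fun x =>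
        ψ (Function.update x ⟨j, h.2.1⟩ (xor (x ⟨j, h.2.1⟩) (x ⟨i, h.1⟩)))
      else ψ

/-- A gate is coded by its kind and its wires, all in unary. -/
def Gate.decode (v : Val) : Gate :=
  match v.hd.toNat with
  | 0 => .had v.tl.hd.toNat
  | 1 => .phase v.tl.hd.toNat
  | _ => .cnot v.tl.hd.toNat v.tl.tl.toNat

/-- A circuit is coded by its number of wires, in unary, and the list of its gates. -/
def wires (c : Val) : ℕ := c.hd.toNat

/-- The final state of the circuit with code `c`, started on `|0…0⟩`. -/
def finalState (c : Val) : QState (wires c) :=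
  (c.tl.toList.map Gate.decode).foldl (fun ψ g => g.apply ψ)
    (fun x => if x = fun _ => false then 1 else 0)

/-- A quantum polynomial-time algorithm: from the input and polynomially many random bits, a
polynomial-time classical computation prepares a quantum circuit; the circuit is run on `|0…0⟩`
and all its wires are measured; a polynomial-time classical computation turns the input, the
random bits and the measured bits into the output. -/
structure QPT where
  coins : Polynomial ℕ
  prep : Val → Val
  post : Val → Val
  prep_poly : PolyTime prep
  post_poly : PolyTime post

open Classical in
/-- The probability that the output of `A` on input `x` lies in `Y`. -/
def QPT.outProb (A : QPT) (x : Val) (Y : Set Val) : ℝ :=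
  unifE fun r : Fin (A.coins.eval x.size) → Bool =>
    ∑ z : Fin (wires (A.prep (.cons x (.ofBits r)))) → Bool,
      if A.post (.cons (.cons x (.ofBits r)) (.ofBits z)) ∈ Y then
        ‖finalState (A.prep (.cons x (.ofBits r))) z‖ ^ 2
      else 0

/-- The probability that `A` outputs `1` (a value other than `nil`). -/
def QPT.acceptProb (A : QPT) (x : Val) : ℝ := A.outProb x {y | y ≠ .nil}

/-! ### Dense-Sparse Learning Parity with Noise -/

/-- An efficiently samplable family of random matrices over `𝔽₂`: the matrix with parameter `l`
is computed in polynomial time from `1^l` and polynomially many uniform random bits. -/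
structure MatrixSampler (rows cols : ℕ → ℕ) where
  coins : Polynomial ℕ
  sample : ∀ l, (Fin (coins.eval l) → Bool) → Matrix (Fin (rows l)) (Fin (cols l)) (ZMod 2)
  gen : Val → Val
  gen_poly : PolyTime gen
  gen_eq : ∀ l r, gen (.cons (.ofNat l) (.ofBits r)) = .ofMatrix (sample l r)

/-- The number of vectors of Hamming weight at most `b` in `𝔽₂^a`. -/
def ballCard (a b : ℕ) : ℕ := ∑ j ∈ Finset.range (b + 1), a.choose j

/-- Every column of `M` has at most `k` nonzero entries. -/
def ColumnSparse {a b : ℕ} (k : ℕ) (M : Matrix (Fin a) (Fin b) (ZMod 2)) : Prop :=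
  ∀ j, hammingNorm (fun i => M i j) ≤ k

/-- `E` maps `t`-sparse vectors to `w`-sparse vectors. -/
def SparseNoise {a b : ℕ} (t w : ℕ) (E : Matrix (Fin a) (Fin b) (ZMod 2)) : Prop :=
  ∀ x : Fin b → ZMod 2, hammingNorm x ≤ t → hammingNorm (E.mulVec x) ≤ w

/-- A compressed sensing matrix for `t`-sparse vectors: `x` is determined by `C x + e`, for every
`t`-sparse `x` and every perturbation `e` of weight at most `w`. -/
def CompressedSensing {a b : ℕ} (t w : ℕ) (C : Matrix (Fin a) (Fin b) (ZMod 2)) : Prop :=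
  ∀ (x x' : Fin b → ZMod 2) (e e' : Fin a → ZMod 2),
    hammingNorm x ≤ t → hammingNorm x' ≤ t → hammingNorm e ≤ w → hammingNorm e' ≤ w →
      C.mulVec x + e = C.mulVec x' + e' → x = x'

/-- Parameters and matrix distributions, indexed by the security parameter: `m` columns, `h`
rows in each of the two blocks, inner dimension `d`, input sparsity `t`, column sparsity `k` of
the sparse factor, and perturbation weight `w`. -/
structure DenseSparseFamily where
  m : ℕ → ℕ
  h : ℕ → ℕ
  d : ℕ → ℕ
  t : ℕ → ℕ
  k : ℕ → ℕ
  w : ℕ → ℕ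
  K : MatrixSampler d m
  E : MatrixSampler h m
  C : MatrixSampler h m

/-- The admissible parameters and matrix distributions. The last condition is the regime of the
assumption: up to a constant factor `Γ > 1` in the exponent, there are more `t`-sparse inputs in
`𝔽₂^m` than pairs of a `k t`-sparse vector in `𝔽₂^d` and a `w`-sparse vector in `𝔽₂^h`. -/
structure DenseSparseFamily.Suitable (D : DenseSparseFamily) : Prop where
  m_eff : EffNat D.m
  h_eff : EffNat D.h
  d_eff : EffNat D.d
  t_eff : EffNat D.t
  t_large : (fun l : ℕ => Real.log l) =o[atTop] fun l => (D.t l : ℝ)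
  t_small : (fun l => (D.t l : ℝ)) =o[atTop] fun l => (D.m l : ℝ)
  sparse_K : ∀ l r, ColumnSparse (D.k l) (D.K.sample l r)
  sparse_E : Negligible fun l => unifP fun r => ¬ SparseNoise (D.t l) (D.w l) (D.E.sample l r)
  sensing_C : Negligible fun l =>
    unifP fun r => ¬ CompressedSensing (D.t l) (D.w l) (D.C.sample l r)
  regime : ∃ Γ : ℝ, 1 < Γ ∧ ∀ᶠ l in atTop,
    Γ * Real.logb 2 ((ballCard (D.d l) (D.k l * D.t l) : ℝ) * (ballCard (D.h l) (D.w l) : ℝ))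
      ≤ Real.logb 2 (ballCard (D.m l) (D.t l) : ℝ)

/-- The probability that `𝒜` outputs `1` on the public description `(A, B)` with parameter `l`.
Here `A = T K` and `B = S A + E` in the low branch, `B = S A + E + C` in the high branch, where
`T` and `S` are uniformly random and `T, S, K, E, C` are independent. -/
def DenseSparseFamily.acceptProb (D : DenseSparseFamily) (𝒜 : QPT) (high : Bool) (l : ℕ) : ℝ :=
  unifE fun ω :
      Matrix (Fin (D.h l)) (Fin (D.d l)) (ZMod 2) × Matrix (Fin (D.h l)) (Fin (D.h l)) (ZMod 2) ×
      (Fin (D.K.coins.eval l) → Bool) × (Fin (D.E.coins.eval l) → Bool) ×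
      (Fin (D.C.coins.eval l) → Bool) =>
    let A := ω.1 * D.K.sample l ω.2.2.1
    let B := ω.2.1 * A + D.E.sample l ω.2.2.2.1
      + (if high then D.C.sample l ω.2.2.2.2 else 0)
    𝒜.acceptProb (.cons (.ofNat l) (.cons (.ofMatrix A) (.ofMatrix B)))

/-- Intractability of Dense-Sparse LPN for quantum polynomial-time adversaries: for some
admissible choice of parameters and matrix distributions, the two public-key distributions are
computationally indistinguishable. -/
def DenseSparseLPN : Prop :=
  ∃ D : DenseSparseFamily, D.Suitable ∧
    ∀ 𝒜 : QPT, Negligible fun l => D.acceptProb 𝒜 true l - D.acceptProb 𝒜 false l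

/-! ### Local Hamiltonians on the square lattice -/

/-- Operators on `n` qubits, in the computational basis. -/
abbrev QOp (n : ℕ) := Matrix (Fin n → Bool) (Fin n → Bool) ℂ

/-- A Hermitian term with entries in `ℚ(i)` acting on a list of distinct qubits. -/
structure LocalTerm (n : ℕ) where
  supp : List (Fin n)
  nodup : supp.Nodup
  re : Matrix (Fin supp.length → Bool) (Fin supp.length → Bool) ℚ
  im : Matrix (Fin supp.length → Bool) (Fin supp.length → Bool) ℚ
  re_symm : ∀ x y, re y x = re x y
  im_symm : ∀ x y, im y x = - im x y

/-- The term as an operator on all `n` qubits: identity outside its support. -/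
def LocalTerm.op {n : ℕ} (h : LocalTerm n) : QOp n := fun x y =>
  if ∀ i, i ∉ h.supp → x i = y i then
    (h.re (fun j => x (h.supp.get j)) (fun j => y (h.supp.get j)) : ℂ)
      + (h.im (fun j => x (h.supp.get j)) (fun j => y (h.supp.get j)) : ℂ) * Complex.I
  else 0

/-- A classical description of a Hamiltonian on `n` qubits: the sites of the qubits in the square
lattice, which are distinct, and the list of the terms. -/
structure Ham (n : ℕ) where
  pos : Fin n → ℕ × ℕ
  pos_inj : Function.Injective pos
  terms : List (LocalTerm n)

/-- Distance in the square lattice. -/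
def latticeDist (p q : ℕ × ℕ) : ℕ := Nat.dist p.1 q.1 + Nat.dist p.2 q.2

namespace Ham

variable {n : ℕ}

/-- Each term acts on at most `k` qubits, with lattice diameter at most `k`. -/
def IsLocal2D (H : Ham n) (k : ℕ) : Prop :=
  ∀ h ∈ H.terms, h.supp.length ≤ k ∧
    ∀ i ∈ h.supp, ∀ j ∈ h.supp, latticeDist (H.pos i) (H.pos j) ≤ k

def op (H : Ham n) : QOp n := (H.terms.map LocalTerm.op).sum

theorem term_isHermitian (h : LocalTerm n) : h.op.IsHermitian := by
  ext x y
  have hc : (∀ i, i ∉ h.supp → y i = x i) ↔ (∀ i, i ∉ h.supp → x i = y i) :=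
    ⟨fun H i hi => (H i hi).symm, fun H i hi => (H i hi).symm⟩
  simp only [Matrix.conjTranspose_apply, LocalTerm.op, hc]
  split_ifs
  · rw [h.re_symm, h.im_symm]
    simp
  · simp

theorem op_isHermitian (H : Ham n) : H.op.IsHermitian := by
  unfold op
  induction H.terms with
  | nil => simp
  | cons a l ih =>
    simp only [List.map_cons, List.sum_cons]
    exact (term_isHermitian a).add ih

/-- The eigenvalues in nondecreasing order, with multiplicity, numbered from `0`. -/
def level (H : Ham n) (j : ℕ) : ℝ :=
  if hj : j < Fintype.card (Fin n → Bool) then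
    H.op_isHermitian.eigenvalues₀ (Fin.rev ⟨j, hj⟩)
  else 0

def groundEnergy (H : Ham n) : ℝ := H.level 0

def spectralGap (H : Ham n) : ℝ := H.level 1 - H.level 0

def FrustrationFree (H : Ham n) : Prop :=
  (∀ h ∈ H.terms, h.op.PosSemidef) ∧ H.groundEnergy = 0

/-- A unit vector in the ground space. -/
def IsGroundState (H : Ham n) (φ : QState n) : Prop :=
  ∑ x, ‖φ x‖ ^ 2 = 1 ∧ H.op.mulVec φ = (H.groundEnergy : ℂ) • φ

/-- `φ` is the ground state, unique up to a phase. -/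
def IsUniqueGroundState (H : Ham n) (φ : QState n) : Prop :=
  H.IsGroundState φ ∧ ∀ ψ, H.IsGroundState ψ → ∃ c : ℂ, ψ = c • φ

/-- Frustration-free with a unique ground state and spectral gap `1`. -/
def GroundStructure (H : Ham n) : Prop :=
  H.FrustrationFree ∧ (∃ φ, H.IsUniqueGroundState φ) ∧ H.spectralGap = 1

end Ham

/-! ### Entanglement entropy -/

/-- The basis string that is `w` on `W` and `a` off `W`. -/
def glue {n : ℕ} (W : Finset (Fin n)) (w : {i // i ∈ W} → Bool) (a : {i // i ∉ W} → Bool) :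
    Fin n → Bool := fun i => if h : i ∈ W then w ⟨i, h⟩ else a ⟨i, h⟩

/-- The partial trace over the qubits in `W`. -/
def ptrace {n : ℕ} (W : Finset (Fin n)) (X : QOp n) :
    Matrix ({i // i ∉ W} → Bool) ({i // i ∉ W} → Bool) ℂ :=
  fun a b => ∑ w : {i // i ∈ W} → Bool, X (glue W w a) (glue W w b)

/-- `|φ⟩⟨φ|`. -/
def proj {n : ℕ} (φ : QState n) : QOp n := Matrix.vecMulVec φ (star φ)

theorem ptrace_proj_isHermitian {n : ℕ} (W : Finset (Fin n)) (φ : QState n) :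
    (ptrace W (proj φ)).IsHermitian := by
  ext a b
  simp [Matrix.conjTranspose_apply, ptrace, proj, Matrix.vecMulVec_apply, mul_comm]

/-- The von Neumann entropy `- Tr ρ log₂ ρ` of a Hermitian matrix. -/
def vonNeumann {ι : Type} [Fintype ι] [DecidableEq ι] {ρ : Matrix ι ι ℂ} (hρ : ρ.IsHermitian) :
    ℝ := ∑ i, Real.negMulLog (hρ.eigenvalues i) / Real.log 2

/-- The entropy of `φ` after the qubits in `W` have been traced out. -/
def entanglementEntropy {n : ℕ} (W : Finset (Fin n)) (φ : QState n) : ℝ :=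
  vonNeumann (ptrace_proj_isHermitian W φ)

/-! ### Codes of Hamiltonians, and samplable families of pairs of Hamiltonians -/

/-- All bit strings of length `l`, in a fixed order. -/
def allBits : (l : ℕ) → List (Fin l → Bool)
  | 0 => [fun i => i.elim0]
  | l + 1 => (allBits l).map (Fin.cons false) ++ (allBits l).map (Fin.cons true)

/-- Code of a term: the numbers of its qubits and the list of its matrix entries. -/
def LocalTerm.code {n : ℕ} (h : LocalTerm n) : Val :=
  .cons (.ofList (h.supp.map fun i => .ofNat i))
    (.ofList ((allBits h.supp.length).map fun x =>
      .ofList ((allBits h.supp.length).map fun y =>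
        .cons (.ofRat (h.re x y)) (.ofRat (h.im x y)))))

/-- Code of a Hamiltonian: the number of qubits, their sites, and the terms. -/
def Ham.code {n : ℕ} (H : Ham n) : Val :=
  .cons (.ofNat n)
    (.cons (.ofList (List.ofFn fun i => .cons (.ofNat (H.pos i).1) (.ofNat (H.pos i).2)))
      (.ofList (H.terms.map LocalTerm.code)))

/-- Code of a set of qubits, as a bit string. -/
def cutCode {n : ℕ} (W : Finset (Fin n)) : Val := .ofBits fun i => decide (i ∈ W)

/-- The input `(H, W)` that an algorithm receives. -/
def inputCode {n : ℕ} (H : Ham n) (W : Finset (Fin n)) : Val := .cons H.code (cutCode W)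

/-- An efficiently samplable family, for all `n ≥ n₀`, of distributions of tuples
`(H_low, H_high, W)` on `n` qubits: the tuple is computed in polynomial time from `1^n` and
polynomially many uniform random bits. -/
structure HamFamily where
  n₀ : ℕ
  coins : Polynomial ℕ
  low : ∀ n, (Fin (coins.eval n) → Bool) → Ham n
  high : ∀ n, (Fin (coins.eval n) → Bool) → Ham n
  cut : ∀ n, (Fin (coins.eval n) → Bool) → Finset (Fin n)
  gen : Val → Val
  gen_poly : PolyTime gen
  gen_eq : ∀ n ≥ n₀, ∀ r, gen (.cons (.ofNat n) (.ofBits r)) =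
    .cons (low n r).code (.cons (high n r).code (cutCode (cut n r)))

/-- A property of the sampled tuple holds with overwhelming probability. -/
def HamFamily.Overwhelming (F : HamFamily)
    (P : ∀ n, Ham n → Ham n → Finset (Fin n) → Prop) : Prop :=
  Negligible fun n => unifP fun r => ¬ P n (F.low n r) (F.high n r) (F.cut n r)

/-! ### Ground-state entanglement learning across a fixed cut -/

/-- The ground state of `H` is unique and its entropy across the cut `W` lies in `I`. -/
def EntropyIn {n : ℕ} (H : Ham n) (W : Finset (Fin n)) (I : Set ℝ) : Prop :=
  ∃ φ, H.IsUniqueGroundState φ ∧ entanglementEntropy W φ ∈ I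

/-- The outputs that name the entropy up to the additive error `ε`. -/
def goodEstimates {n : ℕ} (H : Ham n) (W : Finset (Fin n)) (ε : ℝ) : Set Val :=
  {y | EntropyIn H W (Set.Icc (y.toReal - ε) (y.toReal + ε))}

/-- On all 2D `k`-local inputs with `n` qubits that are frustration-free with a unique ground state
and spectral gap `1`, and whose entropy is at most `a n` or at least `b n`, the algorithm decides
with error at most `1/3` which of the two cases holds. -/
def DecidesEntropyAt (𝒜 : QPT) (k : ℕ) (a b : ℕ → ℝ) (n : ℕ) : Prop :=
  ∀ (H : Ham n) (W : Finset (Fin n)), H.IsLocal2D k → H.GroundStructure →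
    (EntropyIn H W (Set.Iic (a n)) → 𝒜.acceptProb (inputCode H W) ≤ 1 / 3) ∧
    (EntropyIn H W (Set.Ici (b n)) → 2 / 3 ≤ 𝒜.acceptProb (inputCode H W))

/-- On all 2D `k`-local inputs with `n` qubits that are frustration-free with a unique ground state
and spectral gap `1`, the algorithm estimates the entropy up to the additive error `ε`, with
probability at least `2/3`. -/
def LearnsEntropyAt (𝒜 : QPT) (k : ℕ) (ε : ℝ) (n : ℕ) : Prop :=
  ∀ (H : Ham n) (W : Finset (Fin n)), H.IsLocal2D k → H.GroundStructure →
    2 / 3 ≤ 𝒜.outProb (inputCode H W) (goodEstimates H W ε)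

end

end HamLearn

open HamLearn

/-!
The idea is to hide a single bit `b` in a classical constraint satisfaction problem with exactly one
solution, and to let `b` switch `m` Bell pairs on or off.

*The Hamiltonian.* An instance consists of the public matrices `A` and `B` of the LPN problem, the
values `A x` and `B x` for a secret string `x` with one `1` in each of `t` blocks of columns, a random
vector `r`, and the bit `⟨r, x⟩ + b`. On a grid of qubits, row after row scans the same string `x` and
checks one linear equation (`rowClauses`, `gridClauses`), by clauses on at most three neighbouring
qubits. The last row does not check anything; its final state is `⟨r, x⟩ + (⟨r, x⟩ + b) = b`. This bit
controls `m` pairs of qubits, which are forced into the state `00` if `b = 0`, and into the Bell state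
if `b = 1`. In a basis where a controlled Hadamard transformation is applied to every pair, all terms
are diagonal, and the energy counts the violated clauses and the excited pairs
(`PairSys.op_basisChange`). So if the constraints have only one solution, then the Hamiltonian is
frustration-free with a unique ground state and spectral gap exactly `1`, and the entropy across the
cut that separates the partners of the pairs is `0` or `m` (`PairSys.groundStructure`,
`PairSys.entropy_groundState`, `gridHam_spec`). Both Hamiltonians of the family use the high matrix
`B = S A + E + C`: as `C` is a compressed sensing matrix and `x` is sparse, the solution is unique
(`instRows_unique`).

*Indistinguishability.* If the low matrix `B = S A + E` is used instead, then `A x` and `B x` are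
determined by the sparse vectors `K x` and `E x`, so that they take at most `V(d, k t) V(h, w)` values
(`exists_image_sysRows`), and by the condition on the parameters this is much less than the number of
strings `x` (`DenseSparseFamily.Suitable.compression`). By the leftover hash lemma (`leftover_hash`)
the hashed bit `⟨r, x⟩` is then statistically close to uniform, so that `b` cannot be found. An
algorithm that finds `b` in the high case therefore distinguishes the low from the high matrix. Its
advantage may have different signs for different matrices, and it is only known to be large for some
numbers `n` of qubits that belong to a given security parameter. The reduction therefore draws `n` at
random, and compares two independent attempts at guessing a random `b`: they agree with probability
`1 / 2 + ε ^ 2 / 2`, where `ε` is the advantage (`QPT.exists_agree`,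
`DenseSparseFamily.exists_reduction`, `DenseSparseFamily.negligible_advantage`).

The remaining claims follow, since an algorithm that decides or estimates the entropy tells the two
Hamiltonians apart, with a threshold for its output.

That all this takes polynomial time is shown in a small calculus (`PF`) of functions between types
whose elements are coded by trees; `fun_prop` applies its rules.
-/

namespace HamLearn

/-! ### While-programs as subroutines -/

theorem Val.size_pos (v : Val) : 0 < v.size := by
  cases v <;> simp [Val.size]

@[simp] theorem Val.hd_cons (a b : Val) : (Val.cons a b).hd = a := rfl

@[simp] theorem Val.tl_cons (a b : Val) : (Val.cons a b).tl = b := rfl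

theorem poly_mono (p : Polynomial ℕ) : Monotone fun n => p.eval n := by
  intro a b hab
  simp only [Polynomial.eval_eq_sum, Polynomial.sum]
  exact Finset.sum_le_sum fun i _ => Nat.mul_le_mul_left _ (Nat.pow_le_pow_left hab i)

/-- All registers of the expression are smaller than `e.bound`. -/
def Exp.bound : Exp → ℕ
  | .reg i => i + 1
  | .nil => 0
  | .cons e f => max e.bound f.bound
  | .hd e => e.bound
  | .tl e => e.bound

/-- Renames every register `i` to `i + k`. -/
def Exp.shift (k : ℕ) : Exp → Exp
  | .reg i => .reg (i + k)
  | .nil => .nil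
  | .cons e f => .cons (e.shift k) (f.shift k)
  | .hd e => .hd (e.shift k)
  | .tl e => .tl (e.shift k)

/-- All registers of the program are smaller than `c.bound`. -/
def Cmd.bound : Cmd → ℕ
  | .assign i e => max (i + 1) e.bound
  | .seq c d => max c.bound d.bound
  | .ite e c d => max e.bound (max c.bound d.bound)
  | .loop e c => max e.bound c.bound

/-- Renames every register `i` to `i + k`. -/
def Cmd.shift (k : ℕ) : Cmd → Cmd
  | .assign i e => .assign (i + k) (e.shift k)
  | .seq c d => .seq (c.shift k) (d.shift k)
  | .ite e c d => .ite (e.shift k) (c.shift k) (d.shift k)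
  | .loop e c => .loop (e.shift k) (c.shift k)

theorem Exp.eval_shift {k b : ℕ} {σ σ' : Store} (h : ∀ i < b, σ' (i + k) = σ i) :
    ∀ e : Exp, e.bound ≤ b → (e.shift k).eval σ' = e.eval σ
  | .reg i, hb => h i hb
  | .nil, _ => rfl
  | .cons e f, hb => by
      simp only [Exp.bound, max_le_iff] at hb
      simp [Exp.shift, Exp.eval, eval_shift h e hb.1, eval_shift h f hb.2]
  | .hd e, hb => by simp [Exp.shift, Exp.eval, eval_shift h e hb]
  | .tl e, hb => by simp [Exp.shift, Exp.eval, eval_shift h e hb]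

theorem Runs.shift {c : Cmd} {σ τ : Store} {t : ℕ} (h : Runs c σ t τ) (k b : ℕ) :
    c.bound ≤ b → ∀ σ' : Store, (∀ i < b, σ' (i + k) = σ i) →
      ∃ τ', Runs (c.shift k) σ' t τ' ∧ (∀ i < b, τ' (i + k) = τ i) ∧ ∀ i < k, τ' i = σ' i := by
  induction h with
  | assign i e σ =>
    intro hb σ' h
    simp only [Cmd.bound, max_le_iff] at hb
    have he := Exp.eval_shift h e hb.2
    refine ⟨Function.update σ' (i + k) (e.eval σ), ?_, ?_, ?_⟩
    · rw [← he]; exact Runs.assign _ _ _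
    · intro j hj
      by_cases hji : j = i
      · subst hji; simp
      · rw [Function.update_of_ne (by omega), Function.update_of_ne hji, h j hj]
    · intro j hj
      rw [Function.update_of_ne (by omega)]
  | seq _ _ ih1 ih2 =>
    intro hb σ' h
    simp only [Cmd.bound, max_le_iff] at hb
    obtain ⟨τ1, r1, a1, b1⟩ := ih1 hb.1 σ' h
    obtain ⟨τ2, r2, a2, b2⟩ := ih2 hb.2 τ1 a1
    exact ⟨τ2, .seq r1 r2, a2, fun i hi => (b2 i hi).trans (b1 i hi)⟩
  | iteTrue he _ ih =>
    intro hb σ' h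
    simp only [Cmd.bound, max_le_iff] at hb
    obtain ⟨τ1, r1, a1, b1⟩ := ih hb.2.1 σ' h
    exact ⟨τ1, .iteTrue (by rwa [Exp.eval_shift h _ hb.1]) r1, a1, b1⟩
  | iteFalse he _ ih =>
    intro hb σ' h
    simp only [Cmd.bound, max_le_iff] at hb
    obtain ⟨τ1, r1, a1, b1⟩ := ih hb.2.2 σ' h
    exact ⟨τ1, .iteFalse (by rwa [Exp.eval_shift h _ hb.1]) r1, a1, b1⟩
  | loopDone he =>
    intro hb σ' h
    simp only [Cmd.bound, max_le_iff] at hb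
    exact ⟨σ', .loopDone (by rwa [Exp.eval_shift h _ hb.1]), h, fun _ _ => rfl⟩
  | loopStep he _ _ ih1 ih2 =>
    intro hb σ' h
    have hb' := hb
    simp only [Cmd.bound, max_le_iff] at hb
    obtain ⟨τ1, r1, a1, b1⟩ := ih1 hb.2 σ' h
    obtain ⟨τ2, r2, a2, b2⟩ := ih2 hb' τ1 a1
    exact ⟨τ2, .loopStep (by rwa [Exp.eval_shift h _ hb.1]) r1 r2, a2,
      fun i hi => (b2 i hi).trans (b1 i hi)⟩

/-- No register can become larger than the time spent, unless it was so from the start. -/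
theorem Runs.size_le {c : Cmd} {σ τ : Store} {t : ℕ} (h : Runs c σ t τ) (i : ℕ) :
    (τ i).size ≤ (σ i).size + t := by
  induction h with
  | assign j e σ =>
    by_cases hij : i = j
    · subst hij; simp; omega
    · simp [Function.update_of_ne hij]
  | _ => omega

/-- Stores `nil` in the registers `k, …, k + b - 1`. -/
def clear (k : ℕ) : ℕ → Cmd
  | 0 => .loop .nil (.assign 0 .nil)
  | b + 1 => .seq (clear k b) (.assign (k + b) .nil)

theorem runs_clear (k b : ℕ) (σ : Store) : ∃ τ, Runs (clear k b) σ (2 * b + 1) τ ∧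
    (∀ i < k, τ i = σ i) ∧ ∀ i < b, τ (k + i) = .nil := by
  induction b with
  | zero => exact ⟨σ, .loopDone rfl, fun _ _ => rfl, fun i hi => absurd hi (by omega)⟩
  | succ b ih =>
    obtain ⟨τ, r, h1, h2⟩ := ih
    refine ⟨_, (.seq r (.assign _ .nil _) : Runs (clear k (b + 1)) σ (2 * b + 1 + 2) _), ?_, ?_⟩
    · intro i hi
      rw [Function.update_of_ne (by omega), h1 i hi]
    · intro i hi
      by_cases hib : i = b
      · subst hib; simp [Exp.eval]
      · rw [Function.update_of_ne (by omega), h2 i (by omega)]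

/-- Subroutine: `c` replaces the content of register `k` by its image under `f`, in time bounded
by `p`, and leaves the registers below `k` alone. -/
def Calls (f : Val → Val) (k : ℕ) (c : Cmd) (p : Polynomial ℕ) : Prop :=
  ∀ σ : Store, ∃ t ≤ p.eval (σ k).size, ∃ τ : Store,
    Runs c σ t τ ∧ τ k = f (σ k) ∧ ∀ i < k, τ i = σ i

/-- A program becomes a subroutine when its registers are renamed and cleared. -/
theorem PolyTime.calls {f : Val → Val} (h : PolyTime f) (k : ℕ) : ∃ c p, Calls f k c p := by
  obtain ⟨c, p, hc⟩ := h
  refine ⟨.seq (clear (k + 1) c.bound) (c.shift k), p + Polynomial.C (2 * c.bound + 1), ?_⟩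
  intro σ
  obtain ⟨τ, r, h1, h2⟩ := runs_clear (k + 1) c.bound σ
  obtain ⟨t, ht, τ1, r1, e1⟩ := hc (σ k)
  obtain ⟨τ2, r2, a2, b2⟩ := r1.shift k (c.bound + 1) (by omega) τ (by
    intro i hi
    rcases Nat.eq_zero_or_pos i with rfl | hi0
    · simpa [initStore] using h1 k (by omega)
    · have := h2 (i - 1) (by omega)
      rw [show k + 1 + (i - 1) = i + k by omega] at this
      simp [initStore, this, hi0.ne'])
  refine ⟨2 * c.bound + 1 + t, ?_, τ2, .seq r r2, ?_, ?_⟩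
  · simp; omega
  · simpa [e1] using a2 0 (by omega)
  · intro i hi
    rw [b2 i hi, h1 i (by omega)]

theorem Calls.polyTime {f : Val → Val} {c : Cmd} {p : Polynomial ℕ} (h : Calls f 0 c p) :
    PolyTime f := by
  refine ⟨c, p, fun x => ?_⟩
  obtain ⟨t, ht, τ, r, e, -⟩ := h (initStore x)
  exact ⟨t, ht, τ, r, e⟩

theorem PolyTime.size_le {f : Val → Val} (h : PolyTime f) :
    ∃ p : Polynomial ℕ, ∀ x, (f x).size ≤ p.eval x.size := by
  obtain ⟨c, p, hc⟩ := h
  refine ⟨p + Polynomial.X, fun x => ?_⟩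
  obtain ⟨t, ht, τ, r, e⟩ := hc x
  have := r.size_le 0
  rw [e] at this
  simp [initStore] at this ⊢
  omega

/-! ### Closure properties of polynomial time -/

theorem PolyTime.congr {f g : Val → Val} (hf : PolyTime f) (h : ∀ x, g x = f x) : PolyTime g := by
  rwa [show g = f from funext h]

/-- The value of an expression of polynomial size in the input register is computed by a single
assignment. -/
theorem PolyTime.exp (e : Exp) (f : Val → Val) (hf : ∀ σ, e.eval σ = f (σ 0))
    (p : Polynomial ℕ) (hp : ∀ x, (f x).size ≤ p.eval x.size) : PolyTime f := by
  refine Calls.polyTime (c := .assign 0 e) (p := p + 1) fun σ => ?_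
  refine ⟨_, ?_, _, .assign _ _ _, ?_, fun i hi => absurd hi (by omega)⟩
  · simp [hf, hp]
  · simp [hf]

theorem PolyTime.id : PolyTime fun x => x :=
  .exp (.reg 0) _ (fun _ => rfl) Polynomial.X (by simp)

theorem PolyTime.hd : PolyTime Val.hd :=
  .exp (.hd (.reg 0)) _ (fun _ => rfl) Polynomial.X (by
    rintro (_ | ⟨a, b⟩) <;> simp [Val.hd, Val.size]; omega)

theorem PolyTime.tl : PolyTime Val.tl :=
  .exp (.tl (.reg 0)) _ (fun _ => rfl) Polynomial.X (by
    rintro (_ | ⟨a, b⟩) <;> simp [Val.tl, Val.size]; omega)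

/-- The closed expression with value `v`. -/
def Val.toExp : Val → Exp
  | .nil => .nil
  | .cons a b => .cons a.toExp b.toExp

theorem Val.eval_toExp (σ : Store) : ∀ v : Val, v.toExp.eval σ = v
  | .nil => rfl
  | .cons a b => by simp [toExp, Exp.eval, eval_toExp σ a, eval_toExp σ b]

theorem PolyTime.const (v : Val) : PolyTime fun _ => v :=
  .exp v.toExp _ (fun σ => v.eval_toExp σ) (Polynomial.C v.size) (by simp)

theorem PolyTime.comp {f g : Val → Val} (hg : PolyTime g) (hf : PolyTime f) :
    PolyTime fun x => g (f x) := by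
  obtain ⟨s, hs⟩ := hf.size_le
  obtain ⟨c, p, hc⟩ := hf.calls 0
  obtain ⟨d, q, hd⟩ := hg.calls 0
  refine Calls.polyTime (c := .seq c d) (p := p + q.comp s) fun σ => ?_
  obtain ⟨t, ht, τ, r, e, -⟩ := hc σ
  obtain ⟨t', ht', τ', r', e', -⟩ := hd τ
  refine ⟨_, ?_, _, .seq r r', by rw [e', e], fun i hi => absurd hi (by omega)⟩
  rw [Polynomial.eval_add, Polynomial.eval_comp]
  refine Nat.add_le_add ht (ht'.trans ?_)
  rw [e]
  exact poly_mono q (hs _)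

theorem PolyTime.cons {f g : Val → Val} (hf : PolyTime f) (hg : PolyTime g) :
    PolyTime fun x => .cons (f x) (g x) := by
  obtain ⟨sf, hsf⟩ := hf.size_le
  obtain ⟨sg, hsg⟩ := hg.size_le
  obtain ⟨c, p, hc⟩ := hf.calls 1
  obtain ⟨d, q, hd⟩ := hg.calls 2
  refine Calls.polyTime
    (c := .seq (.assign 1 (.reg 0)) (.seq c (.seq (.assign 2 (.reg 0)) (.seq d
      (.assign 0 (.cons (.reg 1) (.reg 2)))))))
    (p := (Polynomial.X + 1) + (p + ((Polynomial.X + 1) + (q + (sf + sg + 2))))) fun σ => ?_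
  obtain ⟨t, ht, τ, r, e, k⟩ := hc (Function.update σ 1 (σ 0))
  obtain ⟨t', ht', τ', r', e', k'⟩ := hd (Function.update τ 2 (τ 0))
  have k0 : τ 0 = σ 0 := by simpa using k 0 (by omega)
  have k1 : τ' 1 = τ 1 := by simpa using k' 1 (by omega)
  simp only [Function.update_self] at e e' ht ht'
  refine ⟨_, ?_, _, .seq (.assign _ _ _) (.seq r (.seq (.assign _ _ _)
    (.seq r' (.assign _ _ _)))), ?_, fun i hi => absurd hi (by omega)⟩
  · have h1 := hsf (σ 0)
    have h2 := hsg (σ 0)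
    simp only [Exp.eval, k0, k1, e, e', Val.size, Polynomial.eval_add, Polynomial.eval_X,
      Polynomial.eval_one, Polynomial.eval_ofNat] at ht ht' ⊢
    omega
  · simp [Exp.eval, k0, k1, e, e']

open Classical in
theorem PolyTime.ite {c f g : Val → Val} (hc : PolyTime c) (hf : PolyTime f) (hg : PolyTime g) :
    PolyTime fun x => if c x ≠ .nil then f x else g x := by
  obtain ⟨cc, pc, hcc⟩ := hc.calls 1
  obtain ⟨cf, pf, hcf⟩ := hf.calls 0
  obtain ⟨cg, pg, hcg⟩ := hg.calls 0
  refine Calls.polyTime (c := .seq (.assign 1 (.reg 0)) (.seq cc (.ite (.reg 1) cf cg)))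
    (p := (Polynomial.X + 1) + (pc + (pf + pg + 1))) fun σ => ?_
  obtain ⟨t, ht, τ, r, e, k⟩ := hcc (Function.update σ 1 (σ 0))
  have k0 : τ 0 = σ 0 := by simpa using k 0 (by omega)
  simp only [Function.update_self] at e ht
  by_cases h : c (σ 0) = .nil
  · obtain ⟨t', ht', τ', r', e', -⟩ := hcg τ
    rw [k0] at e' ht'
    refine ⟨_, ?_, _, .seq (.assign _ _ _) (.seq r (.iteFalse (by simpa [Exp.eval, e] using h) r')),
      by simp [h, e'], fun i hi => absurd hi (by omega)⟩
    simp [Exp.eval]; omega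
  · obtain ⟨t', ht', τ', r', e', -⟩ := hcf τ
    rw [k0] at e' ht'
    refine ⟨_, ?_, _, .seq (.assign _ _ _) (.seq r (.iteTrue (by simpa [Exp.eval, e] using h) r')),
      by simp [h, e'], fun i hi => absurd hi (by omega)⟩
    simp [Exp.eval]; omega

/-- A loop whose number of rounds and whose intermediate states are polynomially bounded. -/
theorem PolyTime.whileLoop {test init step : Val → Val} (ht : PolyTime test) (hi : PolyTime init)
    (hs : PolyTime step) (N : Val → ℕ) (P B : Polynomial ℕ) (hN : ∀ x, N x ≤ P.eval x.size)
    (hcont : ∀ x, ∀ i < N x, test (step^[i] (init x)) ≠ .nil)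
    (hend : ∀ x, test (step^[N x] (init x)) = .nil)
    (hB : ∀ x, ∀ i ≤ N x, (step^[i] (init x)).size ≤ B.eval x.size) :
    PolyTime fun x => step^[N x] (init x) := by
  obtain ⟨ct, pt, hct⟩ := ht.calls 1
  obtain ⟨cs, ps, hcs⟩ := hs.calls 0
  set body : Cmd := .seq cs (.seq (.assign 1 (.reg 0)) ct) with hbody
  have key : ∀ (k M : ℕ) (σ : Store), σ 1 = test (σ 0) →
      (∀ i < k, test (step^[i] (σ 0)) ≠ .nil) → test (step^[k] (σ 0)) = .nil →
      (∀ i ≤ k, (step^[i] (σ 0)).size ≤ M) →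
      ∃ t ≤ k * (ps.eval M + (M + 1) + pt.eval M + 1) + 1, ∃ τ,
        Runs (.loop (.reg 1) body) σ t τ ∧ τ 0 = step^[k] (σ 0) := by
    intro k M
    induction k with
    | zero =>
      intro σ h1 _ h3 _
      exact ⟨1, by omega, σ, .loopDone (by simpa [Exp.eval, h1] using h3), rfl⟩
    | succ k ih =>
      intro σ h1 h2 h3 h4
      obtain ⟨t, ht, τ, r, e, -⟩ := hcs σ
      obtain ⟨t', ht', τ', r', e', k'⟩ := hct (Function.update τ 1 (τ 0))
      have k0 : τ' 0 = τ 0 := by simpa using k' 0 (by omega)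
      simp only [Function.update_self] at e' ht'
      have e0 : τ' 0 = step (σ 0) := k0.trans e
      obtain ⟨t'', ht'', τ'', r'', e''⟩ := ih τ' (by rw [e', k0])
        (by intro i hi; rw [e0]; exact h2 (i + 1) (by omega)) (by rw [e0]; exact h3)
        (by intro i hi; rw [e0]; exact h4 (i + 1) (by omega))
      refine ⟨_, ?_, τ'', .loopStep ?_ (.seq r (.seq (.assign _ _ _) r')) r'', ?_⟩
      · have a0 := ht.trans (poly_mono ps (h4 0 (by omega)))
        have s1 : (τ 0).size ≤ M := by rw [e]; exact h4 1 (by omega)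
        have a1 := ht'.trans (poly_mono pt s1)
        have := Nat.add_mul k 1 (ps.eval M + (M + 1) + pt.eval M + 1)
        simp only [Exp.eval]
        simp only at a0 a1
        omega
      · have := h2 0 (by omega)
        simpa [Exp.eval, h1] using this
      · rw [e'', e0]; rfl
  obtain ⟨ci, pi, hci⟩ := hi.calls 0
  obtain ⟨si, hsi⟩ := hi.size_le
  refine Calls.polyTime
    (c := .seq ci (.seq (.assign 1 (.reg 0)) (.seq ct (.loop (.reg 1) body))))
    (p := pi + ((si + 1) + (pt.comp si + (P * (ps.comp B + (B + 1) + pt.comp B + 1) + 1))))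
    fun σ => ?_
  obtain ⟨t0, ht0, τ0, r0, e0, -⟩ := hci σ
  obtain ⟨t', ht', τ', r', e', k'⟩ := hct (Function.update τ0 1 (τ0 0))
  have k0 : τ' 0 = init (σ 0) := by simpa [e0] using k' 0 (by omega)
  simp only [Function.update_self, e0] at e' ht'
  obtain ⟨t, htt, τ, r, e⟩ := key (N (σ 0)) (B.eval (σ 0).size) τ' (by rw [e', k0])
    (by rw [k0]; exact hcont _) (by rw [k0]; exact hend _) (by rw [k0]; exact hB _)
  refine ⟨_, ?_, τ, .seq r0 (.seq (.assign _ _ _) (.seq r' r)), by rw [e, k0],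
    fun i hi => absurd hi (by omega)⟩
  have h1 := Nat.mul_le_mul_right
    (ps.eval (B.eval (σ 0).size) + (B.eval (σ 0).size + 1) + pt.eval (B.eval (σ 0).size) + 1)
    (hN (σ 0))
  have h2 := hsi (σ 0)
  have h3 := poly_mono pt h2
  simp only [Exp.eval, Polynomial.eval_add, Polynomial.eval_mul, Polynomial.eval_comp,
    Polynomial.eval_one, e0] at *
  omega

theorem Val.toNat_lt_size : ∀ v : Val, v.toNat < v.size
  | .nil => by simp [Val.toNat, Val.size]
  | .cons a b => by have := toNat_lt_size b; simp [Val.toNat, Val.size]; omega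

theorem Val.size_tl_le (v : Val) : v.tl.size ≤ v.size := by
  cases v <;> simp [Val.tl, Val.size]; omega

theorem Val.size_hd_le (v : Val) : v.hd.size ≤ v.size := by
  cases v <;> simp [Val.hd, Val.size]; omega

theorem Val.size_iterate_tl_le (v : Val) (i : ℕ) : (Val.tl^[i] v).size ≤ v.size := by
  induction i with
  | zero => rfl
  | succ i ih => rw [Function.iterate_succ_apply']; exact (Val.size_tl_le _).trans ih

theorem Val.iterate_tl_eq_nil (v : Val) (i : ℕ) : Val.tl^[i] v = .nil ↔ v.toNat ≤ i := by
  induction v generalizing i with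
  | nil =>
    have : Val.tl^[i] .nil = .nil := Function.iterate_fixed rfl i
    simp [this, Val.toNat]
  | cons a b _ ih =>
    cases i with
    | zero => simp [Val.toNat]
    | succ i => simp [Function.iterate_succ_apply, Val.tl, ih, Val.toNat]

/-- Iteration, as often as the unary number `cnt x` says. -/
theorem PolyTime.iter {cnt init step : Val → Val} (hc : PolyTime cnt) (hi : PolyTime init)
    (hs : PolyTime step) (B : Polynomial ℕ)
    (hB : ∀ x, ∀ i ≤ (cnt x).toNat, (step^[i] (init x)).size ≤ B.eval x.size) :
    PolyTime fun x => step^[(cnt x).toNat] (init x) := by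
  obtain ⟨q, hq⟩ := hc.size_le
  -- The state consists of the counter, which is consumed from its end, and the current value.
  let step' : Val → Val := fun s => .cons s.hd.tl (step s.tl)
  have hit : ∀ s v i, step'^[i] (.cons s v) = .cons (Val.tl^[i] s) (step^[i] v) := by
    intro s v i
    induction i with
    | zero => rfl
    | succ i ih => simp only [Function.iterate_succ_apply', ih, step', Val.hd_cons, Val.tl_cons]
  have hw : PolyTime fun x => step'^[(cnt x).toNat] (.cons (cnt x) (init x)) := by
    refine PolyTime.whileLoop .hd (.cons hc hi) (.cons (.comp .tl .hd) (.comp hs .tl))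
      (fun x => (cnt x).toNat) q (q + B + 1) ?_ ?_ ?_ ?_
    · exact fun x => (Val.toNat_lt_size _).le.trans (hq x)
    · intro x i hi
      rw [hit]
      simp only [Val.hd_cons, ne_eq, Val.iterate_tl_eq_nil]
      omega
    · intro x
      rw [hit]
      simp only [Val.hd_cons, Val.iterate_tl_eq_nil, le_refl]
    · intro x i hi
      rw [hit]
      have h1 := (Val.size_iterate_tl_le (cnt x) i).trans (hq x)
      have h2 := hB x i hi
      simp only [Val.size, Polynomial.eval_add, Polynomial.eval_one]
      omega
  have := PolyTime.tl.comp hw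
  simpa only [hit, Val.tl_cons] using this

theorem Val.toList_ofList (l : List Val) : (Val.ofList l).toList = l := by
  induction l with
  | nil => rfl
  | cons a l ih => simp [ofList, toList, ih]

theorem Val.toNat_ofNat (n : ℕ) : (Val.ofNat n).toNat = n := by
  induction n with
  | zero => rfl
  | succ n ih => simp [ofNat, toNat, ih]

theorem Val.size_ofNat (n : ℕ) : (Val.ofNat n).size = 2 * n + 1 := by
  induction n with
  | zero => rfl
  | succ n ih => simp [ofNat, size, ih]; omega

theorem Val.length_toList (v : Val) : v.toList.length = v.toNat := by
  induction v with
  | nil => rfl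
  | cons a b _ ih => simp [toList, toNat, ih]

/-- A loop that consumes the list in the middle component and pushes images of its
entries onto the list in the last component. -/
theorem Val.iterate_push (F : Val → Val → Val) (a : Val) (i : ℕ) : ∀ (v acc : Val), i ≤ v.toNat →
    (fun s : Val => Val.cons s.hd (.cons s.tl.hd.tl (.cons (F s.hd s.tl.hd.hd) s.tl.tl)))^[i]
      (.cons a (.cons v acc)) = .cons a (.cons (Val.tl^[i] v)
        (Val.ofList (((v.toList.take i).map (F a)).reverse ++ acc.toList))) := by
  induction i with
  | zero =>
    intro v acc _
    have : Val.ofList acc.toList = acc := by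
      clear * -
      induction acc with
      | nil => rfl
      | cons a b _ ih => simp [toList, ofList, ih]
    simp [this]
  | succ i ih =>
    intro v acc h
    cases v with
    | nil => simp [toNat] at h
    | cons u v =>
      rw [Function.iterate_succ_apply]
      simp only [Val.hd_cons, Val.tl_cons]
      rw [ih _ _ (by simpa [toNat] using h)]
      simp [Function.iterate_succ_apply, toList]

theorem Val.size_of_mem_toList {u v : Val} (h : u ∈ v.toList) : u.size < v.size := by
  induction v with
  | nil => simp [toList] at h
  | cons a b _ ih =>
    rcases List.mem_cons.1 h with rfl | h
    · simp only [size]; omega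
    · have := ih h; simp [size]; omega

theorem Val.size_ofList_le (l : List Val) (M : ℕ) (h : ∀ v ∈ l, v.size ≤ M) :
    (Val.ofList l).size ≤ l.length * (M + 1) + 1 := by
  induction l with
  | nil => simp [ofList, size]
  | cons a l ih =>
    have := ih fun v hv => h v (List.mem_cons_of_mem _ hv)
    have := h a List.mem_cons_self
    simp only [ofList, size, List.length_cons, Nat.add_mul, one_mul]
    omega

/-- A loop that pushes the images onto a new list reverses the order. -/
theorem PolyTime.mapRev {f : Val → Val} (hf : PolyTime f) :
    PolyTime fun v => Val.ofList (v.tl.toList.map fun u => f (.cons v.hd u)).reverse := by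
  obtain ⟨p, hp⟩ := hf.size_le
  have hs : PolyTime fun s : Val => Val.cons s.hd (.cons s.tl.hd.tl
      (.cons (f (.cons s.hd s.tl.hd.hd)) s.tl.tl)) :=
    .cons .hd (.cons (.comp .tl (.comp .hd .tl)) (.cons
      (.comp hf (.cons .hd (.comp .hd (.comp .hd .tl)))) (.comp .tl .tl)))
  have h := PolyTime.iter (init := fun v => .cons v.hd (.cons v.tl .nil)) .tl
    (.cons .hd (.cons .tl (.const .nil))) hs
    (Polynomial.X + Polynomial.X + Polynomial.X * (p.comp (Polynomial.X + Polynomial.X + 1) + 1)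
      + 3) ?_
  · have h2 := (PolyTime.comp .tl (.comp .tl h))
    refine h2.congr fun v => ?_
    rw [Val.iterate_push (fun a u => f (.cons a u)) _ _ _ _ le_rfl]
    simp [Val.toList, ← Val.length_toList]
  · intro v i hi
    rw [Val.iterate_push (fun a u => f (.cons a u)) _ _ _ _ hi]
    have h1 := v.size_hd_le
    have h2 := v.size_tl_le
    have h3 := Val.size_iterate_tl_le v.tl i
    have h4 := Val.size_ofList_le (((v.tl.toList.take i).map fun u => f (.cons v.hd u)).reverse
      ++ Val.nil.toList) (p.eval (v.size + v.size + 1)) (by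
        intro w hw
        simp only [Val.toList, List.append_nil, List.mem_reverse, List.mem_map] at hw
        obtain ⟨u, hu, rfl⟩ := hw
        refine (hp _).trans (poly_mono p ?_)
        have := Val.size_of_mem_toList (List.mem_of_mem_take hu)
        simp only [Val.size]
        omega)
    have h5 : (((v.tl.toList.take i).map fun u => f (.cons v.hd u)).reverse
      ++ Val.nil.toList).length ≤ v.size := by
      have := Val.toNat_lt_size v.tl
      simp [Val.toList, Val.length_toList]
      omega
    have h6 := Nat.mul_le_mul_right (p.eval (v.size + v.size + 1) + 1) h5
    simp only [Val.size, Polynomial.eval_add, Polynomial.eval_mul, Polynomial.eval_comp,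
      Polynomial.eval_X, Polynomial.eval_one, Polynomial.eval_ofNat]
    omega

theorem PolyTime.map {f : Val → Val} (hf : PolyTime f) :
    PolyTime fun v => Val.ofList (v.tl.toList.map fun u => f (.cons v.hd u)) := by
  have h := PolyTime.mapRev (f := Val.tl) .tl
  have := h.comp (PolyTime.cons (.const .nil) (PolyTime.mapRev hf))
  refine this.congr fun v => ?_
  simp [Val.toList_ofList, Function.comp_def]

theorem PolyTime.ofNat_toNat : PolyTime fun v => Val.ofNat v.toNat := by
  have h := (PolyTime.map (f := fun _ => .nil) (.const _)).comp (.cons (.const .nil) .id)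
  refine h.congr fun v => ?_
  simp only [Val.tl_cons, List.map_const', Val.length_toList]
  generalize v.toNat = n
  induction n with
  | zero => rfl
  | succ n ih => simp [Val.ofNat, List.replicate_succ, Val.ofList, ih]

/-! ### Polynomial time for functions between coded types -/

/-- A type whose elements are coded by trees. Every tree is the code of some element, and a tree
can be brought into canonical form in polynomial time. -/
class PCode (α : Type) where
  enc : α → Val
  dec : Val → α
  dec_enc : ∀ a, dec (enc a) = a
  norm : PolyTime fun v => enc (dec v)

/-- `f` is computable in polynomial time with respect to the codes of its domain and range. -/
@[fun_prop]
def PF {α β : Type} [PCode α] [PCode β] (f : α → β) : Prop :=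
  PolyTime fun v => PCode.enc (f (PCode.dec v))

section basic
variable {α β γ δ σ : Type} [PCode α] [PCode β] [PCode γ] [PCode δ] [PCode σ]

theorem PF.size_le {f : α → β} (hf : PF f) :
    ∃ p : Polynomial ℕ, ∀ a, (PCode.enc (f a)).size ≤ p.eval (PCode.enc a).size := by
  obtain ⟨p, hp⟩ := PolyTime.size_le hf
  exact ⟨p, fun a => by simpa [PCode.dec_enc] using hp (PCode.enc a)⟩

@[fun_prop] theorem PF.id : PF fun a : α => a := PCode.norm

@[fun_prop] theorem PF.const (b : β) : PF fun _ : α => b := PolyTime.const _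

@[fun_prop] theorem PF.comp {g : β → γ} {f : α → β} (hg : PF g) (hf : PF f) :
    PF fun a => g (f a) :=
  (PolyTime.comp hg hf).congr fun v => by simp [PCode.dec_enc]

instance : PCode Val := ⟨fun v => v, fun v => v, fun _ => rfl, PolyTime.id⟩

theorem PF.of_val {g : Val → Val} (hg : PolyTime g) : PF g := hg

theorem PF.enc : PF (PCode.enc : α → Val) := PCode.norm

theorem PF.dec : PF (PCode.dec : Val → α) := PCode.norm

instance : PCode ℕ := ⟨Val.ofNat, Val.toNat, Val.toNat_ofNat, PolyTime.ofNat_toNat⟩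

instance : PCode Bool where
  enc := Val.ofBool
  dec v := match v with
    | .nil => false
    | .cons _ _ => true
  dec_enc b := by cases b <;> rfl
  norm := (PolyTime.ite .id (.const (.cons .nil .nil)) (.const .nil)).congr fun v => by
    cases v <;> simp [Val.ofBool]

instance : PCode (α × β) where
  enc p := .cons (PCode.enc p.1) (PCode.enc p.2)
  dec v := (PCode.dec v.hd, PCode.dec v.tl)
  dec_enc p := by simp [PCode.dec_enc]
  norm := .cons (.comp (PCode.norm (α := α)) .hd) (.comp (PCode.norm (α := β)) .tl)

instance : PCode (List α) where
  enc l := .ofList (l.map PCode.enc)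
  dec v := v.toList.map PCode.dec
  dec_enc l := by simp [Val.toList_ofList, Function.comp_def, PCode.dec_enc]
  norm := ((PolyTime.map (PolyTime.comp (PCode.norm (α := α)) .tl)).comp
    (.cons (.const .nil) .id)).congr fun v => by simp [Function.comp_def]

theorem enc_nat (n : ℕ) : PCode.enc n = Val.ofNat n := rfl
theorem enc_bool (b : Bool) : PCode.enc b = Val.ofBool b := rfl
theorem enc_pair (p : α × β) : PCode.enc p = .cons (PCode.enc p.1) (PCode.enc p.2) := rfl
theorem enc_list (l : List α) : PCode.enc l = .ofList (l.map PCode.enc) := rfl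
theorem enc_val (v : Val) : PCode.enc v = v := rfl

@[fun_prop] theorem PF.mk {f : α → β} {g : α → γ} (hf : PF f) (hg : PF g) :
    PF fun a => (f a, g a) := PolyTime.cons hf hg

@[fun_prop] theorem PF.fst {f : α → β × γ} (hf : PF f) : PF fun a => (f a).1 :=
  (PolyTime.comp .hd hf).congr fun v => by simp [enc_pair]

@[fun_prop] theorem PF.snd {f : α → β × γ} (hf : PF f) : PF fun a => (f a).2 :=
  (PolyTime.comp .tl hf).congr fun v => by simp [enc_pair]

@[fun_prop] theorem PF.bif {c : α → Bool} {f g : α → β} (hc : PF c) (hf : PF f) (hg : PF g) :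
    PF fun a => _root_.cond (c a) (f a) (g a) :=
  (PolyTime.ite hc hf hg).congr fun v => by
    cases h : c (PCode.dec v) <;> simp [enc_bool, h, Val.ofBool]

@[fun_prop] theorem PF.not {f : α → Bool} (hf : PF f) : PF fun a => !(f a) :=
  (PF.bif hf (.const false) (.const true)).congr fun v => by cases h : f (PCode.dec v) <;> simp [h]

@[fun_prop] theorem PF.and {f g : α → Bool} (hf : PF f) (hg : PF g) : PF fun a => f a && g a :=
  (PF.bif hf hg (.const false)).congr fun v => by cases h : f (PCode.dec v) <;> simp [h]

@[fun_prop] theorem PF.or {f g : α → Bool} (hf : PF f) (hg : PF g) : PF fun a => f a || g a :=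
  (PF.bif hf (.const true) hg).congr fun v => by cases h : f (PCode.dec v) <;> simp [h]

@[fun_prop] theorem PF.xor {f g : α → Bool} (hf : PF f) (hg : PF g) :
    PF fun a => f a ^^ g a :=
  (PF.bif hf hg.not hg).congr fun v => by
    cases h : f (PCode.dec v) <;> simp [h]

/-- Iteration with a polynomially bounded number of rounds and polynomially bounded states. -/
theorem PF.iterate {cnt : α → ℕ} {init : α → σ} {step : α → σ → σ} (hc : PF cnt) (hi : PF init)
    (hs : PF fun p : α × σ => step p.1 p.2)
    (hB : ∃ B : Polynomial ℕ, ∀ a, ∀ i ≤ cnt a,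
      (PCode.enc ((step a)^[i] (init a))).size ≤ B.eval (PCode.enc a).size) :
    PF fun a => (step a)^[cnt a] (init a) := by
  obtain ⟨B, hB⟩ := hB
  obtain ⟨q, hq⟩ := (PCode.norm (α := α)).size_le
  have hs' : PF fun p : α × σ => (p.1, step p.1 p.2) := by fun_prop
  have hi' : PF fun a : α => (a, init a) := by fun_prop
  have hit : ∀ (a : α) (s : σ) (i : ℕ),
      (fun v => PCode.enc ((fun p : α × σ => (p.1, step p.1 p.2)) (PCode.dec v)))^[i]
        (PCode.enc (a, s)) = PCode.enc (a, (step a)^[i] s) := by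
    intro a s i
    induction i with
    | zero => rfl
    | succ i ih => simp only [Function.iterate_succ_apply', ih, PCode.dec_enc]
  have h := PolyTime.iter hc hi' hs' (q + B.comp q + 1) (by
    intro x i hx
    rw [hit]
    have h1 := hB (PCode.dec x) i (by simpa [enc_nat, Val.toNat_ofNat] using hx)
    have h2 := poly_mono B (hq x)
    have h3 := hq x
    simp only [enc_pair, Val.size, Polynomial.eval_add, Polynomial.eval_comp,
      Polynomial.eval_one] at *
    omega)
  have h' : PolyTime fun x : Val =>
      PCode.enc ((PCode.dec x : α), (step (PCode.dec x))^[cnt (PCode.dec x)] (init (PCode.dec x))) := by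
    refine h.congr fun x => ?_
    rw [hit]
    simp [enc_nat, Val.toNat_ofNat]
  exact (PolyTime.comp .tl h').congr fun x => by simp [enc_pair]

/-! ### Arithmetic in unary -/

theorem size_enc_nat (n : ℕ) : (PCode.enc n).size = 2 * n + 1 := Val.size_ofNat n

theorem size_enc_pair (p : α × β) :
    (PCode.enc p).size = (PCode.enc p.1).size + (PCode.enc p.2).size + 1 := rfl

theorem size_enc_bool (b : Bool) : (PCode.enc b).size ≤ 3 := by
  cases b <;> simp [enc_bool, Val.ofBool, Val.size]

@[fun_prop] theorem PF.succ {f : α → ℕ} (hf : PF f) : PF fun a => f a + 1 :=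
  (PolyTime.cons (.const .nil) hf).congr fun _ => rfl

theorem PF.pred {f : α → ℕ} (hf : PF f) : PF fun a => f a - 1 :=
  (PolyTime.comp .tl hf).congr fun v => by
    cases h : f (PCode.dec v) <;> simp [h, enc_nat, Val.ofNat, Val.tl]

/-- A polynomial bound on the size of a product of two natural-number valued functions, or of
anything smaller. -/
theorem exists_size_bound {f g : α → ℕ} (hf : PF f) (hg : PF g) :
    ∃ B : Polynomial ℕ, ∀ a, f a * g a + f a + g a + 1 ≤ B.eval (PCode.enc a).size := by
  obtain ⟨p, hp⟩ := hf.size_le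
  obtain ⟨q, hq⟩ := hg.size_le
  refine ⟨p * q + p + q + 1, fun a => ?_⟩
  have h1 := hp a
  have h2 := hq a
  rw [size_enc_nat] at h1 h2
  have := Nat.mul_le_mul (show f a ≤ p.eval (PCode.enc a).size by omega)
    (show g a ≤ q.eval (PCode.enc a).size by omega)
  simp only [Polynomial.eval_add, Polynomial.eval_mul, Polynomial.eval_one]
  omega

theorem iterate_succ_nat (n i : ℕ) : (fun n => n + 1)^[i] n = n + i := Nat.succ_iterate n i

@[fun_prop] theorem PF.add {f g : α → ℕ} (hf : PF f) (hg : PF g) : PF fun a => f a + g a := by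
  obtain ⟨B, hB⟩ := exists_size_bound hf hg
  have h := PF.iterate (step := fun _ n => n + 1) hg hf (by fun_prop) ⟨2 * B + 1, fun a i hi => by
    have := hB a
    simp only [iterate_succ_nat, size_enc_nat, Polynomial.eval_add, Polynomial.eval_mul,
      Polynomial.eval_ofNat, Polynomial.eval_one]
    have := Nat.zero_le (f a * g a)
    omega⟩
  simpa [iterate_succ_nat] using h

theorem iterate_pred (n i : ℕ) : (fun n => n - 1)^[i] n = n - i := by
  induction i with
  | zero => rfl
  | succ i ih => rw [Function.iterate_succ_apply', ih]; omega

@[fun_prop] theorem PF.sub {f g : α → ℕ} (hf : PF f) (hg : PF g) : PF fun a => f a - g a := by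
  obtain ⟨B, hB⟩ := exists_size_bound hf hg
  have h := PF.iterate (step := fun _ n => n - 1) hg hf (.pred (by fun_prop))
    ⟨2 * B + 1, fun a i hi => by
    have := hB a
    simp only [iterate_pred, size_enc_nat, Polynomial.eval_add, Polynomial.eval_mul,
      Polynomial.eval_ofNat, Polynomial.eval_one]
    have := Nat.zero_le (f a * g a)
    omega⟩
  simpa [iterate_pred] using h

theorem iterate_add_left (n m i : ℕ) : (fun k => k + n)^[i] m = m + i * n := by
  induction i with
  | zero => simp
  | succ i ih => rw [Function.iterate_succ_apply', ih]; ring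

@[fun_prop] theorem PF.mul {f g : α → ℕ} (hf : PF f) (hg : PF g) : PF fun a => f a * g a := by
  obtain ⟨B, hB⟩ := exists_size_bound hf hg
  have h := PF.iterate (step := fun a n => n + g a) hf (.const 0) (by fun_prop)
    ⟨2 * B + 1, fun a i hi => by
    have := hB a
    have h2 := Nat.mul_le_mul_right (g a) hi
    simp only [iterate_add_left, size_enc_nat, Polynomial.eval_add, Polynomial.eval_mul,
      Polynomial.eval_ofNat, Polynomial.eval_one]
    omega⟩
  simpa [iterate_add_left] using h

theorem PF.isZero {f : α → ℕ} (hf : PF f) : PF fun a => decide (f a = 0) :=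
  (PolyTime.ite hf (.const (Val.ofBool false)) (.const (Val.ofBool true))).congr fun v => by
    cases h : f (PCode.dec v) <;> simp [h, enc_nat, enc_bool, Val.ofNat]

@[fun_prop] theorem PF.le {f g : α → ℕ} (hf : PF f) (hg : PF g) :
    PF fun a => decide (f a ≤ g a) := by
  simpa [Nat.sub_eq_zero_iff_le] using (hf.sub hg).isZero

@[fun_prop] theorem PF.lt {f g : α → ℕ} (hf : PF f) (hg : PF g) :
    PF fun a => decide (f a < g a) := hf.succ.le hg

@[fun_prop] theorem PF.natEq {f g : α → ℕ} (hf : PF f) (hg : PF g) :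
    PF fun a => decide (f a = g a) := by
  simpa [← Bool.decide_and, ← Nat.le_antisymm_iff] using (hf.le hg).and (hg.le hf)

/-- One round of division with remainder by counting. -/
theorem iterate_divMod (w i : ℕ) :
    (fun s : ℕ × ℕ => cond (decide (s.2 + 1 = w)) (s.1 + 1, 0) (s.1, s.2 + 1))^[i] (0, 0)
      = (i / w, i % w) := by
  induction i with
  | zero => simp
  | succ i ih =>
    rw [Function.iterate_succ_apply', ih]
    rcases Nat.eq_zero_or_pos w with rfl | hw
    · simp
    · have h1 := Nat.div_add_mod i w
      have h2 := Nat.mod_lt i hw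
      by_cases h : i % w + 1 = w
      · have e : i + 1 = w * (i / w + 1) := by rw [Nat.mul_add]; omega
        simp only [h, decide_true, cond_true, Prod.mk.injEq]
        rw [e, Nat.mul_div_cancel_left _ hw, Nat.mul_mod_right]
        exact ⟨rfl, rfl⟩
      · have h3 : i % w + 1 < w := by omega
        have e : i + 1 = (i % w + 1) + w * (i / w) := by omega
        simp only [h, decide_false, cond_false, Prod.mk.injEq]
        rw [e, Nat.add_mul_div_left _ _ hw, Nat.add_mul_mod_self_left,
          Nat.div_eq_of_lt h3, Nat.mod_eq_of_lt h3, zero_add]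
        exact ⟨rfl, rfl⟩

theorem PF.divMod {f g : α → ℕ} (hf : PF f) (hg : PF g) : PF fun a => (f a / g a, f a % g a) := by
  obtain ⟨B, hB⟩ := exists_size_bound hf hg
  have h := PF.iterate (init := fun _ => ((0 : ℕ), (0 : ℕ)))
    (step := fun a s => _root_.cond (decide (s.2 + 1 = g a)) (s.1 + 1, 0) (s.1, s.2 + 1)) hf (.const _)
    (by fun_prop) ⟨4 * B + 3, fun a i hi => by
    have := hB a
    have h1 := Nat.div_le_self i (g a)
    have h2 := Nat.mod_le i (g a)
    simp only [iterate_divMod, size_enc_pair, size_enc_nat, Polynomial.eval_add,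
      Polynomial.eval_mul, Polynomial.eval_ofNat]
    have := Nat.zero_le (f a * g a)
    omega⟩
  simpa [iterate_divMod] using h

@[fun_prop] theorem PF.div {f g : α → ℕ} (hf : PF f) (hg : PF g) : PF fun a => f a / g a :=
  (hf.divMod hg).fst

@[fun_prop] theorem PF.mod {f g : α → ℕ} (hf : PF f) (hg : PF g) : PF fun a => f a % g a :=
  (hf.divMod hg).snd

@[fun_prop] theorem PF.polyEval (p : Polynomial ℕ) {f : α → ℕ} (hf : PF f) :
    PF fun a => p.eval (f a) := by
  induction p using Polynomial.induction_on' with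
  | add p q hp hq => simpa using hp.add hq
  | monomial n c =>
    have : PF fun a => f a ^ n := by
      induction n with
      | zero => simpa using PF.const 1
      | succ n ih => simpa [pow_succ] using ih.mul hf
    simpa using (PF.const c).mul this

/-! ### Lists -/

theorem size_enc_list (l : List α) :
    (PCode.enc l).size = (l.map fun x => (PCode.enc x).size + 1).sum + 1 := by
  rw [enc_list]
  induction l with
  | nil => rfl
  | cons a l ih => simp only [List.map_cons, Val.ofList, Val.size, ih, List.sum_cons]; omega

theorem size_enc_take_le (l : List α) (i : ℕ) :
    (PCode.enc (l.take i)).size ≤ (PCode.enc l).size := by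
  conv_rhs => rw [← List.take_append_drop i l]
  simp only [size_enc_list, List.map_append, List.sum_append]
  omega

theorem size_enc_drop_le (l : List α) (i : ℕ) :
    (PCode.enc (l.drop i)).size ≤ (PCode.enc l).size := by
  conv_rhs => rw [← List.take_append_drop i l]
  simp only [size_enc_list, List.map_append, List.sum_append]
  omega

@[fun_prop] theorem PF.length {l : α → List β} (hl : PF l) : PF fun a => (l a).length :=
  (PolyTime.comp .ofNat_toNat hl).congr fun v => by
    rw [← Val.length_toList, enc_list, Val.toList_ofList, List.length_map]; rfl

@[fun_prop] theorem PF.listCons {f : α → β} {l : α → List β} (hf : PF f) (hl : PF l) :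
    PF fun a => f a :: l a := PolyTime.cons hf hl

@[fun_prop] theorem PF.tail {l : α → List β} (hl : PF l) : PF fun a => (l a).tail :=
  (PolyTime.comp .tl hl).congr fun v => by cases h : l (PCode.dec v) <;> simp [h, enc_list] <;> rfl

@[fun_prop] theorem PF.headD {l : α → List β} {d : α → β} (hl : PF l) (hd : PF d) :
    PF fun a => (l a).headD (d a) :=
  (PolyTime.ite hl (.comp .hd hl) hd).congr fun v => by
    cases h : l (PCode.dec v) <;> simp [h, enc_list, Val.ofList]

@[fun_prop] theorem PF.map {l : α → List β} {f : α → β → γ} (hl : PF l)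
    (hf : PF fun p : α × β => f p.1 p.2) : PF fun a => (l a).map (f a) := by
  have h := (PolyTime.map hf).comp (PolyTime.cons .id hl)
  refine h.congr fun v => ?_
  simp [enc_list, Val.toList_ofList, Function.comp_def, PCode.dec, PCode.dec_enc]

/-- Folding over a list, when the intermediate states are polynomially bounded. -/
theorem PF.foldl {l : α → List β} {s : α → σ} {f : α → σ → β → σ} (hl : PF l) (hs : PF s)
    (hf : PF fun p : α × σ × β => f p.1 p.2.1 p.2.2)
    (hB : ∃ B : Polynomial ℕ, ∀ a i,
      (PCode.enc (((l a).take i).foldl (f a) (s a))).size ≤ B.eval (PCode.enc a).size) :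
    PF fun a => (l a).foldl (f a) (s a) := by
  obtain ⟨B, hB⟩ := hB
  obtain ⟨p, hp⟩ := hl.size_le
  let d : β := PCode.dec .nil
  have hit : ∀ a i, i ≤ (l a).length →
      (fun t : List β × σ => (t.1.tail, f a t.2 (t.1.headD d)))^[i] (l a, s a)
        = ((l a).drop i, ((l a).take i).foldl (f a) (s a)) := by
    intro a i hi
    induction i with
    | zero => simp
    | succ i ih =>
      rw [Function.iterate_succ_apply', ih (by omega)]
      have hi' : i < (l a).length := by omega
      rw [List.take_add_one, List.drop_eq_getElem_cons hi', List.foldl_append,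
        List.getElem?_eq_getElem hi']
      rfl
  have hf' : PF fun q : α × List β × σ => f q.1 q.2.2 (q.2.1.headD d) :=
    PF.comp (g := fun p : α × σ × β => f p.1 p.2.1 p.2.2)
      (f := fun q : α × List β × σ => (q.1, q.2.2, q.2.1.headD d)) hf (by fun_prop)
  have h := PF.iterate (cnt := fun a => (l a).length) (init := fun a => (l a, s a))
    (step := fun a t => (t.1.tail, f a t.2 (t.1.headD d))) (by fun_prop) (by fun_prop)
    (.mk (by fun_prop) hf') ⟨p + B + 1, fun a i hi => by
      rw [hit a i hi, size_enc_pair]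
      have h1 := hB a i
      have h2 := (size_enc_drop_le (l a) i).trans (hp a)
      simp only [Polynomial.eval_add, Polynomial.eval_one]
      omega⟩
  refine (PF.snd h).congr fun v => ?_
  simp only [hit _ _ le_rfl, List.take_length]

theorem PF.foldl_bool {l : α → List β} {s : α → Bool} {f : α → Bool → β → Bool} (hl : PF l)
    (hs : PF s) (hf : PF fun p : α × Bool × β => f p.1 p.2.1 p.2.2) :
    PF fun a => (l a).foldl (f a) (s a) :=
  .foldl hl hs hf ⟨3, fun a i => by simpa using size_enc_bool _⟩

@[fun_prop] theorem PF.range {f : α → ℕ} (hf : PF f) : PF fun a => List.range (f a) := by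
  obtain ⟨B, hB⟩ := exists_size_bound hf hf
  have hit : ∀ n i, i ≤ n →
      (fun s : ℕ × List ℕ => (s.1 - 1, (s.1 - 1) :: s.2))^[i] (n, [])
        = (n - i, (List.range n).drop (n - i)) := by
    intro n i hi
    induction i with
    | zero => simp
    | succ i ih =>
      rw [Function.iterate_succ_apply', ih (by omega)]
      have e : n - i = n - (i + 1) + 1 := by omega
      conv_rhs => rw [List.drop_eq_getElem_cons (by simp; omega)]
      simp only [List.getElem_range, Prod.mk.injEq, List.cons.injEq]
      refine ⟨by omega, by omega, by rw [e]⟩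
  have h := PF.iterate (init := fun a => (f a, ([] : List ℕ)))
    (step := fun _ s => (s.1 - 1, (s.1 - 1) :: s.2)) hf (by fun_prop) (by fun_prop)
    ⟨2 * B + 1 + (B * (2 * B + 2) + 1) + 1, fun a i hi => by
      rw [hit _ _ hi, size_enc_pair, size_enc_nat]
      have h1 := size_enc_drop_le (List.range (f a)) (f a - i)
      have h2 : (PCode.enc (List.range (f a))).size ≤ f a * (2 * f a + 2) + 1 := by
        rw [size_enc_list]
        have := List.sum_le_card_nsmul ((List.range (f a)).map fun x => (PCode.enc x).size + 1)
          (2 * f a + 2) (by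
            intro x hx
            simp only [List.mem_map, List.mem_range, size_enc_nat] at hx
            omega)
        simpa using this
      have h3 := hB a
      have h4 : f a ≤ B.eval (PCode.enc a).size := by
        have := Nat.zero_le (f a * f a)
        omega
      have h5 := Nat.mul_le_mul h4 (show 2 * f a + 2 ≤ 2 * B.eval (PCode.enc a).size + 2 by omega)
      simp only [Polynomial.eval_add, Polynomial.eval_mul, Polynomial.eval_one,
        Polynomial.eval_ofNat]
      omega⟩
  refine (PF.snd h).congr fun v => ?_
  simp [hit]

end basic

section lists
variable {α β γ δ σ : Type} [PCode α] [PCode β] [PCode γ] [PCode δ] [PCode σ]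

theorem iterate_tail {T : Type} (l : List T) (i : ℕ) : (fun l : List T => l.tail)^[i] l = l.drop i := by
  induction i with
  | zero => rfl
  | succ i ih => rw [Function.iterate_succ_apply', ih, List.tail_drop]

@[fun_prop] theorem PF.drop {n : α → ℕ} {l : α → List β} (hn : PF n) (hl : PF l) :
    PF fun a => (l a).drop (n a) := by
  obtain ⟨p, hp⟩ := hl.size_le
  have h := PF.iterate (step := fun _ l => l.tail) hn hl (by fun_prop) ⟨p, fun a i _ => by
    rw [iterate_tail]
    exact (size_enc_drop_le _ _).trans (hp a)⟩
  simpa only [iterate_tail] using h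

@[fun_prop] theorem PF.getD {n : α → ℕ} {l : α → List β} {d : α → β} (hl : PF l) (hn : PF n)
    (hd : PF d) : PF fun a => (l a).getD (n a) (d a) :=
  (PF.headD (hn.drop hl) hd).congr fun v => by simp [List.head?_drop]

theorem foldl_push {T : Type} (l s : List T) : l.foldl (fun acc x => x :: acc) s = l.reverse ++ s := by
  induction l generalizing s with
  | nil => rfl
  | cons a l ih => simp [ih]

theorem PF.reverse_append {l s : α → List β} (hl : PF l) (hs : PF s) :
    PF fun a => (l a).reverse ++ s a := by
  obtain ⟨p, hp⟩ := hl.size_le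
  obtain ⟨q, hq⟩ := hs.size_le
  have h := PF.foldl (f := fun _ acc x => x :: acc) hl hs (by fun_prop) ⟨p + q, fun a i => by
    rw [foldl_push]
    have h1 := (size_enc_take_le (l a) i).trans (hp a)
    have h2 := hq a
    rw [size_enc_list] at h1 h2
    rw [size_enc_list, Polynomial.eval_add]
    simp only [List.map_append, List.map_reverse, List.sum_append, List.sum_reverse]
    omega⟩
  simpa only [foldl_push] using h

@[fun_prop] theorem PF.reverse {l : α → List β} (hl : PF l) : PF fun a => (l a).reverse := by
  simpa using hl.reverse_append (.const [])

@[fun_prop] theorem PF.append {l s : α → List β} (hl : PF l) (hs : PF s) :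
    PF fun a => l a ++ s a := by
  simpa using hl.reverse.reverse_append hs

@[fun_prop] theorem PF.take {n : α → ℕ} {l : α → List β} (hn : PF n) (hl : PF l) :
    PF fun a => (l a).take (n a) := by
  have h : PF fun a => ((l a).reverse.drop ((l a).length - n a)).reverse := by fun_prop
  refine h.congr fun v => ?_
  simp only [List.drop_reverse, List.reverse_reverse]
  congr 1
  rw [List.take_eq_take_iff]
  omega

theorem foldl_append_eq {T : Type} (L : List (List T)) (s : List T) :
    L.foldl (fun acc x => acc ++ x) s = s ++ L.flatten := by
  induction L generalizing s with
  | nil => simp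
  | cons a l ih => simp [ih]

@[fun_prop] theorem PF.flatten {l : α → List (List β)} (hl : PF l) :
    PF fun a => (l a).flatten := by
  obtain ⟨p, hp⟩ := hl.size_le
  have h := PF.foldl (s := fun _ => []) (f := fun _ acc x => acc ++ x) hl (.const []) (by fun_prop)
    ⟨p, fun a i => by
      rw [foldl_append_eq, List.nil_append]
      refine le_trans ?_ ((size_enc_take_le (l a) i).trans (hp a))
      generalize (l a).take i = L
      simp only [size_enc_list]
      induction L with
      | nil => simp
      | cons x L ih => simp only [List.flatten_cons, List.map_append, List.sum_append,
          List.map_cons, List.sum_cons, size_enc_list] at *; omega⟩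
  simpa only [foldl_append_eq, List.nil_append] using h

@[fun_prop] theorem PF.flatMap {l : α → List β} {f : α → β → List γ} (hl : PF l)
    (hf : PF fun p : α × β => f p.1 p.2) : PF fun a => (l a).flatMap (f a) :=
  (hl.map hf).flatten

theorem foldl_or {T : Type} (f : T → Bool) (l : List T) (b : Bool) :
    l.foldl (fun acc x => acc || f x) b = (b || l.any f) := by
  induction l generalizing b with
  | nil => simp
  | cons a l ih => simp [ih, Bool.or_assoc]

@[fun_prop] theorem PF.any {l : α → List β} {f : α → β → Bool} (hl : PF l)
    (hf : PF fun p : α × β => f p.1 p.2) : PF fun a => (l a).any (f a) := by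
  have h := PF.foldl_bool (f := fun a acc x => acc || f a x) hl (.const false)
    (.or (by fun_prop) (PF.comp (g := fun p : α × β => f p.1 p.2)
      (f := fun p : α × Bool × β => (p.1, p.2.2)) hf (by fun_prop)))
  simpa [foldl_or] using h

/-- The parity of `f 0, …, f (n - 1)`. -/
def xorSum (n : ℕ) (f : ℕ → Bool) : Bool := (List.range n).foldl (fun acc i => acc ^^ f i) false

@[simp] theorem xorSum_zero (f : ℕ → Bool) : xorSum 0 f = false := rfl

theorem xorSum_succ (n : ℕ) (f : ℕ → Bool) : xorSum (n + 1) f = (xorSum n f ^^ f n) := by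
  simp [xorSum, List.range_succ]

theorem PF.xorSum {n : α → ℕ} {f : α → ℕ → Bool} (hn : PF n)
    (hf : PF fun p : α × ℕ => f p.1 p.2) : PF fun a => HamLearn.xorSum (n a) (f a) :=
  PF.foldl_bool (f := fun a acc x => acc ^^ f a x) hn.range (.const false)
    (.xor (by fun_prop) (PF.comp (g := fun p : α × ℕ => f p.1 p.2)
      (f := fun p : α × Bool × ℕ => (p.1, p.2.2)) hf (by fun_prop)))

/-- The last index up to `n` at which `p` holds, and `0` if there is none. -/
def lastIndex (n : ℕ) (p : ℕ → Bool) : ℕ :=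
  (List.range (n + 1)).foldl (fun acc i => cond (p i) i acc) 0

theorem foldl_last_spec (p : ℕ → Bool) (n : ℕ) :
    (List.range n).foldl (fun acc i => cond (p i) i acc) 0 ≤ n - 1 ∧
    ∀ i < n, p i = true → i ≤ (List.range n).foldl (fun acc i => cond (p i) i acc) 0 ∧
      p ((List.range n).foldl (fun acc i => cond (p i) i acc) 0) = true := by
  induction n with
  | zero => simp
  | succ n ih =>
    simp only [List.range_succ, List.foldl_append, List.foldl_cons, List.foldl_nil]
    cases h : p n
    · refine ⟨by simp; omega, fun i hi hp => ?_⟩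
      have : i ≠ n := by rintro rfl; simp [h] at hp
      simpa using ih.2 i (by omega) hp
    · exact ⟨by simp, fun i hi hp => ⟨by simp; omega, by simpa using h⟩⟩

theorem le_lastIndex {n i : ℕ} {p : ℕ → Bool} (hi : i ≤ n) (h : p i = true) :
    i ≤ lastIndex n p ∧ p (lastIndex n p) = true :=
  (foldl_last_spec p (n + 1)).2 i (by omega) h

theorem PF.lastIndex {n : α → ℕ} {f : α → ℕ → Bool} (hn : PF n)
    (hf : PF fun p : α × ℕ => f p.1 p.2) : PF fun a => HamLearn.lastIndex (n a) (f a) := by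
  obtain ⟨p, hp⟩ := hn.size_le
  refine PF.foldl (f := fun a acc i => _root_.cond (f a i) i acc) (s := fun _ => 0) hn.succ.range
    (.const 0) (.bif (PF.comp (g := fun p : α × ℕ => f p.1 p.2)
      (f := fun p : α × ℕ × ℕ => (p.1, p.2.2)) hf (by fun_prop)) (by fun_prop) (by fun_prop))
    ⟨p, fun a i => ?_⟩
  have h1 := hp a
  rw [List.take_range]
  have h2 := (foldl_last_spec (f a) (min i (n a + 1))).1
  rw [size_enc_nat] at *
  omega

end lists

/-! ### The size of a tree -/

open Classical in
/-- One step of the computation of the size of a tree: the state is a stack of trees, followed by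
the number of nodes seen so far. -/
noncomputable def sizeStep (s : Val) : Val :=
  if s.hd.hd ≠ .nil then .cons (.cons s.hd.hd.hd (.cons s.hd.hd.tl s.hd.tl)) (.cons .nil s.tl)
  else .cons s.hd.tl (.cons .nil s.tl)

theorem iterate_sizeStep (v : Val) (i : ℕ) (hi : i ≤ v.size) : ∃ L : List Val,
    sizeStep^[i] (.cons (.cons v .nil) .nil) = .cons (.ofList L) (.ofNat i) ∧
      (L.map Val.size).sum = v.size - i := by
  induction i with
  | zero => exact ⟨[v], rfl, by simp⟩
  | succ i ih =>
    obtain ⟨L, h1, h2⟩ := ih (by omega)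
    rw [Function.iterate_succ_apply', h1]
    match L, h2 with
    | [], h2 => simp at h2; omega
    | .nil :: L, h2 =>
      refine ⟨L, by simp [sizeStep, Val.ofList, Val.ofNat], ?_⟩
      simp [Val.size] at h2; omega
    | .cons a b :: L, h2 =>
      refine ⟨a :: b :: L, by simp [sizeStep, Val.ofList, Val.ofNat], ?_⟩
      simp [Val.size] at h2 ⊢; omega

theorem PolyTime.size : PolyTime fun v => .ofNat v.size := by
  have hs : PolyTime sizeStep :=
    .ite (.comp .hd .hd)
      (.cons (.cons (.comp .hd (.comp .hd .hd)) (.cons (.comp .tl (.comp .hd .hd))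
        (.comp .tl .hd))) (.cons (.const .nil) .tl))
      (.cons (.comp .tl .hd) (.cons (.const .nil) .tl))
  have h := PolyTime.whileLoop (test := Val.hd) (step := sizeStep)
    (init := fun v => .cons (.cons v .nil) .nil) .hd
    (.cons (.cons .id (.const .nil)) (.const .nil)) hs Val.size Polynomial.X
    (2 * Polynomial.X + 1 + (2 * Polynomial.X + 1) + 1) (by simp) ?_ ?_ ?_
  · refine (PolyTime.comp .tl h).congr fun v => ?_
    obtain ⟨L, h1, -⟩ := iterate_sizeStep v v.size le_rfl
    rw [h1, Val.tl_cons]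
  · intro v i hi
    obtain ⟨L, h1, h2⟩ := iterate_sizeStep v i hi.le
    rw [h1, Val.hd_cons]
    cases L with
    | nil => simp at h2; omega
    | cons a L => simp [Val.ofList]
  · intro v
    obtain ⟨L, h1, h2⟩ := iterate_sizeStep v v.size le_rfl
    rw [h1, Val.hd_cons]
    cases L with
    | nil => rfl
    | cons a L => have := a.size_pos; simp at h2; omega
  · intro v i hi
    obtain ⟨L, h1, h2⟩ := iterate_sizeStep v i hi
    have h3 : ∀ L : List Val, (Val.ofList L).size ≤ 2 * (L.map Val.size).sum + 1 := by
      intro L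
      induction L with
      | nil => simp [Val.ofList, Val.size]
      | cons a L ih => have := a.size_pos; simp [Val.ofList, Val.size]; omega
    have h4 := h3 L
    rw [h1]
    simp only [Val.size, Val.size_ofNat, Polynomial.eval_add, Polynomial.eval_mul,
      Polynomial.eval_ofNat, Polynomial.eval_X, Polynomial.eval_one]
    omega

@[fun_prop] theorem PF.valSize {α : Type} [PCode α] {f : α → Val} (hf : PF f) :
    PF fun a => (f a).size := PolyTime.comp .size hf

@[fun_prop] theorem PF.enc' {α β : Type} [PCode α] [PCode β] {f : α → β} (hf : PF f) :
    PF fun a => PCode.enc (f a) := PF.comp PF.enc hf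

@[fun_prop] theorem PF.dec' {α β : Type} [PCode α] [PCode β] {f : α → Val} (hf : PF f) :
    PF fun a => (PCode.dec (f a) : β) := PF.comp PF.dec hf

/-! ### Averages over bit strings -/

/-- The average of `f` over the bit strings of length `n`. -/
noncomputable def avg (n : ℕ) (f : List Bool → ℝ) : ℝ :=
  unifE fun r : Fin n → Bool => f (List.ofFn r)

theorem unifE_congr {Ω : Type} [Fintype Ω] {f g : Ω → ℝ} (h : ∀ ω, f ω = g ω) :
    unifE f = unifE g := by rw [show f = g from funext h]

theorem unifE_add {Ω : Type} [Fintype Ω] (f g : Ω → ℝ) :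
    unifE (fun ω => f ω + g ω) = unifE f + unifE g := by
  simp [unifE, Finset.sum_add_distrib, add_div]

theorem unifE_sub {Ω : Type} [Fintype Ω] (f g : Ω → ℝ) :
    unifE (fun ω => f ω - g ω) = unifE f - unifE g := by
  simp [unifE, Finset.sum_sub_distrib, sub_div]

theorem unifE_mul_left {Ω : Type} [Fintype Ω] (c : ℝ) (f : Ω → ℝ) :
    unifE (fun ω => c * f ω) = c * unifE f := by
  simp [unifE, ← Finset.mul_sum, mul_div_assoc]

theorem unifE_mono {Ω : Type} [Fintype Ω] {f g : Ω → ℝ} (h : ∀ ω, f ω ≤ g ω) :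
    unifE f ≤ unifE g :=
  div_le_div_of_nonneg_right (Finset.sum_le_sum fun ω _ => h ω) (Nat.cast_nonneg _)

theorem unifE_nonneg {Ω : Type} [Fintype Ω] {f : Ω → ℝ} (h : ∀ ω, 0 ≤ f ω) : 0 ≤ unifE f :=
  div_nonneg (Finset.sum_nonneg fun ω _ => h ω) (Nat.cast_nonneg _)

theorem unifE_const {Ω : Type} [Fintype Ω] [Nonempty Ω] (c : ℝ) :
    unifE (fun _ : Ω => c) = c := by
  have : (Fintype.card Ω : ℝ) ≠ 0 := by simp
  simp [unifE, mul_div_cancel_left₀ c this]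

theorem unifE_equiv {Ω Ω' : Type} [Fintype Ω] [Fintype Ω'] (e : Ω ≃ Ω') (f : Ω' → ℝ) :
    unifE (fun ω => f (e ω)) = unifE f := by
  simp [unifE, e.sum_comp, Fintype.card_congr e]

theorem unifE_prod {Ω Ω' : Type} [Fintype Ω] [Fintype Ω'] (f : Ω × Ω' → ℝ) :
    unifE f = unifE fun a => unifE fun b => f (a, b) := by
  simp [unifE, Fintype.sum_prod_type, Finset.sum_div, mul_comm, div_div]

theorem unifE_swap {Ω Ω' : Type} [Fintype Ω] [Fintype Ω'] (f : Ω → Ω' → ℝ) :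
    (unifE fun a => unifE fun b => f a b) = unifE fun b => unifE fun a => f a b := by
  rw [← unifE_prod fun p : Ω × Ω' => f p.1 p.2, ← unifE_prod fun p : Ω' × Ω => f p.2 p.1]
  exact unifE_equiv (Equiv.prodComm Ω Ω') fun p : Ω' × Ω => f p.2 p.1

/-- Jensen's inequality for the square. -/
theorem sq_unifE_le {Ω : Type} [Fintype Ω] [Nonempty Ω] (f : Ω → ℝ) :
    unifE f ^ 2 ≤ unifE fun ω => f ω ^ 2 := by
  have h : 0 ≤ unifE fun ω => (f ω - unifE f) ^ 2 := unifE_nonneg fun ω => sq_nonneg _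
  have e : (unifE fun ω => (f ω - unifE f) ^ 2) = (unifE fun ω => f ω ^ 2) - unifE f ^ 2 := by
    rw [unifE_congr (g := fun ω => (f ω ^ 2 - 2 * unifE f * f ω) + unifE f ^ 2)
      (fun ω => by ring), unifE_add, unifE_sub, unifE_mul_left, unifE_const]
    ring
  linarith

theorem avg_add (a b : ℕ) (f : List Bool → ℝ) :
    avg (a + b) f = avg a fun u => avg b fun v => f (u ++ v) := by
  unfold avg
  rw [← unifE_prod fun p : (Fin a → Bool) × (Fin b → Bool) =>
    f (List.ofFn p.1 ++ List.ofFn p.2)]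
  rw [← unifE_equiv (Fin.appendEquiv a b)]
  refine unifE_congr fun p => ?_
  rw [← List.ofFn_fin_append]
  rfl

theorem avg_congr {n : ℕ} {f g : List Bool → ℝ} (h : ∀ u, u.length = n → f u = g u) :
    avg n f = avg n g := unifE_congr fun r => h _ (by simp)

theorem avg_mono {n : ℕ} {f g : List Bool → ℝ} (h : ∀ u, u.length = n → f u ≤ g u) :
    avg n f ≤ avg n g := unifE_mono fun r => h _ (by simp)

theorem avg_const (n : ℕ) (c : ℝ) : avg n (fun _ => c) = c := unifE_const c

theorem avg_zero (f : List Bool → ℝ) : avg 0 f = f [] := by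
  unfold avg
  rw [unifE_congr (g := fun _ => f []) (fun r => by simp), unifE_const]

theorem avg_one (f : List Bool → ℝ) : avg 1 f = (f [false] + f [true]) / 2 := by
  unfold avg
  rw [← unifE_equiv (Equiv.funUnique (Fin 1) Bool).symm]
  simp [unifE, List.ofFn_succ, add_comm]

/-- Superfluous bits do not matter. -/
theorem avg_take {n k : ℕ} (h : k ≤ n) (f : List Bool → ℝ) :
    avg n (fun u => f (u.take k)) = avg k f := by
  obtain ⟨m, rfl⟩ := Nat.exists_eq_add_of_le h
  rw [avg_add]
  refine avg_congr fun u hu => ?_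
  rw [← avg_const m (f u)]
  refine avg_congr fun v _ => ?_
  rw [List.take_left' hu]

/-! ### Measurement outcomes of circuits -/

open Classical in
/-- The probability that measuring all `N` wires, after the gates have been applied to `|0…0⟩`,
gives a bit string with property `P`. -/
noncomputable def measProb (N : ℕ) (gs : List Gate) (P : List Bool → Prop) : ℝ :=
  ∑ z : Fin N → Bool, if P (List.ofFn z) then
    ‖gs.foldl (fun ψ g => g.apply ψ) (fun x : Fin N → Bool => if x = fun _ => false then 1 else 0)
      z‖ ^ 2 else 0

/-- The same for the circuit with code `c`. -/
noncomputable def meas (c : Val) (P : List Bool → Prop) : ℝ :=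
  measProb (wires c) (c.tl.toList.map Gate.decode) P

theorem ofBits_eq_enc {N : ℕ} (z : Fin N → Bool) : Val.ofBits z = PCode.enc (List.ofFn z) := by
  simp [Val.ofBits, enc_list, List.map_ofFn, Function.comp_def, enc_bool]

theorem outProb_eq (A : QPT) (x : Val) (Y : Set Val) : A.outProb x Y =
    avg (A.coins.eval x.size) fun r => meas (A.prep (.cons x (PCode.enc r)))
      fun z => A.post (.cons (.cons x (PCode.enc r)) (PCode.enc z)) ∈ Y := by
  unfold QPT.outProb avg meas measProb finalState
  refine unifE_congr fun r => ?_
  rw [ofBits_eq_enc r]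
  refine Finset.sum_congr rfl fun z _ => ?_
  rw [ofBits_eq_enc z]

/-- The squared norm of a state vector. -/
noncomputable def sqNorm {N : ℕ} (ψ : QState N) : ℝ := ∑ x, ‖ψ x‖ ^ 2

theorem sum_involutive {ι : Type} [Fintype ι] (s : ι → ι) (hs : Function.Involutive s)
    (f : ι → ℝ) : ∑ x, f (s x) = ∑ x, f x :=
  Equiv.sum_comp hs.toPerm f

theorem sqNorm_apply {N : ℕ} (ψ : QState N) (g : Gate) : sqNorm (g.apply ψ) = sqNorm ψ := by
  cases g with
  | had i =>
    simp only [Gate.apply]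
    split_ifs with h
    · let s : (Fin N → Bool) → (Fin N → Bool) := fun x => Function.update x ⟨i, h⟩ (!x ⟨i, h⟩)
      have hs : Function.Involutive s := fun x => by simp [s]
      have key : ∀ f : (Fin N → Bool) → ℝ, 2 * ∑ x, f x = ∑ x, (f x + f (s x)) := by
        intro f
        rw [Finset.sum_add_distrib, sum_involutive s hs]
        ring
      have : (2 : ℝ) ≠ 0 := by norm_num
      apply mul_left_cancel₀ this
      unfold sqNorm
      rw [key, key]
      refine Finset.sum_congr rfl fun x _ => ?_
      have par : ∀ a b : ℂ, ‖(a + b) / (√2 : ℝ)‖ ^ 2 + ‖(a - b) / (√2 : ℝ)‖ ^ 2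
          = ‖a‖ ^ 2 + ‖b‖ ^ 2 := by
        intro a b
        have h2 : ‖((√2 : ℝ) : ℂ)‖ ^ 2 = 2 := by
          rw [Complex.norm_real, Real.norm_of_nonneg (Real.sqrt_nonneg 2)]; simp
        rw [norm_div, norm_div, div_pow, div_pow, h2]
        have := parallelogram_law_with_norm ℝ a b
        nlinarith
      have hx : ∀ b, x ⟨i, h⟩ = b → Function.update x ⟨i, h⟩ b = x := by
        rintro b rfl; simp
      cases hb : x ⟨i, h⟩
      · have e := hx _ hb
        simp only [s, hb, Function.update_self, Function.update_idem, e, Bool.not_false,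
          Bool.false_eq_true, if_false, if_true, one_mul, neg_one_mul, ← sub_eq_add_neg]
        exact par _ _
      · have e := hx _ hb
        simp only [s, hb, Function.update_self, Function.update_idem, e, Bool.not_true,
          Bool.false_eq_true, if_false, if_true, one_mul, neg_one_mul, ← sub_eq_add_neg]
        rw [add_comm, par, add_comm]
    · rfl
  | phase i =>
    simp only [Gate.apply]
    split_ifs with h
    · refine Finset.sum_congr rfl fun x _ => ?_
      have : ‖Complex.exp (Real.pi / 4 * Complex.I)‖ = 1 := by
        simpa using Complex.norm_exp_ofReal_mul_I (Real.pi / 4)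
      beta_reduce
      split_ifs <;> simp [this]
    · rfl
  | cnot i j =>
    simp only [Gate.apply]
    split_ifs with h
    · refine sum_involutive (fun x : Fin N → Bool =>
        Function.update x ⟨j, h.2.1⟩ (xor (x ⟨j, h.2.1⟩) (x ⟨i, h.1⟩))) ?_ fun x => ‖ψ x‖ ^ 2
      intro x
      have : (⟨i, h.1⟩ : Fin N) ≠ ⟨j, h.2.1⟩ := by simpa using h.2.2
      simp [Function.update_of_ne this]
    · rfl

theorem measProb_true (N : ℕ) (gs : List Gate) : measProb N gs (fun _ => True) = 1 := by
  have key : ∀ (gs : List Gate) (ψ : QState N),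
      sqNorm (gs.foldl (fun ψ g => g.apply ψ) ψ) = sqNorm ψ := by
    intro gs
    induction gs with
    | nil => intro ψ; rfl
    | cons g gs ih => intro ψ; rw [List.foldl_cons, ih, sqNorm_apply]
  have := key gs fun x => if x = fun _ => false then 1 else 0
  simp only [measProb, if_true]
  unfold sqNorm at this
  rw [this, Finset.sum_eq_single fun _ => false] <;> simp +contextual

theorem measProb_add_not (N : ℕ) (gs : List Gate) (P : List Bool → Prop) :
    measProb N gs P + measProb N gs (fun z => ¬ P z) = 1 := by
  rw [← measProb_true N gs]
  simp only [measProb, ← Finset.sum_add_distrib]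
  refine Finset.sum_congr rfl fun z _ => ?_
  by_cases h : P (List.ofFn z) <;> simp [h]

theorem measProb_mono {N : ℕ} {gs : List Gate} {P Q : List Bool → Prop} (h : ∀ z, P z → Q z) :
    measProb N gs P ≤ measProb N gs Q := by
  refine Finset.sum_le_sum fun z _ => ?_
  by_cases hP : P (List.ofFn z)
  · simp [hP, h _ hP]
  · rw [if_neg hP]; split_ifs <;> positivity

theorem measProb_nonneg (N : ℕ) (gs : List Gate) (P : List Bool → Prop) : 0 ≤ measProb N gs P :=
  Finset.sum_nonneg fun z _ => by split_ifs <;> positivity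

theorem outProb_nonneg (A : QPT) (x : Val) (Y : Set Val) : 0 ≤ A.outProb x Y := by
  rw [outProb_eq]; exact unifE_nonneg fun r => measProb_nonneg _ _ _

theorem outProb_mono (A : QPT) (x : Val) {Y Z : Set Val} (h : Y ⊆ Z) :
    A.outProb x Y ≤ A.outProb x Z := by
  rw [outProb_eq, outProb_eq]; exact unifE_mono fun r => measProb_mono fun z hz => h hz

theorem outProb_add_compl (A : QPT) (x : Val) (Y : Set Val) :
    A.outProb x Y + A.outProb x Yᶜ = 1 := by
  rw [outProb_eq, outProb_eq, avg, avg, ← unifE_add, ← unifE_const (Ω := Fin _ → Bool) 1]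
  exact unifE_congr fun r => measProb_add_not _ _ _

theorem outProb_le_one (A : QPT) (x : Val) (Y : Set Val) : A.outProb x Y ≤ 1 := by
  have := outProb_add_compl A x Y
  have := outProb_nonneg A x Yᶜ
  linarith

/-! ### Two circuits side by side -/

/-- Renames the wires of a gate. -/
def Gate.map (r : ℕ → ℕ) : Gate → Gate
  | .had i => .had (r i)
  | .phase i => .phase (r i)
  | .cnot i j => .cnot (r i) (r j)

/-- A gate on the wires in the range of `e` acts on the first factor only; wires that do not exist
in the small circuit are renamed to wires that do not exist in the large one. -/
theorem Gate.apply_map {n N : ℕ} (e : Fin n → Fin N) (he : Function.Injective e) (r : ℕ → ℕ)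
    (hr : ∀ i : Fin n, r i = e i) (hr' : ∀ i, n ≤ i → N ≤ r i) (ψ : QState n) (χ : QState N)
    (hχ : ∀ x i b, χ (Function.update x (e i) b) = χ x) (g : Gate) :
    (g.map r).apply (fun x => ψ (x ∘ e) * χ x) = fun x => (g.apply ψ) (x ∘ e) * χ x := by
  have hup : ∀ (x : Fin N → Bool) i b,
      Function.update x (e i) b ∘ e = Function.update (x ∘ e) i b := fun x i b =>
    Function.update_comp_eq_of_injective x he i b
  have hlt : ∀ i, (h : i < n) → ∃ h' : r i < N, (⟨r i, h'⟩ : Fin N) = e ⟨i, h⟩ := by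
    intro i h
    have := hr ⟨i, h⟩
    simp only at this
    exact ⟨by rw [this]; exact (e _).2, Fin.ext this⟩
  cases g with
  | had i =>
    funext x
    by_cases h : i < n
    · obtain ⟨h', e'⟩ := hlt i h
      simp only [Gate.map, Gate.apply, h, h', dif_pos, e', hup, hχ, Function.comp_apply]
      ring
    · have h' : ¬ r i < N := by have := hr' i (by omega); omega
      simp only [Gate.map, Gate.apply, h, h', dif_neg, not_false_eq_true]
  | phase i =>
    funext x
    by_cases h : i < n
    · obtain ⟨h', e'⟩ := hlt i h
      simp only [Gate.map, Gate.apply, h, h', dif_pos, e', Function.comp_apply]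
      ring
    · have h' : ¬ r i < N := by have := hr' i (by omega); omega
      simp only [Gate.map, Gate.apply, h, h', dif_neg, not_false_eq_true]
  | cnot i j =>
    funext x
    by_cases h : i < n ∧ j < n ∧ i ≠ j
    · obtain ⟨hi, e1⟩ := hlt i h.1
      obtain ⟨hj, e2⟩ := hlt j h.2.1
      have h' : r i < N ∧ r j < N ∧ r i ≠ r j := by
        refine ⟨hi, hj, fun hij => h.2.2 ?_⟩
        have : e ⟨i, h.1⟩ = e ⟨j, h.2.1⟩ := by rw [← e1, ← e2]; exact Fin.ext hij
        simpa using he this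
      simp only [Gate.map, Gate.apply, dif_pos h, dif_pos h', e1, e2, hup, hχ,
        Function.comp_apply]
    · have h' : ¬ (r i < N ∧ r j < N ∧ r i ≠ r j) := by
        rintro ⟨h1, h2, h3⟩
        refine h ⟨?_, ?_, fun hij => h3 (by rw [hij])⟩
        · by_contra hc; have := hr' i (by omega); omega
        · by_contra hc; have := hr' j (by omega); omega
      simp only [Gate.map, Gate.apply, dif_neg h, dif_neg h']

theorem foldl_apply_map {n N : ℕ} (e : Fin n → Fin N) (he : Function.Injective e) (r : ℕ → ℕ)
    (hr : ∀ i : Fin n, r i = e i) (hr' : ∀ i, n ≤ i → N ≤ r i) (χ : QState N)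
    (hχ : ∀ x i b, χ (Function.update x (e i) b) = χ x) (gs : List Gate) (ψ : QState n) :
    (gs.map (Gate.map r)).foldl (fun ψ g => g.apply ψ) (fun x => ψ (x ∘ e) * χ x)
      = fun x => gs.foldl (fun ψ g => g.apply ψ) ψ (x ∘ e) * χ x := by
  induction gs generalizing ψ with
  | nil => rfl
  | cons g gs ih =>
    simp only [List.map_cons, List.foldl_cons]
    rw [Gate.apply_map e he r hr hr' ψ χ hχ, ih]

/-- The wire `i` of a circuit with `n` wires, moved by `off`; non-existing wires become `N`. -/
def moveWire (n off N i : ℕ) : ℕ := cond (decide (i < n)) (off + i) N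

/-- The gates of two circuits, on disjoint sets of wires. -/
def pairGates (n m : ℕ) (gs hs : List Gate) : List Gate :=
  gs.map (Gate.map (moveWire n 0 (n + m))) ++ hs.map (Gate.map (moveWire m n (n + m)))

open Classical in
theorem measProb_pairGates (n m : ℕ) (gs hs : List Gate) (P Q : List Bool → Prop) :
    measProb (n + m) (pairGates n m gs hs) (fun z => P (z.take n) ∧ Q (z.drop n))
      = measProb n gs P * measProb m hs Q := by
  have h0 : (fun x : Fin (n + m) → Bool => if x = fun _ => false then (1 : ℂ) else 0) =
      fun x => (fun y : Fin n → Bool => if y = fun _ => false then (1 : ℂ) else 0)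
        (x ∘ Fin.castAdd m) *
        (fun y : Fin m → Bool => if y = fun _ => false then (1 : ℂ) else 0) (x ∘ Fin.natAdd n) := by
    funext x
    by_cases h : x = fun _ => false
    · subst h; simp [Function.comp_def]
    · rw [if_neg h]
      by_cases h1 : x ∘ Fin.castAdd m = fun _ => false
      · have h2 : ¬ x ∘ Fin.natAdd n = fun _ => false := by
          intro h2
          refine h (funext fun i => ?_)
          refine Fin.addCases (fun i => congrFun h1 i) (fun i => congrFun h2 i) i
        simp [h2]
      · simp [h1]
  have hne : ∀ (i : Fin n) (j : Fin m), Fin.natAdd n j ≠ Fin.castAdd m i := by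
    intro i j h
    have := congrArg Fin.val h
    simp at this
    omega
  have hst : (pairGates n m gs hs).foldl (fun ψ g => g.apply ψ)
      (fun x : Fin (n + m) → Bool => if x = fun _ => false then 1 else 0) = fun x =>
      gs.foldl (fun ψ g => g.apply ψ) (fun x : Fin n → Bool => if x = fun _ => false then 1 else 0)
        (x ∘ Fin.castAdd m) *
      hs.foldl (fun ψ g => g.apply ψ) (fun x : Fin m → Bool => if x = fun _ => false then 1 else 0)
        (x ∘ Fin.natAdd n) := by
    rw [h0, pairGates, List.foldl_append]
    have h1 := foldl_apply_map (Fin.castAdd m) (Fin.castAdd_injective n m) (moveWire n 0 (n + m))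
      (by intro i; simp [moveWire]) (by intro i hi; simp [moveWire, Nat.not_lt.2 hi])
      (fun x => (fun y : Fin m → Bool => if y = fun _ => false then (1 : ℂ) else 0)
        (x ∘ Fin.natAdd n)) (by
        intro x i b
        congr 1
        exact Function.update_comp_eq_of_forall_ne _ _ fun j => hne i j) gs
      (fun x : Fin n → Bool => if x = fun _ => false then 1 else 0)
    rw [h1]
    have := foldl_apply_map (Fin.natAdd n) (Fin.natAdd_injective m n) (moveWire m n (n + m))
      (by intro i; simp [moveWire]) (by intro i hi; simp [moveWire, Nat.not_lt.2 hi])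
      (fun x => gs.foldl (fun ψ g => g.apply ψ)
        (fun x : Fin n → Bool => if x = fun _ => false then 1 else 0) (x ∘ Fin.castAdd m)) (by
        intro x i b
        rw [Function.update_comp_eq_of_forall_ne _ _ fun j => (hne j i).symm]) hs
      (fun y : Fin m → Bool => if y = fun _ => false then (1 : ℂ) else 0)
    simp only [mul_comm] at this ⊢
    exact this
  unfold measProb
  rw [hst, Finset.sum_mul_sum, ← Fintype.sum_prod_type', ← (Fin.appendEquiv n m).sum_comp]
  refine Finset.sum_congr rfl fun p _ => ?_
  obtain ⟨y, z⟩ := p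
  have e1 : (Fin.appendEquiv n m (y, z)) ∘ Fin.castAdd m = y := by
    funext i; simp [Fin.appendEquiv]
  have e2 : (Fin.appendEquiv n m (y, z)) ∘ Fin.natAdd n = z := by
    funext i; simp [Fin.appendEquiv]
  have e3 : List.ofFn (Fin.appendEquiv n m (y, z)) = List.ofFn y ++ List.ofFn z := by
    rw [← List.ofFn_fin_append]; rfl
  beta_reduce
  rw [e1, e2, e3, List.take_left' (by simp), List.drop_left' (by simp)]
  by_cases hP : P (List.ofFn y) <;> by_cases hQ : Q (List.ofFn z) <;> simp [hP, hQ, mul_pow]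

/-! ### New quantum algorithms from old ones -/

/-- The quantum algorithm with circuit `f (x, r)` and output `g ((x, r), z)`, for the input `x`,
the random bits `r` and the measured bits `z`. -/
def QPT.ofPF (coins : Polynomial ℕ) (f : Val × List Bool → Val) (hf : PF f)
    (g : (Val × List Bool) × List Bool → Val) (hg : PF g) : QPT :=
  ⟨coins, fun v => f (PCode.dec v), fun v => g (PCode.dec v), hf, hg⟩

theorem QPT.acceptProb_ofPF (coins : Polynomial ℕ) (f : Val × List Bool → Val) (hf : PF f)
    (g : (Val × List Bool) × List Bool → Val) (hg : PF g) (v : Val) :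
    (QPT.ofPF coins f hf g hg).acceptProb v = avg (coins.eval v.size) fun r =>
      meas (f (v, r)) fun z => g ((v, r), z) ≠ .nil := by
  rw [QPT.acceptProb, outProb_eq]
  refine avg_congr fun r _ => ?_
  have h1 : ∀ (a : Val) (r : List Bool),
      (PCode.dec (.cons a (PCode.enc r)) : Val × List Bool) = (a, r) :=
    fun a r => PCode.dec_enc (a, r)
  have h2 : ∀ (a : Val) (r z : List Bool), (PCode.dec (.cons (.cons a (PCode.enc r))
      (PCode.enc z)) : (Val × List Bool) × List Bool) = ((a, r), z) :=
    fun a r z => PCode.dec_enc ((a, r), z)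
  simp only [QPT.ofPF, h1, h2, Set.mem_ofPred_eq]

theorem size_enc_bits_le (u : List Bool) : (PCode.enc u).size ≤ 4 * u.length + 1 := by
  rw [size_enc_list]
  induction u with
  | nil => simp
  | cons a u ih =>
    have := size_enc_bool a
    simp only [List.map_cons, List.sum_cons, List.length_cons]
    omega

/-- Randomized polynomial-time preparation of the input of a quantum algorithm, and
polynomial-time processing of its output. -/
theorem QPT.exists_wrap (A : QPT) (p : Polynomial ℕ) (pre : Val × List Bool → Val) (hpre : PF pre)
    (test : (Val × List Bool) × Val → Bool) (htest : PF test) :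
    ∃ A' : QPT, ∀ v, A'.acceptProb v = avg (p.eval v.size) fun u =>
      A.outProb (pre (v, u)) {y | test ((v, u), y) = true} := by
  obtain ⟨s, hs⟩ := hpre.size_le
  let U : Val × List Bool → List Bool := fun x => x.2.take (p.eval x.1.size)
  let W : Val × List Bool → Val := fun x => pre (x.1, U x)
  let R : Val × List Bool → List Bool := fun x =>
    (x.2.drop (p.eval x.1.size)).take (A.coins.eval (W x).size)
  have hU : PF U := by fun_prop
  have hW : PF W := PF.comp hpre (by fun_prop)
  have hR : PF R := by fun_prop
  have hprep : PF A.prep := PF.of_val A.prep_poly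
  have hpost : PF A.post := PF.of_val A.post_poly
  have hf : PF fun x : Val × List Bool => A.prep (PCode.enc (W x, R x)) :=
    PF.comp hprep (by fun_prop)
  have hpost' : PF fun x : (Val × List Bool) × List Bool =>
      A.post (PCode.enc ((W x.1, R x.1), x.2)) :=
    PF.comp hpost (.enc' (.mk (.mk (.comp hW (by fun_prop)) (.comp hR (by fun_prop)))
      (by fun_prop)))
  have hg : PF fun x : (Val × List Bool) × List Bool => PCode.enc (test ((x.1.1, U x.1),
      A.post (PCode.enc ((W x.1, R x.1), x.2)))) :=
    .enc' (PF.comp htest (.mk (.mk (by fun_prop) (.comp hU (by fun_prop))) hpost'))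
  refine ⟨QPT.ofPF (p + A.coins.comp (s.comp (Polynomial.X + (4 * p + 2)))) _ hf _ hg,
    fun v => ?_⟩
  rw [QPT.acceptProb_ofPF, Polynomial.eval_add, avg_add]
  refine avg_congr fun u hu => ?_
  rw [outProb_eq]
  have hsz : A.coins.eval (pre (v, u)).size ≤
      (A.coins.comp (s.comp (Polynomial.X + (4 * p + 2)))).eval v.size := by
    rw [Polynomial.eval_comp, Polynomial.eval_comp]
    refine poly_mono _ ((hs (v, u)).trans (poly_mono s ?_))
    have := size_enc_bits_le u
    have e : (PCode.enc v).size = v.size := rfl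
    rw [size_enc_pair, e]
    simp only [Polynomial.eval_add, Polynomial.eval_mul, Polynomial.eval_X,
      Polynomial.eval_ofNat]
    omega
  rw [← avg_take hsz]
  refine avg_congr fun r _ => ?_
  have e1 : U (v, u ++ r) = u := by simp [U, ← hu]
  have e2 : W (v, u ++ r) = pre (v, u) := by simp only [W, e1]
  have e3 : R (v, u ++ r) = r.take (A.coins.eval (pre (v, u)).size) := by
    simp only [R, e2]; simp [← hu]
  simp only [e1, e2, e3, Set.mem_ofPred_eq, enc_pair, enc_val]
  congr 1
  funext z
  cases test ((v, u), A.post (((pre (v, u)).cons (PCode.enc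
    (List.take (Polynomial.eval (pre (v, u)).size A.coins) r))).cons (PCode.enc z))) <;>
    simp [enc_bool, Val.ofBool]

/-- The gate coded by the image is the renamed gate. -/
def moveGate (n off N : ℕ) (v : Val) : Val :=
  .cons v.hd (PCode.enc (moveWire n off N v.tl.hd.toNat, moveWire n off N v.tl.tl.toNat))

theorem decode_moveGate (n off N : ℕ) (v : Val) :
    Gate.decode (moveGate n off N v) = (Gate.decode v).map (moveWire n off N) := by
  unfold Gate.decode moveGate
  simp only [enc_pair, enc_nat, Val.hd_cons, Val.tl_cons, Val.toNat_ofNat]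
  split <;> rfl

/-- The code of the two circuits side by side. -/
def pairCircuit (c d : Val) : Val :=
  .cons (PCode.enc (wires c + wires d)) (PCode.enc
    (c.tl.toList.map (moveGate (wires c) 0 (wires c + wires d)) ++
      d.tl.toList.map (moveGate (wires d) (wires c) (wires c + wires d))))

theorem meas_pairCircuit (c d : Val) (P Q : List Bool → Prop) :
    meas (pairCircuit c d) (fun z => P (z.take (wires c)) ∧ Q (z.drop (wires c)))
      = meas c P * meas d Q := by
  have e1 : wires (pairCircuit c d) = wires c + wires d := by
    simp [pairCircuit, wires, enc_nat, Val.toNat_ofNat]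
  have e2 : (pairCircuit c d).tl.toList.map Gate.decode = pairGates (wires c) (wires d)
      (c.tl.toList.map Gate.decode) (d.tl.toList.map Gate.decode) := by
    simp [pairCircuit, enc_list, Val.toList_ofList, pairGates, decode_moveGate, enc_val,
      Function.comp_def]
  unfold meas
  rw [e1, e2, measProb_pairGates]

theorem meas_add_not (c : Val) (P : List Bool → Prop) : meas c P + meas c (fun z => ¬ P z) = 1 :=
  measProb_add_not _ _ _

section
variable {α : Type} [PCode α]

theorem PF.hd {f : α → Val} (hf : PF f) : PF fun a => (f a).hd :=
  PF.comp (PF.of_val PolyTime.hd) hf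
theorem PF.tl {f : α → Val} (hf : PF f) : PF fun a => (f a).tl :=
  PF.comp (PF.of_val PolyTime.tl) hf
theorem PF.valCons {f g : α → Val} (hf : PF f) (hg : PF g) : PF fun a => Val.cons (f a) (g a) :=
  PolyTime.cons hf hg
theorem PF.toNat {f : α → Val} (hf : PF f) : PF fun a => (f a).toNat := PF.dec' hf
theorem PF.wires {f : α → Val} (hf : PF f) : PF fun a => wires (f a) := hf.hd.toNat

theorem PF.toList {f : α → Val} (hf : PF f) : PF fun a => (f a).toList :=
  (PF.dec' (β := List Val) hf).congr fun v => by simp [PCode.dec]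

theorem PF.moveWire {n off N i : α → ℕ} (hn : PF n) (ho : PF off) (hN : PF N) (hi : PF i) :
    PF fun a => moveWire (n a) (off a) (N a) (i a) := by
  unfold HamLearn.moveWire
  fun_prop

theorem PF.moveGate {n off N : α → ℕ} {v : α → Val} (hn : PF n) (ho : PF off) (hN : PF N)
    (hv : PF v) : PF fun a => moveGate (n a) (off a) (N a) (v a) :=
  .valCons hv.hd (.enc' (.mk (.moveWire hn ho hN hv.tl.hd.toNat)
    (.moveWire hn ho hN hv.tl.tl.toNat)))

theorem PF.pairCircuit {c d : α → Val} (hc : PF c) (hd : PF d) :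
    PF fun a => pairCircuit (c a) (d a) := by
  have h1 : PF fun p : α × Val => HamLearn.wires (c p.1) := PF.wires (hc.comp (by fun_prop))
  have h2 : PF fun p : α × Val => HamLearn.wires (d p.1) := PF.wires (hd.comp (by fun_prop))
  refine .valCons (.enc' (hc.wires.add hd.wires)) (.enc' (.append ?_ ?_))
  · exact PF.map (l := fun a => (c a).tl.toList) hc.tl.toList
      (.moveGate h1 (.const 0) (h1.add h2) (by fun_prop))
  · exact PF.map (l := fun a => (d a).tl.toList) hd.tl.toList
      (.moveGate h2 h1 (h1.add h2) (by fun_prop))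

end

theorem enc_agree_ne_nil (y y' : Val) :
    PCode.enc (!((PCode.dec y : Bool) ^^ (PCode.dec y' : Bool))) ≠ .nil ↔
      (y ≠ .nil ∧ y' ≠ .nil) ∨ (¬ y ≠ .nil ∧ ¬ y' ≠ .nil) := by
  cases y <;> cases y' <;> simp [PCode.dec, enc_bool, Val.ofBool]

/-- Two independent runs of an algorithm can be compared: the probability that they agree. -/
theorem QPT.exists_agree (A : QPT) : ∃ A' : QPT, ∀ v,
    A'.acceptProb v = A.acceptProb v ^ 2 + (1 - A.acceptProb v) ^ 2 := by
  let n : Val → ℕ := fun v => A.coins.eval v.size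
  let R : Val × List Bool → Val := fun x => .cons x.1 (PCode.enc (x.2.take (n x.1)))
  let S : Val × List Bool → Val := fun x => .cons x.1 (PCode.enc (x.2.drop (n x.1)))
  have hn : PF n := by fun_prop
  have hn' : PF fun x : Val × List Bool => n x.1 := hn.comp (by fun_prop)
  have hR : PF R := .valCons (by fun_prop) (.enc' (.take hn' (by fun_prop)))
  have hS : PF S := .valCons (by fun_prop) (.enc' (.drop hn' (by fun_prop)))
  have hp : PF A.prep := PF.of_val A.prep_poly
  have hq : PF A.post := PF.of_val A.post_poly
  have hbool : PF fun v : Val => (PCode.dec v : Bool) := PF.dec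
  let T : (Val × List Bool) × List Bool → Bool := fun x =>
    PCode.dec (A.post (.cons (R x.1) (PCode.enc (x.2.take (wires (A.prep (R x.1)))))))
  let T' : (Val × List Bool) × List Bool → Bool := fun x =>
    PCode.dec (A.post (.cons (S x.1) (PCode.enc (x.2.drop (wires (A.prep (R x.1)))))))
  have hR' : PF fun x : (Val × List Bool) × List Bool => R x.1 := hR.comp (by fun_prop)
  have hS' : PF fun x : (Val × List Bool) × List Bool => S x.1 := hS.comp (by fun_prop)
  have hw : PF fun x : (Val × List Bool) × List Bool => wires (A.prep (R x.1)) :=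
    PF.wires (hp.comp hR')
  have hT : PF T := hbool.comp (hq.comp (.valCons hR' (.enc' (.take hw (by fun_prop)))))
  have hT' : PF T' := hbool.comp (hq.comp (.valCons hS' (.enc' (.drop hw (by fun_prop)))))
  have hg : PF fun x => PCode.enc (!(T x ^^ T' x)) := .enc' (.not (.xor hT hT'))
  refine ⟨QPT.ofPF (2 * A.coins) (fun x => pairCircuit (A.prep (R x)) (A.prep (S x)))
    (.pairCircuit (hp.comp hR) (hp.comp hS)) _ hg, fun v => ?_⟩
  rw [QPT.acceptProb_ofPF, Polynomial.eval_mul, Polynomial.eval_ofNat, two_mul, avg_add]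
  let a : List Bool → ℝ := fun r => meas (A.prep (.cons v (PCode.enc r)))
    fun z => A.post (.cons (.cons v (PCode.enc r)) (PCode.enc z)) ∈ {y : Val | y ≠ .nil}
  have ha : A.acceptProb v = avg (n v) a := outProb_eq _ _ _
  have key : ∀ r s : List Bool, r.length = n v →
      meas (pairCircuit (A.prep (R (v, r ++ s))) (A.prep (S (v, r ++ s))))
        (fun z => PCode.enc (!(T ((v, r ++ s), z) ^^ T' ((v, r ++ s), z))) ≠ .nil)
      = a r * a s + (1 - a r) * (1 - a s) := by
    intro r s hr
    have eR : R (v, r ++ s) = .cons v (PCode.enc r) := by simp [R, ← hr]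
    have eS : S (v, r ++ s) = .cons v (PCode.enc s) := by simp [S, ← hr]
    have n1 := meas_add_not (A.prep (.cons v (PCode.enc r)))
      fun z => A.post (.cons (.cons v (PCode.enc r)) (PCode.enc z)) ∈ {y : Val | y ≠ .nil}
    have n2 := meas_add_not (A.prep (.cons v (PCode.enc s)))
      fun z => A.post (.cons (.cons v (PCode.enc s)) (PCode.enc z)) ∈ {y : Val | y ≠ .nil}
    rw [show 1 - a r = meas (A.prep (.cons v (PCode.enc r))) fun z =>
        ¬ A.post (.cons (.cons v (PCode.enc r)) (PCode.enc z)) ∈ {y : Val | y ≠ .nil} by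
          simp only [a]; linarith,
      show 1 - a s = meas (A.prep (.cons v (PCode.enc s))) fun z =>
        ¬ A.post (.cons (.cons v (PCode.enc s)) (PCode.enc z)) ∈ {y : Val | y ≠ .nil} by
          simp only [a]; linarith]
    simp only [a]
    rw [← meas_pairCircuit, ← meas_pairCircuit]
    simp only [T, T', eR, eS]
    unfold meas measProb
    rw [← Finset.sum_add_distrib]
    refine Finset.sum_congr rfl fun z _ => ?_
    have hag := enc_agree_ne_nil
      (A.post ((v.cons (PCode.enc r)).cons (PCode.enc
        (List.take (wires (A.prep (v.cons (PCode.enc r)))) (List.ofFn z)))))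
      (A.post ((v.cons (PCode.enc s)).cons (PCode.enc
        (List.drop (wires (A.prep (v.cons (PCode.enc r)))) (List.ofFn z)))))
    simp only [Set.mem_ofPred_eq]
    split_ifs <;> first | (exfalso; tauto) | simp

  have h1 : ∀ r, r.length = n v → (avg (n v) fun s =>
      meas (pairCircuit (A.prep (R (v, r ++ s))) (A.prep (S (v, r ++ s))))
        (fun z => PCode.enc (!(T ((v, r ++ s), z) ^^ T' ((v, r ++ s), z))) ≠ .nil))
      = (2 * avg (n v) a - 1) * a r + (1 - avg (n v) a) := by
    intro r hr
    have : ∀ s : List Bool, s.length = n v →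
        meas (pairCircuit (A.prep (R (v, r ++ s))) (A.prep (S (v, r ++ s))))
          (fun z => PCode.enc (!(T ((v, r ++ s), z) ^^ T' ((v, r ++ s), z))) ≠ .nil)
        = (2 * a r - 1) * a s + (1 - a r) := fun s _ => by rw [key r s hr]; ring
    rw [avg_congr this, avg, unifE_add, unifE_mul_left, unifE_const]
    change (2 * a r - 1) * avg (n v) a + (1 - a r) = _
    ring
  rw [ha]
  refine (avg_congr h1).trans ?_
  rw [avg, unifE_add, unifE_mul_left, unifE_const]
  change (2 * avg (n v) a - 1) * avg (n v) a + (1 - avg (n v) a) = _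
  ring

/-! ### Spectra of diagonalized Hamiltonians -/

/-- Two real functions with the same multiset of values differ by a bijection. -/
theorem exists_equiv_of_map_eq {ι κ : Type} [Fintype ι] [Fintype κ] {f : ι → ℝ} {g : κ → ℝ}
    (h : Finset.univ.val.map f = Finset.univ.val.map g) : ∃ e : ι ≃ κ, ∀ i, f i = g (e i) := by
  classical
  have hc : ∀ r : ℝ, Nonempty ({i // f i = r} ≃ {k // g k = r}) := by
    intro r
    have := congrArg (Multiset.count r) h
    simp only [Multiset.count_map] at this
    refine ⟨Fintype.equivOfCardEq ?_⟩
    rw [Fintype.card_subtype, Fintype.card_subtype]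
    simpa [Finset.card_def, eq_comm] using this
  let e := ((Equiv.sigmaFiberEquiv f).symm.trans
    (Equiv.sigmaCongrRight fun r => (hc r).some)).trans (Equiv.sigmaFiberEquiv g)
  refine ⟨e, fun i => ?_⟩
  exact ((hc (f i)).some ⟨i, rfl⟩).2.symm

/-- The eigenvalues of a Hermitian matrix that a change of basis makes diagonal. -/
theorem exists_equiv_eigenvalues {ι : Type} [Fintype ι] [DecidableEq ι] {M : Matrix ι ι ℂ}
    (hM : M.IsHermitian) (U : (ι → ℂ) ≃ₗ[ℂ] (ι → ℂ)) (d : ι → ℝ)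
    (hU : ∀ ψ : ι → ℂ, M.mulVec (U ψ) = U fun x => (d x : ℂ) * ψ x) :
    (∃ e : Fin (Fintype.card ι) ≃ ι, ∀ i, hM.eigenvalues₀ i = d (e i)) ∧
      ∃ e : ι ≃ ι, ∀ i, hM.eigenvalues i = d (e i) := by
  let A := LinearMap.toMatrix' U.toLinearMap
  let B := LinearMap.toMatrix' U.symm.toLinearMap
  have hAB : A * B = 1 := by
    rw [← LinearMap.toMatrix'_comp]; simp
  have hBA : B * A = 1 := by
    rw [← LinearMap.toMatrix'_comp]; simp
  have hMA : M * A = A * Matrix.diagonal fun x => (d x : ℂ) := by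
    apply Matrix.toLin'.injective
    ext1 x
    ext1
    simp only [LinearMap.comp_apply, Matrix.toLin'_mul, A, Matrix.toLin'_toMatrix',
      Matrix.toLin'_apply, LinearEquiv.coe_coe]
    rw [hU]
    congr 1
    funext y
    rw [Matrix.mulVec_diagonal]
  have hM' : M = A * (Matrix.diagonal fun x => (d x : ℂ)) * B := by
    rw [← hMA, Matrix.mul_assoc, hAB, Matrix.mul_one]
  have hchar : M.charpoly = (Matrix.diagonal fun x => (d x : ℂ)).charpoly := by
    rw [hM', Matrix.charpoly_mul_comm, ← Matrix.mul_assoc, hBA, Matrix.one_mul]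
  have hroots : M.charpoly.roots = Finset.univ.val.map fun x => (d x : ℂ) := by
    rw [hchar, Matrix.charpoly_diagonal, Polynomial.roots_prod]
    · simp
    · simp [Finset.prod_ne_zero_iff, Polynomial.X_sub_C_ne_zero]
  have hre := congrArg (Multiset.map Complex.re) hroots
  simp only [Multiset.map_map, Function.comp_def, Complex.ofReal_re] at hre
  constructor
  · refine exists_equiv_of_map_eq ?_
    rw [← hre, hM.roots_charpoly_eq_eigenvalues₀]
    simp [Function.comp_def]
  · refine exists_equiv_of_map_eq ?_
    rw [← hre, hM.roots_charpoly_eq_eigenvalues]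
    simp [Multiset.map_map]

/-- A Hamiltonian which in some basis counts violated constraints, where exactly one assignment
violates none and some assignment violates exactly one. -/
theorem Ham.levels_of_diagonalized {n : ℕ} (H : Ham n) (U : QState n ≃ₗ[ℂ] QState n)
    (D : (Fin n → Bool) → ℕ)
    (hU : ∀ ψ : QState n, H.op.mulVec (U ψ) = U fun x => (D x : ℂ) * ψ x)
    (z₀ z₁ : Fin n → Bool) (h0 : ∀ z, D z = 0 ↔ z = z₀) (h1 : D z₁ = 1) :
    H.level 0 = 0 ∧ H.level 1 = 1 ∧
      ∀ ψ : QState n, H.op.mulVec ψ = 0 → ∃ c : ℂ, ψ = c • U (Pi.single z₀ 1) := by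
  obtain ⟨⟨e, he⟩, -⟩ := exists_equiv_eigenvalues H.op_isHermitian U (fun x => (D x : ℝ))
    (fun ψ => by rw [hU]; simp)
  have hne : z₁ ≠ z₀ := by
    rintro rfl
    rw [(h0 z₁).2 rfl] at h1
    exact absurd h1 (by norm_num)
  have hcard : 1 < Fintype.card (Fin n → Bool) := Fintype.one_lt_card_iff.2 ⟨z₁, z₀, hne⟩
  have hcard0 : 0 < Fintype.card (Fin n → Bool) := by omega
  have hanti := H.op_isHermitian.eigenvalues₀_antitone
  have hl0 : H.level 0 = D (e (Fin.rev ⟨0, hcard0⟩)) := by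
    rw [Ham.level, dif_pos hcard0, he]
  have hl1 : H.level 1 = D (e (Fin.rev ⟨1, hcard⟩)) := by
    rw [Ham.level, dif_pos hcard, he]
  have hmin : D (e (Fin.rev ⟨0, hcard0⟩)) = 0 := by
    have := hanti (show e.symm z₀ ≤ Fin.rev ⟨0, hcard0⟩ by
      rw [Fin.le_def, Fin.val_rev]
      have := (e.symm z₀).2
      simp only
      omega)
    rw [he, he, e.apply_symm_apply, (h0 z₀).2 rfl] at this
    have h2 : D (e (Fin.rev ⟨0, hcard0⟩)) ≤ 0 := by exact_mod_cast this
    omega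
  have e0 : e (Fin.rev ⟨0, hcard0⟩) = z₀ := (h0 _).1 hmin
  refine ⟨by rw [hl0, hmin, Nat.cast_zero], ?_, ?_⟩
  · have hle : D (e (Fin.rev ⟨1, hcard⟩)) ≤ 1 := by
      have := hanti (show e.symm z₁ ≤ Fin.rev ⟨1, hcard⟩ by
        rw [Fin.le_def, Fin.val_rev]
        have h2 := (e.symm z₁).2
        have h3 : (e.symm z₁ : ℕ) ≠ Fintype.card (Fin n → Bool) - (0 + 1) := by
          intro h
          apply hne
          rw [← e0, ← e.apply_symm_apply z₁]
          congr 1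
          exact Fin.ext (by rw [h, Fin.val_rev])
        simp only
        omega)
      rw [he, he, e.apply_symm_apply, h1] at this
      exact_mod_cast this
    have hge : D (e (Fin.rev ⟨1, hcard⟩)) ≠ 0 := by
      intro h
      have := ((h0 _).1 h).trans e0.symm
      have := congrArg Fin.val (e.injective this)
      rw [Fin.val_rev, Fin.val_rev] at this
      simp only at this
      omega
    rw [hl1]
    exact_mod_cast le_antisymm hle (Nat.one_le_iff_ne_zero.2 hge)
  · intro ψ hψ
    refine ⟨U.symm ψ z₀, ?_⟩
    have h2 := hU (U.symm ψ)
    rw [U.apply_symm_apply, hψ, eq_comm, map_eq_zero_iff U U.injective] at h2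
    rw [← map_smul, ← U.symm_apply_eq]
    funext z
    by_cases hz : z = z₀
    · subst hz; simp
    · have h3 := congrFun h2 z
      have h4 : (D z : ℂ) ≠ 0 := by
        rw [Nat.cast_ne_zero, ne_eq, h0]; exact hz
      simpa [hz, h4] using h3

/-! ### Entropy of uniform superpositions -/

theorem glue_restrict {n : ℕ} (W : Finset (Fin n)) (x : Fin n → Bool) :
    glue W (fun i => x i) (fun i => x i) = x := by
  funext i; simp [glue]

theorem glue_mem {n : ℕ} (W : Finset (Fin n)) (w : {i // i ∈ W} → Bool)
    (a : {i // i ∉ W} → Bool) (i : Fin n) (h : i ∈ W) : glue W w a i = w ⟨i, h⟩ := by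
  simp [glue, h]

theorem glue_not_mem {n : ℕ} (W : Finset (Fin n)) (w : {i // i ∈ W} → Bool)
    (a : {i // i ∉ W} → Bool) (i : Fin n) (h : i ∉ W) : glue W w a i = a ⟨i, h⟩ := by
  simp [glue, h]

open Classical in
/-- A uniform superposition of `2 ^ N` basis strings, each of which is determined by either of its
two parts, has entropy `N`. -/
theorem entanglementEntropy_uniform {n : ℕ} (W : Finset (Fin n)) (S : Finset (Fin n → Bool))
    (N : ℕ) (hS : S.card = 2 ^ N)
    (hW : ∀ x ∈ S, ∀ y ∈ S, (∀ i ∈ W, x i = y i) → x = y)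
    (hW' : ∀ x ∈ S, ∀ y ∈ S, (∀ i ∉ W, x i = y i) → x = y) (c : ℂ) (hc : ‖c‖ ^ 2 = (2 ^ N)⁻¹) :
    entanglementEntropy W (fun x => if x ∈ S then c else 0) = N := by
  let d : ({i // i ∉ W} → Bool) → ℝ := fun a => if ∃ w, glue W w a ∈ S then (2 ^ N)⁻¹ else 0
  have hρ : ptrace W (proj fun x => if x ∈ S then c else 0) =
      Matrix.diagonal fun a => (d a : ℂ) := by
    ext a b
    simp only [ptrace, proj, Matrix.vecMulVec_apply, Pi.star_apply, Matrix.diagonal_apply]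
    split_ifs with hab
    · subst hab
      simp only [d]
      split_ifs with hw
      · obtain ⟨w, hw⟩ := hw
        rw [Finset.sum_eq_single w]
        · rw [if_pos hw, ← hc]
          push_cast
          rw [← Complex.mul_conj']
          rfl
        · intro w' _ hne
          rw [if_neg, zero_mul]
          intro hw'
          refine hne (funext fun i => ?_)
          have := hW' _ hw' _ hw fun i hi => by rw [glue_not_mem _ _ _ _ hi, glue_not_mem _ _ _ _ hi]
          have := congrFun this i
          rwa [glue_mem _ _ _ _ i.2, glue_mem _ _ _ _ i.2] at this
        · simp
      · simp only [not_exists] at hw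
        simp [hw]
    · refine Finset.sum_eq_zero fun w _ => ?_
      by_cases h1 : glue W w a ∈ S
      · have h2 : glue W w b ∉ S := by
          intro h2
          refine hab (funext fun i => ?_)
          have := hW _ h1 _ h2 fun i hi => by rw [glue_mem _ _ _ _ hi, glue_mem _ _ _ _ hi]
          have := congrFun this i
          rwa [glue_not_mem _ _ _ _ i.2, glue_not_mem _ _ _ _ i.2] at this
        simp [h2]
      · simp [h1]
  have hcount : (Finset.univ.filter fun a => ∃ w, glue W w a ∈ S).card = 2 ^ N := by
    rw [← hS]
    symm
    refine Finset.card_bij (fun x _ => fun i => x i) ?_ ?_ ?_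
    · intro x hx
      simp only [Finset.mem_filter, Finset.mem_univ, true_and]
      exact ⟨fun i => x i, by rwa [glue_restrict]⟩
    · intro x hx y hy hxy
      exact hW' x hx y hy fun i hi => congrFun hxy ⟨i, hi⟩
    · intro a ha
      simp only [Finset.mem_filter, Finset.mem_univ, true_and] at ha
      obtain ⟨w, hw⟩ := ha
      exact ⟨_, hw, funext fun i => glue_not_mem _ _ _ _ i.2⟩
  obtain ⟨-, e, he⟩ := exists_equiv_eigenvalues
    (ptrace_proj_isHermitian W fun x => if x ∈ S then c else 0) (LinearEquiv.refl ℂ _) d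
    (fun ψ => by
      rw [hρ]
      funext a
      simp [Matrix.mulVec_diagonal])
  unfold entanglementEntropy vonNeumann
  simp only [he]
  rw [Equiv.sum_comp e fun a => Real.negMulLog (d a) / Real.log 2]
  have hterm : ∀ a, Real.negMulLog (d a) / Real.log 2 =
      if ∃ w, glue W w a ∈ S then (2 ^ N : ℝ)⁻¹ * N else 0 := by
    intro a
    simp only [d]
    split_ifs
    · have : Real.log 2 ≠ 0 := (Real.log_pos (by norm_num)).ne'
      rw [Real.negMulLog, Real.log_inv, Real.log_pow]
      field_simp
    · simp
  simp only [hterm]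
  rw [← Finset.sum_filter, Finset.sum_const, hcount, nsmul_eq_mul]
  push_cast
  field_simp

/-! ### Local terms given by tables -/

/-- The local term with the real matrix entries `e u v`, where `u` and `v` are the values of the
qubits in the support. -/
def tableTerm {n : ℕ} (supp : List (Fin n)) (h : supp.Nodup) (e : List Bool → List Bool → ℚ)
    (he : ∀ u v, e v u = e u v) : LocalTerm n where
  supp := supp
  nodup := h
  re x y := e (List.ofFn x) (List.ofFn y)
  im _ _ := 0
  re_symm x y := he _ _
  im_symm x y := by simp

theorem tableTerm_op {n : ℕ} (supp : List (Fin n)) (h : supp.Nodup)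
    (e : List Bool → List Bool → ℚ) (he : ∀ u v, e v u = e u v) (x y : Fin n → Bool) :
    (tableTerm supp h e he).op x y =
      if ∀ i, i ∉ supp → x i = y i then (e (supp.map x) (supp.map y) : ℂ) else 0 := by
  have hx : ∀ x : Fin n → Bool, (List.ofFn fun j => x (supp.get j)) = supp.map x := by
    intro x
    conv_rhs => rw [← List.ofFn_get supp, List.map_ofFn]
    rfl
  simp only [LocalTerm.op, tableTerm, hx]
  simp

/-- The matrix entries of the projector onto the assignments that a clause forbids. -/
def clauseTable (bad : List Bool → Bool) (u v : List Bool) : ℚ := if u = v ∧ bad u = true then 1 else 0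

theorem clauseTable_symm (bad : List Bool → Bool) (u v : List Bool) :
    clauseTable bad v u = clauseTable bad u v := by
  unfold clauseTable
  by_cases h : u = v
  · subst h; rfl
  · simp [h, Ne.symm h]

/-- A constraint on few qubits: the list of their values must not be `bad`. -/
structure Clause (n : ℕ) where
  supp : List (Fin n)
  nodup : supp.Nodup
  bad : List Bool → Bool

namespace Clause
variable {n : ℕ}

/-- The projector onto the assignments that violate the clause. -/
def term (c : Clause n) : LocalTerm n :=
  tableTerm c.supp c.nodup (clauseTable c.bad) (clauseTable_symm c.bad)

/-- Whether the assignment violates the clause. -/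
def violated (c : Clause n) (x : Fin n → Bool) : Bool := c.bad (c.supp.map x)

theorem term_op (c : Clause n) :
    c.term.op = Matrix.diagonal fun x => if c.violated x = true then 1 else 0 := by
  ext x y
  rw [term, tableTerm_op, Matrix.diagonal_apply]
  by_cases hxy : x = y
  · subst hxy
    simp only [clauseTable, violated, implies_true, if_true, true_and]
    split_ifs with h <;> simp [h]
  · rw [if_neg hxy]
    split_ifs with h
    · have : c.supp.map x ≠ c.supp.map y := by
        intro h2
        refine hxy (funext fun i => ?_)
        by_cases hi : i ∈ c.supp
        · exact List.map_inj_left.1 h2 i hi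
        · exact h i hi
      simp [clauseTable, this]
    · rfl

theorem term_posSemidef (c : Clause n) : c.term.op.PosSemidef := by
  rw [term_op]
  refine Matrix.PosSemidef.diagonal fun x => ?_
  simp only [Pi.zero_apply]
  split_ifs <;> simp

end Clause

/-- The matrix entries of the term on a control qubit `b` and a pair of qubits: it penalizes
everything but `00` if the control is `0`, and everything but the Bell state `00 + 11` if the
control is `1`. -/
def bellEntry (b p q b' p' q' : Bool) : ℚ :=
  if b = b' then
    if b then
      if p = q then (if p' = q' then (if p = p' then 1 / 2 else -1 / 2) else 0)
      else if p = p' ∧ q = q' then 1 else 0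
    else if (p || q) ∧ p = p' ∧ q = q' then 1 else 0
  else 0

/-- `bellEntry` for the lists of the values of the control qubit and the pair. -/
def bellTable (u v : List Bool) : ℚ :=
  bellEntry (u.getD 0 false) (u.getD 1 false) (u.getD 2 false)
    (v.getD 0 false) (v.getD 1 false) (v.getD 2 false)

theorem bellEntry_symm : ∀ b p q b' p' q', bellEntry b' p' q' b p q = bellEntry b p q b' p' q' := by
  decide +kernel

theorem bellEntry_ne_zero : ∀ b p q b' p' q', bellEntry b p q b' p' q' ≠ 0 →
    b' = b ∧ (p' = p ∧ q' = q ∨ p' = !p ∧ q' = !q) := by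
  decide +kernel

theorem bellTable_symm (u v : List Bool) : bellTable v u = bellTable u v := bellEntry_symm _ _ _ _ _ _

/-! ### Controlled Bell pairs -/

/-- `m` pairs of qubits `p j`, `q j`, each with a control qubit `b j`. -/
structure PairSys (n m : ℕ) where
  b : Fin m → Fin n
  p : Fin m → Fin n
  q : Fin m → Fin n
  p_inj : Function.Injective p
  q_inj : Function.Injective q
  p_ne_q : ∀ i j, p i ≠ q j
  b_ne_p : ∀ i j, b i ≠ p j
  b_ne_q : ∀ i j, b i ≠ q j

/-- The operator `ψ ↦ α ψ + β (ψ ∘ s)`. -/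
def twoPoint {n : ℕ} (s : (Fin n → Bool) → (Fin n → Bool)) (α β : (Fin n → Bool) → ℂ) :
    QState n →ₗ[ℂ] QState n where
  toFun ψ x := α x * ψ x + β x * ψ (s x)
  map_add' ψ χ := by funext x; simp; ring
  map_smul' c ψ := by funext x; simp; ring

theorem twoPoint_comm {n : ℕ} {s t : (Fin n → Bool) → (Fin n → Bool)}
    {α β γ δ : (Fin n → Bool) → ℂ} (hst : ∀ x, s (t x) = t (s x)) (hα : ∀ x, α (t x) = α x)
    (hβ : ∀ x, β (t x) = β x) (hγ : ∀ x, γ (s x) = γ x) (hδ : ∀ x, δ (s x) = δ x)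
    (ψ : QState n) : twoPoint s α β (twoPoint t γ δ ψ) = twoPoint t γ δ (twoPoint s α β ψ) := by
  funext x
  simp only [twoPoint, LinearMap.coe_mk, AddHom.coe_mk, hα, hβ, hγ, hδ, hst]
  ring

namespace PairSys
variable {n m : ℕ} (P : PairSys n m)

/-- Flips both qubits of the pair `j`. -/
def flip (j : Fin m) (x : Fin n → Bool) : Fin n → Bool :=
  fun i => if i = P.p j ∨ i = P.q j then !x i else x i

theorem flip_p (j : Fin m) (x : Fin n → Bool) : P.flip j x (P.p j) = !x (P.p j) := by simp [flip]

theorem flip_q (j : Fin m) (x : Fin n → Bool) : P.flip j x (P.q j) = !x (P.q j) := by simp [flip]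

theorem flip_b (i j : Fin m) (x : Fin n → Bool) : P.flip j x (P.b i) = x (P.b i) := by
  simp [flip, P.b_ne_p, P.b_ne_q]

theorem flip_p_of_ne {i j : Fin m} (h : i ≠ j) (x : Fin n → Bool) :
    P.flip j x (P.p i) = x (P.p i) := by
  simp [flip, P.p_ne_q, P.p_inj.eq_iff, h]

theorem flip_q_of_ne {i j : Fin m} (h : i ≠ j) (x : Fin n → Bool) :
    P.flip j x (P.q i) = x (P.q i) := by
  simp [flip, fun i j => (P.p_ne_q i j).symm, P.q_inj.eq_iff, h]

theorem flip_flip (j : Fin m) (x : Fin n → Bool) : P.flip j (P.flip j x) = x := by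
  funext i
  simp only [flip]
  split_ifs <;> simp

theorem flip_comm (i j : Fin m) (x : Fin n → Bool) :
    P.flip i (P.flip j x) = P.flip j (P.flip i x) := by
  funext k
  simp only [flip]
  split_ifs <;> rfl

theorem flip_ne (j : Fin m) (x : Fin n → Bool) : P.flip j x ≠ x := by
  intro h
  have := congrFun h (P.p j)
  rw [flip_p] at this
  simp at this

/-- Whether the pair `j` is in a state other than `00`; in the basis in which the Hamiltonian is
diagonal, this costs the energy `1`. -/
def excited (j : Fin m) (x : Fin n → Bool) : Bool := x (P.p j) || x (P.q j)

/-- Whether the pair `j` is controlled into the span of `00` and `11`. -/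
def active (j : Fin m) (x : Fin n → Bool) : Bool := x (P.b j) && (x (P.p j) == x (P.q j))

theorem active_flip (i j : Fin m) (x : Fin n → Bool) : P.active i (P.flip j x) = P.active i x := by
  by_cases h : i = j
  · subst h
    simp only [active, flip_b, flip_p, flip_q]
    cases x (P.p i) <;> cases x (P.q i) <;> rfl
  · simp only [active, flip_b, P.flip_p_of_ne h, P.flip_q_of_ne h]

theorem excited_flip {i j : Fin m} (h : i ≠ j) (x : Fin n → Bool) :
    P.excited i (P.flip j x) = P.excited i x := by
  simp only [excited, P.flip_p_of_ne h, P.flip_q_of_ne h]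

/-- The term of the pair `j`. -/
noncomputable def bellOp (j : Fin m) : QState n →ₗ[ℂ] QState n :=
  twoPoint (P.flip j) (fun x => if P.active j x then 1 / 2 else if P.excited j x then 1 else 0)
    (fun x => if P.active j x then -1 / 2 else 0)

/-- The controlled Hadamard transformation of the span of `00` and `11`, which diagonalizes the
term of the pair `j`. -/
noncomputable def hadOp (j : Fin m) : QState n →ₗ[ℂ] QState n :=
  twoPoint (P.flip j)
    (fun x => if P.active j x then (if x (P.p j) then -1 else 1) / (√2 : ℝ) else 1)
    (fun x => if P.active j x then 1 / (√2 : ℝ) else 0)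

theorem sqrt_two_inv_mul : (1 / (√2 : ℝ) : ℂ) * (1 / (√2 : ℝ)) = 1 / 2 := by
  rw [div_mul_div_comm, ← Complex.ofReal_mul, Real.mul_self_sqrt (by norm_num)]
  norm_num

theorem hadOp_hadOp (j : Fin m) (ψ : QState n) : P.hadOp j (P.hadOp j ψ) = ψ := by
  funext x
  simp only [hadOp, twoPoint, LinearMap.coe_mk, AddHom.coe_mk, active_flip, flip_flip, flip_p]
  have h := sqrt_two_inv_mul
  set r : ℂ := 1 / (√2 : ℝ) with hr
  have e : ∀ a : ℂ, a / (√2 : ℝ) = a * r := fun a => by rw [hr]; ring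
  simp only [e]
  cases P.active j x
  · simp
  · cases x (P.p j)
    · simp; linear_combination (2 * ψ x) * h
    · simp; linear_combination (2 * ψ x) * h

/-- The same transformation as a linear equivalence. -/
noncomputable def hadEquiv (j : Fin m) : QState n ≃ₗ[ℂ] QState n :=
  LinearEquiv.ofInvolutive (P.hadOp j) (P.hadOp_hadOp j)

/-- The term of the pair `j` is diagonal after the controlled Hadamard transformation. -/
theorem bellOp_hadOp (j : Fin m) (ψ : QState n) : P.bellOp j (P.hadOp j ψ) =
    P.hadOp j fun x => (if P.excited j x then 1 else 0) * ψ x := by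
  funext x
  simp only [hadOp, bellOp, twoPoint, LinearMap.coe_mk, AddHom.coe_mk, active_flip, flip_flip,
    flip_p]
  cases h : P.active j x
  · simp
  · have hpq : x (P.p j) = x (P.q j) := by
      simp only [active, Bool.and_eq_true, beq_iff_eq] at h
      exact h.2
    have e1 : P.excited j x = x (P.p j) := by rw [excited, ← hpq, Bool.or_self]
    have e2 : P.excited j (P.flip j x) = !x (P.p j) := by
      rw [excited, flip_p, flip_q, ← hpq, Bool.or_self]
    rw [e1, e2]
    cases x (P.p j) <;> simp <;> ring

theorem bellOp_bellOp (j : Fin m) (ψ : QState n) : P.bellOp j (P.bellOp j ψ) = P.bellOp j ψ := by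
  funext x
  simp only [bellOp, twoPoint, LinearMap.coe_mk, AddHom.coe_mk, active_flip, flip_flip]
  cases h : P.active j x
  · cases P.excited j x <;> simp
  · simp; ring

/-- The local term of the pair `j`. -/
def bellTerm (j : Fin m) : LocalTerm n :=
  tableTerm [P.b j, P.p j, P.q j]
    (by simp [P.b_ne_p, P.b_ne_q, P.p_ne_q]) bellTable bellTable_symm

theorem bellTerm_mulVec (j : Fin m) (ψ : QState n) :
    (P.bellTerm j).op.mulVec ψ = P.bellOp j ψ := by
  funext x
  have key : ∀ y, (P.bellTerm j).op x y =
      (if y = x then (if P.active j x then 1 / 2 else if P.excited j x then 1 else 0) else 0) +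
      (if y = P.flip j x then (if P.active j x then -1 / 2 else 0) else 0) := by
    intro y
    rw [bellTerm, tableTerm_op]
    have hbt : bellTable ([P.b j, P.p j, P.q j].map x) ([P.b j, P.p j, P.q j].map y) =
      bellEntry (x (P.b j)) (x (P.p j)) (x (P.q j)) (y (P.b j)) (y (P.p j)) (y (P.q j)) := rfl
    rw [hbt]
    by_cases h1 : y = x
    · subst h1
      rw [if_pos rfl, if_neg (P.flip_ne j y).symm, if_pos (fun _ _ => rfl)]
      have : ∀ b p q : Bool, ((bellEntry b p q b p q : ℚ) : ℂ) =
          (if (b && (p == q)) = true then 1 / 2 else if (p || q) = true then 1 else 0) + 0 := by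
        intro b p q; cases b <;> cases p <;> cases q <;> simp [bellEntry]
      exact this _ _ _
    · rw [if_neg h1]
      by_cases h2 : y = P.flip j x
      · rw [if_pos h2]
        subst h2
        rw [if_pos]
        · have : ∀ b p q : Bool, ((bellEntry b p q b (!p) (!q) : ℚ) : ℂ) =
              0 + (if (b && (p == q)) = true then -1 / 2 else 0) := by
            intro b p q; cases b <;> cases p <;> cases q <;> simp [bellEntry]
          rw [flip_b, flip_p, flip_q]
          exact this _ _ _
        · intro i hi
          simp only [List.mem_cons, List.not_mem_nil, or_false, not_or] at hi
          simp [flip, hi.2.1, hi.2.2]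
      · rw [if_neg h2, add_zero]
        split_ifs with h
        · have : bellEntry (x (P.b j)) (x (P.p j)) (x (P.q j)) (y (P.b j)) (y (P.p j))
              (y (P.q j)) = 0 := by
            by_contra hne
            obtain ⟨hb, hpq⟩ := bellEntry_ne_zero _ _ _ _ _ _ hne
            rcases hpq with ⟨hp, hq⟩ | ⟨hp, hq⟩
            · refine h1 (funext fun i => ?_)
              by_cases hi : i ∈ [P.b j, P.p j, P.q j]
              · simp only [List.mem_cons, List.not_mem_nil, or_false] at hi
                rcases hi with rfl | rfl | rfl <;> assumption
              · exact (h i hi).symm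
            · refine h2 (funext fun i => ?_)
              by_cases hi : i ∈ [P.b j, P.p j, P.q j]
              · simp only [List.mem_cons, List.not_mem_nil, or_false] at hi
                rcases hi with rfl | rfl | rfl
                · rw [flip_b]; exact hb
                · rw [flip_p]; exact hp
                · rw [flip_q]; exact hq
              · rw [← h i hi]
                simp only [List.mem_cons, List.not_mem_nil, or_false, not_or] at hi
                simp [flip, hi.2.1, hi.2.2]
          rw [this, Rat.cast_zero]
        · rfl
  simp only [Matrix.mulVec, dotProduct, key, add_mul, Finset.sum_add_distrib, ite_mul, zero_mul,
    Finset.sum_ite_eq', Finset.mem_univ, if_true, bellOp, twoPoint, LinearMap.coe_mk,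
    AddHom.coe_mk]

theorem bellTerm_posSemidef (j : Fin m) : (P.bellTerm j).op.PosSemidef := by
  have h1 : (P.bellTerm j).op * (P.bellTerm j).op = (P.bellTerm j).op := by
    apply Matrix.toLin'.injective
    ext1 x
    ext1
    simp only [LinearMap.comp_apply, Matrix.toLin'_mul, Matrix.toLin'_apply, bellTerm_mulVec,
      bellOp_bellOp]
  have h2 := Matrix.posSemidef_conjTranspose_mul_self (P.bellTerm j).op
  rwa [(Ham.term_isHermitian (P.bellTerm j)).eq, h1] at h2

theorem hadOp_diag (j : Fin m) (d : (Fin n → Bool) → ℂ) (hd : ∀ x, d (P.flip j x) = d x)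
    (ψ : QState n) : (fun x => d x * P.hadOp j ψ x) = P.hadOp j fun x => d x * ψ x := by
  funext x
  simp only [hadOp, twoPoint, LinearMap.coe_mk, AddHom.coe_mk, hd]
  ring

theorem bellOp_hadOp_of_ne {i j : Fin m} (h : i ≠ j) (ψ : QState n) :
    P.bellOp i (P.hadOp j ψ) = P.hadOp j (P.bellOp i ψ) :=
  twoPoint_comm (P.flip_comm i j) (fun x => by simp only [active_flip, P.excited_flip h])
    (fun x => by simp only [active_flip])
    (fun x => by simp only [active_flip, P.flip_p_of_ne h.symm])
    (fun x => by simp only [active_flip]) ψ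

/-- The change of basis that treats all pairs in a list. -/
noncomputable def basisChange : List (Fin m) → QState n ≃ₗ[ℂ] QState n
  | [] => LinearEquiv.refl ℂ _
  | j :: L => (basisChange L).trans (P.hadEquiv j)

theorem basisChange_diag (L : List (Fin m)) (d : (Fin n → Bool) → ℂ)
    (hd : ∀ j ∈ L, ∀ x, d (P.flip j x) = d x) (ψ : QState n) :
    (fun x => d x * P.basisChange L ψ x) = P.basisChange L fun x => d x * ψ x := by
  induction L generalizing ψ with
  | nil => rfl
  | cons j L ih =>
    change (fun x => d x * P.hadOp j (P.basisChange L ψ) x) =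
      P.hadOp j (P.basisChange L fun x => d x * ψ x)
    rw [P.hadOp_diag j d (hd j List.mem_cons_self),
      ih fun i hi => hd i (List.mem_cons_of_mem _ hi)]

theorem bellOp_basisChange (L : List (Fin m)) (hL : L.Nodup) (j : Fin m) (hj : j ∈ L)
    (ψ : QState n) : P.bellOp j (P.basisChange L ψ) =
      P.basisChange L fun x => (if P.excited j x then 1 else 0) * ψ x := by
  induction L generalizing ψ with
  | nil => simp at hj
  | cons i L ih =>
    obtain ⟨hi, hL⟩ := List.nodup_cons.1 hL
    change P.bellOp j (P.hadOp i (P.basisChange L ψ)) = P.hadOp i (P.basisChange L _)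
    by_cases hij : j = i
    · subst hij
      rw [bellOp_hadOp, P.basisChange_diag L (fun x => if P.excited j x then 1 else 0)]
      intro k hk x
      have : j ≠ k := by rintro rfl; exact hi hk
      rw [P.excited_flip this]
    · rw [P.bellOp_hadOp_of_ne hij, ih hL ((List.mem_cons.1 hj).resolve_left hij)]

end PairSys

/-! ### The ground state of controlled Bell pairs -/

namespace PairSys
variable {n m : ℕ} (P : PairSys n m)

theorem list_sum_mulVec {ι : Type} [Fintype ι] (L : List (Matrix ι ι ℂ)) (ψ : ι → ℂ) (x : ι) :
    L.sum.mulVec ψ x = (L.map fun M => M.mulVec ψ x).sum := by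
  induction L with
  | nil => simp
  | cons M L ih => simp [Matrix.add_mulVec, ih]

/-- The number of violated clauses. -/
def violations (C : List (Clause n)) (x : Fin n → Bool) : ℕ :=
  (C.map fun c => if c.violated x = true then 1 else 0).sum

/-- The number of excited pairs. -/
def excitations (x : Fin n → Bool) : ℕ :=
  ((List.finRange m).map fun j => if P.excited j x = true then 1 else 0).sum

theorem clauses_mulVec (C : List (Clause n)) (ψ : QState n) (x : Fin n → Bool) :
    (C.map fun c => c.term.op.mulVec ψ x).sum = violations C x * ψ x := by
  induction C with
  | nil => simp [violations]
  | cons c C ih =>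
    have h : violations (c :: C) x = (if c.violated x = true then 1 else 0) + violations C x := rfl
    rw [List.map_cons, List.sum_cons, ih, h, Clause.term_op, Matrix.mulVec_diagonal]
    push_cast
    ring

theorem op_mulVec {H : Ham n} {C : List (Clause n)}
    (hH : H.terms = C.map Clause.term ++ (List.finRange m).map P.bellTerm) (ψ : QState n)
    (x : Fin n → Bool) : H.op.mulVec ψ x =
      violations C x * ψ x + ((List.finRange m).map fun j => P.bellOp j ψ x).sum := by
  rw [Ham.op, hH, list_sum_mulVec]
  simp only [List.map_append, List.map_map, List.sum_append, Function.comp_def,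
    bellTerm_mulVec, clauses_mulVec]

/-- The Hamiltonian counts violated clauses and excited pairs, in the basis in which all terms are
diagonal. -/
theorem op_basisChange {H : Ham n} {C : List (Clause n)}
    (hH : H.terms = C.map Clause.term ++ (List.finRange m).map P.bellTerm)
    (hC : ∀ c ∈ C, ∀ j, P.p j ∉ c.supp ∧ P.q j ∉ c.supp) (ψ : QState n) :
    H.op.mulVec (P.basisChange (List.finRange m) ψ) = P.basisChange (List.finRange m)
      fun x => ((violations C x + P.excitations x : ℕ) : ℂ) * ψ x := by
  have hviol : ∀ j x, violations C (P.flip j x) = violations C x := by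
    intro j x
    unfold violations
    congr 1
    refine List.map_congr_left fun c hc => ?_
    have : c.supp.map (P.flip j x) = c.supp.map x := by
      refine List.map_congr_left fun i hi => ?_
      have h1 : i ≠ P.p j := by rintro rfl; exact (hC c hc j).1 hi
      have h2 : i ≠ P.q j := by rintro rfl; exact (hC c hc j).2 hi
      simp [flip, h1, h2]
    rw [Clause.violated, this, Clause.violated]
  funext x
  rw [P.op_mulVec hH]
  have h1 := congrFun (P.basisChange_diag (List.finRange m) (fun x => (violations C x : ℂ))
    (fun j _ x => by rw [hviol]) ψ) x
  have h2 : ∀ j, P.bellOp j (P.basisChange (List.finRange m) ψ) =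
      P.basisChange (List.finRange m) fun x => (if P.excited j x then 1 else 0) * ψ x := fun j =>
    P.bellOp_basisChange _ (List.nodup_finRange m) j (List.mem_finRange j) ψ
  rw [h1]
  simp only [h2]
  have h3 : (fun x => ((violations C x + P.excitations x : ℕ) : ℂ) * ψ x) =
      (fun x => (violations C x : ℂ) * ψ x) +
        ((List.finRange m).map fun j => (fun x => (if P.excited j x then (1 : ℂ) else 0) * ψ x)).sum := by
    funext y
    have : ∀ L : List (Fin m), ((L.map fun j => if P.excited j y = true then 1 else 0).sum : ℕ) * ψ y
        = (L.map fun j => (fun x => (if P.excited j x then (1 : ℂ) else 0) * ψ x)).sum y := by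
      intro L
      induction L with
      | nil => simp
      | cons j L ih =>
        simp only [List.map_cons, List.sum_cons, Pi.add_apply, ← ih]
        push_cast
        ring
    rw [Pi.add_apply, ← this, excitations]
    push_cast
    ring
  have h4 : ∀ (L : List (Fin m)) (F : Fin m → QState n), (L.map fun j => F j x).sum =
      (L.map F).sum x := by
    intro L F
    induction L with
    | nil => rfl
    | cons j L ih => simp only [List.map_cons, List.sum_cons, Pi.add_apply, ih]
  rw [h3, map_add, map_list_sum, Pi.add_apply, List.map_map, h4]
  rfl

open Classical in
/-- The basis strings of the ground state: off the pairs they agree with `z`, and every pair is in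
the state `00`, or `11` if the common control value `c` is `1`. -/
noncomputable def groundSet (z : Fin n → Bool) (c : Bool) : Finset (Fin n → Bool) :=
  Finset.univ.filter fun x => (∀ i, (∀ j, i ≠ P.p j ∧ i ≠ P.q j) → x i = z i) ∧
    ∀ j, x (P.p j) = x (P.q j) ∧ (c = false → x (P.p j) = false)

theorem mem_groundSet {z x : Fin n → Bool} {c : Bool} : x ∈ P.groundSet z c ↔
    (∀ i, (∀ j, i ≠ P.p j ∧ i ≠ P.q j) → x i = z i) ∧
      ∀ j, x (P.p j) = x (P.q j) ∧ (c = false → x (P.p j) = false) := by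
  simp [groundSet]

open Classical in
theorem card_groundSet (z : Fin n → Bool) (c : Bool) :
    (P.groundSet z c).card = 2 ^ (if c then m else 0) := by
  -- The string with given values on the pairs.
  let mk : (Fin m → Bool) → Fin n → Bool := fun y i =>
    if h : ∃ j, i = P.p j ∨ i = P.q j then y h.choose else z i
  have mk_p : ∀ y j, mk y (P.p j) = y j := by
    intro y j
    have h : ∃ k, P.p j = P.p k ∨ P.p j = P.q k := ⟨j, Or.inl rfl⟩
    have h2 : h.choose = j := by
      rcases h.choose_spec with h3 | h3
      · exact (P.p_inj h3).symm
      · exact absurd h3 (P.p_ne_q _ _)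
    simp only [mk, dif_pos h, h2]
  have mk_q : ∀ y j, mk y (P.q j) = y j := by
    intro y j
    have h : ∃ k, P.q j = P.p k ∨ P.q j = P.q k := ⟨j, Or.inr rfl⟩
    have h2 : h.choose = j := by
      rcases h.choose_spec with h3 | h3
      · exact absurd h3.symm (P.p_ne_q _ _)
      · exact (P.q_inj h3).symm
    simp only [mk, dif_pos h, h2]
  have mk_off : ∀ y i, (∀ j, i ≠ P.p j ∧ i ≠ P.q j) → mk y i = z i := by
    intro y i hi
    simp only [mk]
    rw [dif_neg]
    rintro ⟨j, h | h⟩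
    · exact (hi j).1 h
    · exact (hi j).2 h
  have ext : ∀ x x' : Fin n → Bool, (∀ i, (∀ j, i ≠ P.p j ∧ i ≠ P.q j) → x i = x' i) →
      (∀ j, x (P.p j) = x' (P.p j)) → (∀ j, x (P.q j) = x' (P.q j)) → x = x' := by
    intro x x' h1 h2 h3
    funext i
    by_cases h : ∃ j, i = P.p j ∨ i = P.q j
    · obtain ⟨j, rfl | rfl⟩ := h
      · exact h2 j
      · exact h3 j
    · refine h1 i fun j => ⟨fun h' => h ⟨j, Or.inl h'⟩, fun h' => h ⟨j, Or.inr h'⟩⟩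
  clear_value mk
  cases c
  · have : P.groundSet z false = {mk fun _ => false} := by
      ext x
      rw [mem_groundSet, Finset.mem_singleton]
      constructor
      · rintro ⟨h1, h2⟩
        refine ext _ _ (fun i hi => by rw [h1 i hi, mk_off _ _ hi]) (fun j => ?_) (fun j => ?_)
        · rw [mk_p, (h2 j).2 rfl]
        · rw [mk_q, ← (h2 j).1, (h2 j).2 rfl]
      · rintro rfl
        exact ⟨fun i hi => mk_off _ _ hi, fun j => ⟨by rw [mk_p, mk_q], fun _ => mk_p _ _⟩⟩
    simp [this]
  · have : P.groundSet z true = Finset.univ.image mk := by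
      ext x
      rw [mem_groundSet, Finset.mem_image]
      constructor
      · rintro ⟨h1, h2⟩
        refine ⟨fun j => x (P.p j), Finset.mem_univ _, ext _ _ (fun i hi => ?_) (fun j => ?_)
          (fun j => ?_)⟩
        · rw [mk_off _ _ hi, h1 i hi]
        · rw [mk_p]
        · rw [mk_q, (h2 j).1]
      · rintro ⟨y, -, rfl⟩
        exact ⟨fun i hi => mk_off _ _ hi, fun j => ⟨by rw [mk_p, mk_q], by simp⟩⟩
    rw [this, Finset.card_image_of_injective]
    · simp
    · intro y y' h
      funext j
      rw [← mk_p y, h, mk_p]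

open Classical in
/-- The ground state: the uniform superposition of the strings in `groundSet`. -/
noncomputable def groundState (z : Fin n → Bool) (c : Bool) : QState n := fun x =>
  if x ∈ P.groundSet z c then ((√((2 ^ (if c then m else 0))⁻¹ : ℝ) : ℝ) : ℂ) else 0

theorem norm_sq_amplitude (N : ℕ) : ‖((√((2 ^ N)⁻¹ : ℝ) : ℝ) : ℂ)‖ ^ 2 = (2 ^ N : ℝ)⁻¹ := by
  rw [Complex.norm_real, Real.norm_of_nonneg (Real.sqrt_nonneg _), Real.sq_sqrt (by positivity)]

/-- The cut that contains one qubit of every pair. -/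
def cut : Finset (Fin n) := Finset.univ.image P.q

theorem entropy_groundState (z : Fin n → Bool) (c : Bool) :
    entanglementEntropy P.cut (P.groundState z c) = ((if c then m else 0 : ℕ) : ℝ) := by
  refine entanglementEntropy_uniform P.cut _ _ (P.card_groundSet z c) ?_ ?_ _ ?_
  · intro x hx y hy h
    rw [mem_groundSet] at hx hy
    have hq : ∀ j, x (P.q j) = y (P.q j) := fun j => h _ (by simp [cut])
    funext i
    by_cases hi : ∃ j, i = P.p j ∨ i = P.q j
    · obtain ⟨j, rfl | rfl⟩ := hi
      · rw [(hx.2 j).1, hq, (hy.2 j).1]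
      · exact hq j
    · have hi' : ∀ j, i ≠ P.p j ∧ i ≠ P.q j := fun j =>
        ⟨fun h' => hi ⟨j, Or.inl h'⟩, fun h' => hi ⟨j, Or.inr h'⟩⟩
      rw [hx.1 i hi', hy.1 i hi']
  · intro x hx y hy h
    rw [mem_groundSet] at hx hy
    funext i
    by_cases hi : ∃ j, P.q j = i
    · obtain ⟨j, rfl⟩ := hi
      rw [← (hx.2 j).1, ← (hy.2 j).1]
      exact h _ (by simp only [cut, Finset.mem_image, Finset.mem_univ, true_and, not_exists]
                    exact fun k => (P.p_ne_q j k).symm)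
    · exact h i (by simpa [cut] using hi)
  · exact norm_sq_amplitude _

/-- If exactly one assignment off the pairs satisfies all clauses, and it gives all controls the
value `c`, then the Hamiltonian is frustration-free with a unique ground state and spectral gap
`1`. -/
theorem groundStructure {H : Ham n} {C : List (Clause n)}
    (hH : H.terms = C.map Clause.term ++ (List.finRange m).map P.bellTerm)
    (hC : ∀ c ∈ C, ∀ j, P.p j ∉ c.supp ∧ P.q j ∉ c.supp) (hm : 0 < m) (z : Fin n → Bool) (c : Bool)
    (hz : ∀ c ∈ C, c.violated z = false)
    (huniq : ∀ x : Fin n → Bool, (∀ c ∈ C, c.violated x = false) →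
      ∀ i, (∀ j, i ≠ P.p j ∧ i ≠ P.q j) → x i = z i)
    (hb : ∀ j, z (P.b j) = c) (hzp : ∀ j, z (P.p j) = false ∧ z (P.q j) = false) :
    H.GroundStructure ∧ H.IsUniqueGroundState (P.groundState z c) := by
  have hv0 : ∀ x, violations C x = 0 ↔ ∀ c ∈ C, c.violated x = false := by
    intro x
    simp [violations, List.sum_eq_zero_iff]
  have he0 : ∀ x, P.excitations x = 0 ↔ ∀ j, P.excited j x = false := by
    intro x
    simp [excitations, List.sum_eq_zero_iff]
  have hclause : ∀ x : Fin n → Bool, (∀ i, (∀ j, i ≠ P.p j ∧ i ≠ P.q j) → x i = z i) →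
      ∀ c ∈ C, c.violated x = false := by
    intro x hx c hc
    rw [← hz c hc, Clause.violated, Clause.violated]
    congr 1
    refine List.map_congr_left fun i hi => hx i fun j => ⟨?_, ?_⟩
    · rintro rfl; exact (hC c hc j).1 hi
    · rintro rfl; exact (hC c hc j).2 hi
  have hD0 : ∀ x, violations C x + P.excitations x = 0 ↔ x = z := by
    intro x
    rw [Nat.add_eq_zero_iff, hv0, he0]
    constructor
    · rintro ⟨h1, h2⟩
      funext i
      by_cases hi : ∃ j, i = P.p j ∨ i = P.q j
      · obtain ⟨j, hj⟩ := hi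
        have := h2 j
        simp only [excited, Bool.or_eq_false_iff] at this
        rcases hj with rfl | rfl
        · rw [this.1, (hzp j).1]
        · rw [this.2, (hzp j).2]
      · exact huniq x h1 i fun j => ⟨fun h' => hi ⟨j, Or.inl h'⟩, fun h' => hi ⟨j, Or.inr h'⟩⟩
    · rintro rfl
      exact ⟨hz, fun j => by simp [excited, hzp j]⟩
  -- Flipping one qubit of one pair excites this pair and nothing else.
  obtain ⟨z₁, hz₁⟩ : ∃ z₁, z₁ = Function.update z (P.p ⟨0, hm⟩) true := ⟨_, rfl⟩
  have hD1 : violations C z₁ + P.excitations z₁ = 1 := by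
    have h1 : violations C z₁ = 0 := (hv0 _).2 (hclause _ fun i hi => by
      rw [hz₁, Function.update_of_ne (hi ⟨0, hm⟩).1])
    have h2 : P.excitations z₁ = 1 := by
      have h3 : ∀ j, P.excited j z₁ = decide (j = ⟨0, hm⟩) := by
        intro j
        have hq : z₁ (P.q j) = false := by
          rw [hz₁, Function.update_of_ne (P.p_ne_q _ _).symm, (hzp j).2]
        by_cases hj : j = ⟨0, hm⟩
        · subst hj; simp [excited, hz₁]
        · have hp : z₁ (P.p j) = false := by
            rw [hz₁, Function.update_of_ne (fun h => hj (P.p_inj h)), (hzp j).1]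
          simp [excited, hp, hq, hj]
      simp only [excitations, h3, decide_eq_true_eq]
      rw [← List.ofFn_eq_map, List.sum_ofFn]
      simp
    omega
  obtain ⟨hl0, hl1, hker⟩ := H.levels_of_diagonalized (P.basisChange (List.finRange m))
    (fun x => violations C x + P.excitations x) (P.op_basisChange hH hC) z z₁ hD0 hD1
  have hg0 : H.groundEnergy = 0 := hl0
  have hzero : H.op.mulVec (P.groundState z c) = 0 := by
    funext x
    rw [P.op_mulVec hH, Pi.zero_apply]
    have hA : (violations C x : ℂ) * P.groundState z c x = 0 := by
      by_cases hx : x ∈ P.groundSet z c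
      · rw [(hv0 x).2 (hclause x (P.mem_groundSet.1 hx).1)]; simp
      · simp [groundState, hx]
    rw [hA, zero_add]
    refine List.sum_eq_zero ?_
    intro r hr
    obtain ⟨j, -, rfl⟩ := List.mem_map.1 hr
    simp only [bellOp, twoPoint, LinearMap.coe_mk, AddHom.coe_mk]
    have hbz : ∀ y, y ∈ P.groundSet z c → y (P.b j) = c := by
      intro y hy
      rw [(P.mem_groundSet.1 hy).1 _ fun k => ⟨P.b_ne_p j k, P.b_ne_q j k⟩, hb]
    have hflip : ∀ y, y ∈ P.groundSet z c → c = true → P.flip j y ∈ P.groundSet z c := by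
      intro y hy hc
      rw [mem_groundSet] at hy ⊢
      refine ⟨fun i hi => ?_, fun k => ⟨?_, by simp [hc]⟩⟩
      · rw [← hy.1 i hi]
        simp [flip, hi j]
      · by_cases hkj : k = j
        · subst hkj
          rw [flip_p, flip_q, (hy.2 k).1]
        · rw [P.flip_p_of_ne hkj, P.flip_q_of_ne hkj, (hy.2 k).1]
    cases hact : P.active j x
    · simp only [Bool.false_eq_true, if_false, zero_mul, add_zero]
      by_cases hx : x ∈ P.groundSet z c
      · have hpq := (P.mem_groundSet.1 hx).2 j
        have hc : c = false := by
          rw [← hbz x hx]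
          simpa [active, hpq.1] using hact
        have : P.excited j x = false := by
          rw [excited, ← hpq.1, hpq.2 hc, Bool.or_self]
        simp [this]
      · simp [groundState, hx]
    · have hbx : x (P.b j) = true := by
        simp only [active, Bool.and_eq_true] at hact; exact hact.1
      have hiff : x ∈ P.groundSet z c ↔ P.flip j x ∈ P.groundSet z c := by
        constructor
        · intro hx
          exact hflip x hx (by rw [← hbz x hx, hbx])
        · intro hx
          have := hflip _ hx (by rw [← hbz _ hx, flip_b, hbx])
          rwa [flip_flip] at this
      simp only [if_true, groundState, hiff]
      ring
  have hnorm : ∑ x, ‖P.groundState z c x‖ ^ 2 = 1 := by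
    have : ∀ x, ‖P.groundState z c x‖ ^ 2 =
        if x ∈ P.groundSet z c then (2 ^ (if c then m else 0) : ℝ)⁻¹ else 0 := by
      intro x
      by_cases hx : x ∈ P.groundSet z c
      · simp only [groundState, if_pos hx]
        exact norm_sq_amplitude _
      · simp [groundState, hx]
    simp only [this]
    rw [Finset.sum_ite_mem, Finset.univ_inter, Finset.sum_const, card_groundSet, nsmul_eq_mul]
    push_cast
    exact mul_inv_cancel₀ (by positivity)
  have hgs : H.IsGroundState (P.groundState z c) := ⟨hnorm, by rw [hg0, hzero]; simp⟩
  have hug : H.IsUniqueGroundState (P.groundState z c) := by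
    refine ⟨hgs, fun ψ hψ => ?_⟩
    obtain ⟨a, ha⟩ := hker _ hzero
    obtain ⟨a', ha'⟩ := hker ψ (by rw [hψ.2, hg0]; simp)
    have hane : a ≠ 0 := by
      rintro rfl
      rw [ha] at hnorm
      simp at hnorm
    refine ⟨a' / a, ?_⟩
    rw [ha', ha, smul_smul, div_mul_cancel₀ _ hane]
  refine ⟨⟨⟨?_, hg0⟩, ⟨_, hug⟩, ?_⟩, hug⟩
  · intro h hh
    rw [hH, List.mem_append, List.mem_map, List.mem_map] at hh
    rcases hh with ⟨c, -, rfl⟩ | ⟨j, -, rfl⟩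
    · exact c.term_posSemidef
    · exact P.bellTerm_posSemidef j
  · rw [Ham.spectralGap, hl0, hl1, sub_zero]

end PairSys

/-! ### Clauses on a grid of qubits -/

/-- The forbidden values of the kinds of clauses in use: `0` for `a = 0`, `1` for `a = 1`, `2` for
`a = b`, `3` for `a + b + c = 0`, and `4` for `b → a`. -/
def kindBad : ℕ → List Bool → Bool
  | 0, u => u.getD 0 false
  | 1, u => !u.getD 0 false
  | 2, u => u.getD 0 false ^^ u.getD 1 false
  | 3, u => u.getD 0 false ^^ u.getD 1 false ^^ u.getD 2 false
  | _, u => !u.getD 0 false && u.getD 1 false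

/-- The number of qubits of a clause of the given kind. -/
def kindLen : ℕ → ℕ
  | 0 => 1
  | 1 => 1
  | 2 => 2
  | 3 => 3
  | _ => 2

/-- The assignment satisfies all clauses of a list; a clause is given by its kind and the numbers of
its qubits. -/
def Holds (ζ : ℕ → Bool) (L : List (ℕ × List ℕ)) : Prop :=
  ∀ r ∈ L, kindBad r.1 (r.2.map ζ) = false

section Holds
variable (ζ : ℕ → Bool)

theorem holds_nil : Holds ζ [] ↔ True := by simp [Holds]

theorem holds_cons (r : ℕ × List ℕ) (L : List (ℕ × List ℕ)) :
    Holds ζ (r :: L) ↔ kindBad r.1 (r.2.map ζ) = false ∧ Holds ζ L := by simp [Holds]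

theorem holds_append (L L' : List (ℕ × List ℕ)) :
    Holds ζ (L ++ L') ↔ Holds ζ L ∧ Holds ζ L' := by
  simp only [Holds, List.mem_append]
  exact ⟨fun h => ⟨fun r hr => h r (Or.inl hr), fun r hr => h r (Or.inr hr)⟩,
    fun h r hr => hr.elim (h.1 r) (h.2 r)⟩

theorem holds_flatMap (k : ℕ) (f : ℕ → List (ℕ × List ℕ)) :
    Holds ζ ((List.range k).flatMap f) ↔ ∀ i < k, Holds ζ (f i) := by
  simp only [Holds, List.mem_flatMap, List.mem_range]
  exact ⟨fun h i hi r hr => h r ⟨i, hi, hr⟩, fun h r ⟨i, hi, hr⟩ => h i hi r hr⟩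

theorem holds_map (k : ℕ) (f : ℕ → ℕ × List ℕ) :
    Holds ζ ((List.range k).map f) ↔ ∀ i < k, kindBad (f i).1 ((f i).2.map ζ) = false := by
  simp [Holds]

theorem holds_cond (b : Bool) (L L' : List (ℕ × List ℕ)) :
    Holds ζ (bif b then L else L') ↔ (b = true → Holds ζ L) ∧ (b = false → Holds ζ L') := by
  cases b <;> simp

end Holds

/-- The clause has the right number of distinct qubits among `n` qubits, which are placed row by row
on a grid of width `w`, and they are close to each other. -/
def WellPlaced (n w : ℕ) (r : ℕ × List ℕ) : Prop :=
  r.2.length = kindLen r.1 ∧ (∀ i ∈ r.2, i < n) ∧ r.2.Nodup ∧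
    ∀ i ∈ r.2, ∀ j ∈ r.2, latticeDist (i / w, i % w) (j / w, j % w) ≤ 3

theorem kindLen_le (k : ℕ) : kindLen k ≤ 3 := by
  unfold kindLen
  split <;> omega

open Classical in
/-- The clause with the given kind and qubits, if the qubits are admissible. -/
noncomputable def toClause (n w : ℕ) (r : ℕ × List ℕ) : Option (Clause n) :=
  if h : WellPlaced n w r then
    some ⟨r.2.attach.map fun i => ⟨i.1, h.2.1 i.1 i.2⟩, by
      refine List.Nodup.map ?_ (List.nodup_attach.2 h.2.2.1)
      intro a b hab
      exact Subtype.ext (congrArg Fin.val hab), kindBad r.1⟩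
  else none

/-- The assignment to all natural numbers that is `0` from `n` on. -/
def extend {n : ℕ} (z : Fin n → Bool) (i : ℕ) : Bool := if h : i < n then z ⟨i, h⟩ else false

theorem toClause_spec {n w : ℕ} {r : ℕ × List ℕ} {c : Clause n} (h : toClause n w r = some c) :
    WellPlaced n w r ∧ c.supp.map Fin.val = r.2 ∧ c.bad = kindBad r.1 := by
  unfold toClause at h
  split_ifs at h with hr
  cases h
  refine ⟨hr, ?_, rfl⟩
  simp only [List.map_map]
  exact List.attach_map_subtype_val _

theorem violated_eq {n w : ℕ} {r : ℕ × List ℕ} {c : Clause n} (h : toClause n w r = some c)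
    (z : Fin n → Bool) : c.violated z = kindBad r.1 (r.2.map (extend z)) := by
  obtain ⟨-, h2, h3⟩ := toClause_spec h
  rw [Clause.violated, h3, ← h2, List.map_map]
  congr 1
  refine List.map_congr_left fun i _ => ?_
  simp [extend]

/-- Codes of a table of matrix entries. -/
noncomputable def entriesCode (L : ℕ) (e : List Bool → List Bool → ℚ) : Val :=
  .ofList ((allBits L).map fun x => .ofList ((allBits L).map fun y =>
    .cons (.ofRat (e (List.ofFn x) (List.ofFn y))) (.ofRat 0)))

theorem tableTerm_code {n : ℕ} (supp : List (Fin n)) (h : supp.Nodup)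
    (e : List Bool → List Bool → ℚ) (he : ∀ u v, e v u = e u v) :
    (tableTerm supp h e he).code =
      .cons (.ofList ((supp.map Fin.val).map Val.ofNat)) (entriesCode supp.length e) := by
  have hc : (supp >>= fun i => pure i.val) = supp.map Fin.val := by
    rw [List.map_eq_flatMap]
    rfl
  rw [← hc]
  rfl

/-- The code of a term is computed from its kind and the numbers of its qubits. -/
noncomputable def clauseCode (r : ℕ × List ℕ) : Val :=
  .cons (PCode.enc r.2) (entriesCode (kindLen r.1) (clauseTable (kindBad r.1)))

theorem code_toClause {n w : ℕ} {r : ℕ × List ℕ} {c : Clause n} (h : toClause n w r = some c) :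
    c.term.code = clauseCode r := by
  obtain ⟨h1, h2, h3⟩ := toClause_spec h
  rw [Clause.term, tableTerm_code, h2, clauseCode, h3, ← h1.1, ← h2, List.length_map]
  rfl

theorem filterMap_toClause_code {n w : ℕ} (L : List (ℕ × List ℕ)) (hL : ∀ r ∈ L, WellPlaced n w r) :
    ((L.filterMap (toClause n w)).map Clause.term).map LocalTerm.code = L.map clauseCode := by
  induction L with
  | nil => rfl
  | cons r L ih =>
    have hr : ∃ c, toClause n w r = some c := by
      rw [toClause, dif_pos (hL r List.mem_cons_self)]
      exact ⟨_, rfl⟩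
    obtain ⟨c, hc⟩ := hr
    rw [List.filterMap_cons_some hc, List.map_cons, List.map_cons, List.map_cons, code_toClause hc,
      ih fun r hr => hL r (List.mem_cons_of_mem _ hr)]

theorem holds_iff {n w : ℕ} (L : List (ℕ × List ℕ)) (hL : ∀ r ∈ L, WellPlaced n w r)
    (z : Fin n → Bool) :
    (∀ c ∈ L.filterMap (toClause n w), c.violated z = false) ↔ Holds (extend z) L := by
  simp only [List.mem_filterMap]
  constructor
  · intro h r hr
    have hc : ∃ c, toClause n w r = some c := by
      rw [toClause, dif_pos (hL r hr)]
      exact ⟨_, rfl⟩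
    obtain ⟨c, hc⟩ := hc
    rw [← violated_eq hc]
    exact h c ⟨r, hr, hc⟩
  · rintro h c ⟨r, hr, hc⟩
    rw [violated_eq hc]
    exact h r hr

theorem PF.kind {α : Type} [PCode α] {f : ℕ → α} (h4 : ∀ k, f (k + 4) = f 4) : PF f := by
  have h : f = fun k => bif decide (k = 0) then f 0 else bif decide (k = 1) then f 1 else
      bif decide (k = 2) then f 2 else bif decide (k = 3) then f 3 else f 4 := by
    funext k
    match k with
    | 0 => rfl
    | 1 => rfl
    | 2 => rfl
    | 3 => rfl
    | k + 4 => simp [h4]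
  rw [h]
  fun_prop

@[fun_prop] theorem PF.clauseCode {α : Type} [PCode α] {r : α → ℕ × List ℕ} (hr : PF r) :
    PF fun a => clauseCode (r a) := by
  have h : PF fun k => entriesCode (kindLen k) (clauseTable (kindBad k)) := PF.kind fun k => rfl
  have h2 : PF fun a => entriesCode (kindLen (r a).1) (clauseTable (kindBad (r a).1)) :=
    PF.comp (f := fun a => (r a).1) h (by fun_prop)
  exact PF.valCons (by fun_prop) h2

/-! ### Scanning the rows of a linear system -/

/-- The number of the qubit in row `i` and column `c` of a grid of width `2 m + 1`. -/
def cell (m i c : ℕ) : ℕ := i * (2 * m + 1) + c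

/-- A row of a system of constraints on a bit string `x`: the start bit, whether the final state is
constrained to be `0`, whether two ones of `x` in the row are excluded, and the coefficients. -/
abbrev Row := Bool × Bool × Bool × List Bool

/-- The state of the scan of a row after `j` columns: the start bit plus the inner product. -/
def Row.state (row : Row) (x : ℕ → Bool) (j : ℕ) : Bool :=
  row.1 ^^ xorSum j fun k => row.2.2.2.getD k false && x k

/-- `x` satisfies the constraint of the row. In an exclusive row, a one of `x` on a nonzero
coefficient is allowed in state `1` only. -/
def Row.Ok (m : ℕ) (row : Row) (x : ℕ → Bool) : Prop :=
  (row.2.1 = true → row.state x m = false) ∧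
    (row.2.2.1 = true → ∀ j < m, row.2.2.2.getD j false = true → x j = true →
      row.state x j = true)

/-- A default value for lookups in lists of rows. -/
def nullRow : Row := (false, false, false, [])

theorem xorSum_congr {n : ℕ} {f g : ℕ → Bool} (h : ∀ i < n, f i = g i) : xorSum n f = xorSum n g := by
  induction n with
  | zero => rfl
  | succ n ih =>
    rw [xorSum_succ, xorSum_succ, ih fun i hi => h i (by omega), h n (by omega)]

theorem Row.state_congr (row : Row) {x y : ℕ → Bool} {j : ℕ} (h : ∀ i < j, x i = y i) :
    row.state x j = row.state y j := by
  rw [Row.state, Row.state, xorSum_congr fun i hi => by rw [h i hi]]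

theorem Row.state_succ (row : Row) (x : ℕ → Bool) (j : ℕ) :
    row.state x (j + 1) = (row.state x j ^^ (row.2.2.2.getD j false && x j)) := by
  rw [Row.state, Row.state, xorSum_succ, Bool.xor_assoc]

/-- The clauses that make row `i` of the grid hold, at the even columns, the states of the scan of
the string at the odd columns. -/
def rowClauses (m i : ℕ) (row : Row) : List (ℕ × List ℕ) :=
  [(bif row.1 then 1 else 0, [cell m i 0])] ++
    (List.range m).flatMap (fun j => bif row.2.2.2.getD j false then
      (3, [cell m i (2 * j), cell m i (2 * j + 1), cell m i (2 * j + 2)]) ::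
        (bif row.2.2.1 then [(4, [cell m i (2 * j), cell m i (2 * j + 1)])] else [])
      else [(2, [cell m i (2 * j), cell m i (2 * j + 2)])]) ++
    (bif row.2.1 then [(0, [cell m i (2 * m)])] else [])

/-- All clauses: the rows are scanned with the same string; the final state of the last row is
copied to the even columns of the next row of the grid, which are the control qubits of the pairs;
the pairs stand at the odd columns of this row and the next one, and the remaining qubits are `0`. -/
def gridClauses (n m : ℕ) (rows : List Row) : List (ℕ × List ℕ) :=
  (List.range rows.length).flatMap (fun i => rowClauses m i (rows.getD i nullRow)) ++
  ((List.range rows.length).flatMap (fun i => (List.range m).flatMap fun j =>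
    bif decide (i + 1 < rows.length) then [(2, [cell m i (2 * j + 1), cell m (i + 1) (2 * j + 1)])]
    else []) ++
  ((List.range m).map (fun j =>
    (2, [cell m rows.length (2 * j), cell m rows.length (2 * j + 2)])) ++
  ([(2, [cell m (rows.length - 1) (2 * m), cell m rows.length (2 * m)])] ++
  ((List.range (m + 1)).map (fun j => (0, [cell m (rows.length + 1) (2 * j)])) ++
  (List.range (n - cell m (rows.length + 2) 0)).map fun q =>
    (0, [cell m (rows.length + 2) 0 + q])))))

@[fun_prop] theorem PF.gridClauses {α : Type} [PCode α] {n m : α → ℕ} {rows : α → List Row}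
    (hn : PF n) (hm : PF m) (hr : PF rows) : PF fun a => gridClauses (n a) (m a) (rows a) := by
  unfold HamLearn.gridClauses rowClauses cell
  fun_prop

theorem cell_div {m i c : ℕ} (hc : c ≤ 2 * m) : cell m i c / (2 * m + 1) = i := by
  rw [cell, Nat.mul_comm, Nat.mul_add_div (by omega), Nat.div_eq_of_lt (by omega), add_zero]

theorem cell_mod {m i c : ℕ} (hc : c ≤ 2 * m) : cell m i c % (2 * m + 1) = c := by
  rw [cell, Nat.mul_comm, Nat.mul_add_mod, Nat.mod_eq_of_lt (by omega)]

theorem cell_div_mod (m q : ℕ) : cell m (q / (2 * m + 1)) (q % (2 * m + 1)) = q := by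
  rw [cell, Nat.mul_comm]
  exact Nat.div_add_mod q (2 * m + 1)

theorem cell_inj {m i c i' c' : ℕ} (hc : c ≤ 2 * m) (hc' : c' ≤ 2 * m) :
    cell m i c = cell m i' c' ↔ i = i' ∧ c = c' := by
  constructor
  · intro h
    exact ⟨by rw [← cell_div hc (i := i), h, cell_div hc'], by rw [← cell_mod hc (i := i), h, cell_mod hc']⟩
  · rintro ⟨rfl, rfl⟩
    rfl

theorem cell_lt {n m i c r : ℕ} (hn : cell m r 0 ≤ n) (hi : i < r) (hc : c ≤ 2 * m) :
    cell m i c < n := by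
  have : (i + 1) * (2 * m + 1) ≤ r * (2 * m + 1) := Nat.mul_le_mul_right _ hi
  simp only [cell, add_mul] at *
  omega

theorem wellPlaced_one {n w k i : ℕ} (hk : kindLen k = 1) (hi : i < n) : WellPlaced n w (k, [i]) := by
  refine ⟨by simp [hk], by simpa using hi, by simp, ?_⟩
  simp [latticeDist]

theorem wellPlaced_two {n m k i c i' c' : ℕ} (hk : kindLen k = 2) (hc : c ≤ 2 * m) (hc' : c' ≤ 2 * m)
    (h1 : cell m i c < n) (h2 : cell m i' c' < n) (hne : i ≠ i' ∨ c ≠ c')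
    (hd : latticeDist (i, c) (i', c') ≤ 3) :
    WellPlaced n (2 * m + 1) (k, [cell m i c, cell m i' c']) := by
  refine ⟨by simp [hk], by simp [h1, h2], ?_, ?_⟩
  · simp only [List.nodup_cons, List.mem_singleton, cell_inj hc hc']
    simp
    omega
  · have hd' : latticeDist (i', c') (i, c) ≤ 3 := by
      simpa [latticeDist, Nat.dist_comm] using hd
    simp only [List.mem_cons, List.not_mem_nil, or_false]
    rintro a (rfl | rfl) b (rfl | rfl) <;> simp only [cell_div hc, cell_mod hc, cell_div hc', cell_mod hc']
    · simp [latticeDist]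
    · exact hd
    · exact hd'
    · simp [latticeDist]

theorem wellPlaced_three {n m i c : ℕ} (hc : c + 2 ≤ 2 * m) (h : cell m i (c + 2) < n) :
    WellPlaced n (2 * m + 1) (3, [cell m i c, cell m i (c + 1), cell m i (c + 2)]) := by
  refine ⟨rfl, ?_, ?_, ?_⟩
  · simp only [cell] at *
    simp
    omega
  · simp [cell]
  · simp only [List.mem_cons, List.not_mem_nil, or_false]
    have h0 : c ≤ 2 * m := by omega
    have h1 : c + 1 ≤ 2 * m := by omega
    rintro a (rfl | rfl | rfl) b (rfl | rfl | rfl) <;>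
      simp only [cell_div h0, cell_mod h0, cell_div h1, cell_mod h1, cell_div hc, cell_mod hc,
        latticeDist, Nat.dist] <;> omega

theorem wellPlaced_gridClauses {n m : ℕ} {rows : List Row} (hn : cell m (rows.length + 2) 0 ≤ n)
    (hrows : rows ≠ []) : ∀ r ∈ gridClauses n m rows, WellPlaced n (2 * m + 1) r := by
  have hR : 0 < rows.length := List.length_pos_iff.2 hrows
  intro r hr
  simp only [gridClauses, List.mem_append, List.mem_flatMap, List.mem_range, List.mem_map,
    List.mem_singleton] at hr
  rcases hr with ⟨i, hi, hr⟩ | ⟨i, hi, j, hj, hr⟩ | ⟨j, hj, rfl⟩ | rfl | ⟨j, hj, rfl⟩ | ⟨q, hq, rfl⟩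
  · simp only [rowClauses, List.mem_append, List.mem_flatMap, List.mem_range, List.mem_singleton] at hr
    rcases hr with (rfl | ⟨j, hj, hr⟩) | hr
    · refine wellPlaced_one ?_ (cell_lt hn (by omega) (by omega))
      cases (rows.getD i nullRow).1 <;> rfl
    · cases h1 : (rows.getD i nullRow).2.2.2.getD j false
      · rw [h1, cond_false, List.mem_singleton] at hr
        subst hr
        exact wellPlaced_two rfl (by omega) (by omega) (cell_lt hn (by omega) (by omega))
          (cell_lt hn (by omega) (by omega)) (by omega) (by simp only [latticeDist, Nat.dist]; omega)
      · rw [h1, cond_true, List.mem_cons] at hr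
        rcases hr with rfl | hr
        · exact wellPlaced_three (by omega) (cell_lt hn (by omega) (by omega))
        · cases h2 : (rows.getD i nullRow).2.2.1
          · rw [h2] at hr; simp at hr
          · rw [h2, cond_true, List.mem_singleton] at hr
            subst hr
            exact wellPlaced_two rfl (by omega) (by omega) (cell_lt hn (by omega) (by omega))
              (cell_lt hn (by omega) (by omega)) (by omega)
              (by simp only [latticeDist, Nat.dist]; omega)
    · cases h2 : (rows.getD i nullRow).2.1
      · rw [h2] at hr; simp at hr
      · rw [h2, cond_true, List.mem_singleton] at hr
        subst hr
        exact wellPlaced_one rfl (cell_lt hn (by omega) (by omega))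
  · cases h2 : decide (i + 1 < rows.length)
    · rw [h2] at hr; simp at hr
    · rw [h2, cond_true, List.mem_singleton] at hr
      subst hr
      exact wellPlaced_two rfl (by omega) (by omega) (cell_lt hn (by omega) (by omega))
          (cell_lt hn (by omega) (by omega)) (by omega) (by simp only [latticeDist, Nat.dist]; omega)
  · exact wellPlaced_two rfl (by omega) (by omega) (cell_lt hn (by omega) (by omega))
          (cell_lt hn (by omega) (by omega)) (by omega) (by simp only [latticeDist, Nat.dist]; omega)
  · exact wellPlaced_two rfl (by omega) (by omega) (cell_lt hn (by omega) (by omega))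
          (cell_lt hn (by omega) (by omega)) (by omega) (by simp only [latticeDist, Nat.dist]; omega)
  · exact wellPlaced_one rfl (cell_lt hn (by omega) (by omega))
  · exact wellPlaced_one rfl (by omega)

/-- The meaning of the clauses, line by line. -/
theorem holds_gridClauses (ζ : ℕ → Bool) (n m : ℕ) (rows : List Row) :
    Holds ζ (gridClauses n m rows) ↔
      (∀ i < rows.length, ζ (cell m i 0) = (rows.getD i nullRow).1 ∧
        (∀ j < m, ζ (cell m i (2 * j + 2)) =
          (ζ (cell m i (2 * j)) ^^ ((rows.getD i nullRow).2.2.2.getD j false &&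
            ζ (cell m i (2 * j + 1)))) ∧
          ((rows.getD i nullRow).2.2.2.getD j false = true →
            (rows.getD i nullRow).2.2.1 = true → ζ (cell m i (2 * j + 1)) = true →
              ζ (cell m i (2 * j)) = true)) ∧
        ((rows.getD i nullRow).2.1 = true → ζ (cell m i (2 * m)) = false)) ∧
      (∀ i, i + 1 < rows.length → ∀ j < m,
        ζ (cell m i (2 * j + 1)) = ζ (cell m (i + 1) (2 * j + 1))) ∧
      (∀ j < m, ζ (cell m rows.length (2 * j)) = ζ (cell m rows.length (2 * j + 2))) ∧
      ζ (cell m (rows.length - 1) (2 * m)) = ζ (cell m rows.length (2 * m)) ∧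
      (∀ j < m + 1, ζ (cell m (rows.length + 1) (2 * j)) = false) ∧
      ∀ q < n - cell m (rows.length + 2) 0, ζ (cell m (rows.length + 2) 0 + q) = false := by
  have h0 : ∀ a, kindBad 0 [a] = a := fun _ => rfl
  have h1 : ∀ a, kindBad 1 [a] = !a := fun _ => rfl
  have h2 : ∀ a b, kindBad 2 [a, b] = false ↔ a = b := by decide
  have h3 : ∀ a b c, kindBad 3 [a, b, c] = false ↔ c = (a ^^ b) := by decide
  have h4 : ∀ a b, kindBad 4 [a, b] = false ↔ (b = true → a = true) := by decide
  have hs : ∀ a b, kindBad (bif a then 1 else 0) [b] = false ↔ b = a := by decide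
  simp only [gridClauses, rowClauses, holds_append, holds_flatMap, holds_map, holds_cons, holds_nil,
    holds_cond, List.map_cons, List.map_nil, h0, h2, h3, h4, hs, and_true, implies_true,
    decide_eq_true_eq]
  refine and_congr (forall₂_congr fun i hi => ?_) (and_congr ?_ Iff.rfl)
  · rw [and_assoc]
    refine and_congr Iff.rfl (and_congr (forall₂_congr fun j hj => ?_) Iff.rfl)
    cases (rows.getD i nullRow).2.2.2.getD j false
    · simp only [Bool.false_eq_true, IsEmpty.forall_iff, forall_const, true_and, Bool.false_and,
        Bool.xor_false, and_true]
      exact eq_comm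
    · simp
  · exact ⟨fun h i hi j hj => h i (by omega) j hj hi, fun h i _ j hj hi => h i hi j hj⟩

/-- The assignment of the grid that belongs to the string `x`. -/
def scan (m : ℕ) (rows : List Row) (x : ℕ → Bool) (q : ℕ) : Bool :=
  if q / (2 * m + 1) < rows.length then
    if q % (2 * m + 1) % 2 = 1 then x (q % (2 * m + 1) / 2)
    else (rows.getD (q / (2 * m + 1)) nullRow).state x (q % (2 * m + 1) / 2)
  else if q / (2 * m + 1) = rows.length ∧ q % (2 * m + 1) % 2 = 0 then
    (rows.getD (rows.length - 1) nullRow).state x m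
  else false

section scan
variable {m : ℕ} {rows : List Row} {x : ℕ → Bool}

theorem scan_odd {i j : ℕ} (hi : i < rows.length) (hj : j < m) :
    scan m rows x (cell m i (2 * j + 1)) = x j := by
  rw [scan, cell_div (by omega), cell_mod (by omega), if_pos hi, if_pos (by omega)]
  congr 1
  omega

theorem scan_even {i j : ℕ} (hi : i < rows.length) (hj : j ≤ m) :
    scan m rows x (cell m i (2 * j)) = (rows.getD i nullRow).state x j := by
  rw [scan, cell_div (by omega), cell_mod (by omega), if_pos hi, if_neg (by omega)]
  congr 1
  omega

theorem scan_control {j : ℕ} (hj : j ≤ m) : scan m rows x (cell m rows.length (2 * j)) =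
    (rows.getD (rows.length - 1) nullRow).state x m := by
  rw [scan, cell_div (by omega), cell_mod (by omega), if_neg (by omega), if_pos ⟨rfl, by omega⟩]

theorem scan_pair_left {j : ℕ} (hj : j < m) : scan m rows x (cell m rows.length (2 * j + 1)) = false := by
  rw [scan, cell_div (by omega), cell_mod (by omega), if_neg (by omega), if_neg (by omega)]

theorem scan_of_lt {q : ℕ} (hq : rows.length < q / (2 * m + 1)) : scan m rows x q = false := by
  rw [scan, if_neg (by omega), if_neg (by omega)]

theorem scan_congr {y : ℕ → Bool} (h : ∀ j < m, x j = y j) : scan m rows x = scan m rows y := by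
  funext q
  have hq : q % (2 * m + 1) < 2 * m + 1 := Nat.mod_lt _ (by omega)
  unfold scan
  split_ifs with h1 h2 h3
  · exact h _ (by omega)
  · exact Row.state_congr _ fun i hi => h i (by omega)
  · exact Row.state_congr _ h
  · rfl

theorem holds_scan {n : ℕ} (hrows : rows ≠ []) (hok : ∀ row ∈ rows, Row.Ok m row x) :
    Holds (scan m rows x) (gridClauses n m rows) := by
  have hR : 0 < rows.length := List.length_pos_iff.2 hrows
  rw [holds_gridClauses]
  refine ⟨fun i hi => ?_, fun i hi j hj => ?_, fun j hj => ?_, ?_, fun j hj => ?_, fun q hq => ?_⟩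
  · have hmem : rows.getD i nullRow ∈ rows := by
      rw [List.getD_eq_getElem _ _ hi]; exact List.getElem_mem hi
    have hrow := hok _ hmem
    have h0 := scan_even (x := x) hi (Nat.zero_le m)
    refine ⟨?_, fun j hj => ⟨?_, fun h1 h2 => ?_⟩, fun h => ?_⟩
    · rw [Nat.mul_zero] at h0
      rw [h0, Row.state, xorSum_zero, Bool.xor_false]
    · have h1 := scan_even (x := x) hi (show j + 1 ≤ m by omega)
      rw [Nat.mul_add] at h1
      rw [h1, scan_even hi hj.le, scan_odd hi hj, Row.state_succ]
    · rw [scan_even hi hj.le, scan_odd hi hj]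
      exact hrow.2 h2 j hj h1
    · rw [scan_even hi le_rfl]
      exact hrow.1 h
  · rw [scan_odd (by omega) hj, scan_odd hi hj]
  · have h1 := scan_control (m := m) (rows := rows) (x := x) (show j + 1 ≤ m by omega)
    rw [Nat.mul_add] at h1
    rw [scan_control hj.le, h1]
  · rw [scan_even (by omega) le_rfl, scan_control le_rfl]
  · exact scan_of_lt (by rw [cell_div (by omega)]; omega)
  · refine scan_of_lt ?_
    have h1 : cell m (rows.length + 2) 0 / (2 * m + 1) ≤ (cell m (rows.length + 2) 0 + q) / (2 * m + 1) :=
      Nat.div_le_div_right (Nat.le_add_right _ _)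
    rw [cell_div (by omega)] at h1
    omega

/-- An assignment that satisfies the clauses belongs to a string that satisfies the constraints of
all rows, up to the values of the pairs. -/
theorem of_holds {n : ℕ} {ζ : ℕ → Bool} (hrows : rows ≠ []) (h : Holds ζ (gridClauses n m rows)) :
    (∀ row ∈ rows, Row.Ok m row fun j => ζ (cell m 0 (2 * j + 1))) ∧
    ∀ q < n, (∀ j < m, q ≠ cell m rows.length (2 * j + 1) ∧ q ≠ cell m (rows.length + 1) (2 * j + 1)) →
      ζ q = scan m rows (fun j => ζ (cell m 0 (2 * j + 1))) q := by
  have hR : 0 < rows.length := List.length_pos_iff.2 hrows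
  rw [holds_gridClauses] at h
  obtain ⟨h1, h2, h3, h4, h5, h6⟩ := h
  set x : ℕ → Bool := fun j => ζ (cell m 0 (2 * j + 1)) with hx
  have hodd : ∀ i < rows.length, ∀ j < m, ζ (cell m i (2 * j + 1)) = x j := by
    intro i
    induction i with
    | zero => intro _ j _; rfl
    | succ i ih =>
      intro hi j hj
      rw [← h2 i hi j hj, ih (by omega) j hj]
  have heven : ∀ i < rows.length, ∀ j ≤ m, ζ (cell m i (2 * j)) = (rows.getD i nullRow).state x j := by
    intro i hi j
    induction j with
    | zero =>
      intro _
      rw [Nat.mul_zero, (h1 i hi).1, Row.state, xorSum_zero, Bool.xor_false]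
    | succ j ih =>
      intro hj
      rw [Nat.mul_add, ((h1 i hi).2.1 j (by omega)).1, ih (by omega), hodd i hi j (by omega),
        Row.state_succ]
  have hctl : ∀ k ≤ m, ζ (cell m rows.length (2 * (m - k))) =
      (rows.getD (rows.length - 1) nullRow).state x m := by
    intro k
    induction k with
    | zero =>
      intro _
      rw [Nat.sub_zero, ← h4, heven _ (by omega) m le_rfl]
    | succ k ih =>
      intro hk
      have := h3 (m - (k + 1)) (by omega)
      rw [this, show 2 * (m - (k + 1)) + 2 = 2 * (m - k) by omega, ih (by omega)]
  constructor
  · intro row hrow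
    obtain ⟨i, hi, rfl⟩ := List.getElem_of_mem hrow
    have hg : rows.getD i nullRow = rows[i] := List.getD_eq_getElem _ _ hi
    rw [← hg]
    refine ⟨fun hc => ?_, fun he j hj hv hxj => ?_⟩
    · rw [← heven i hi m le_rfl]
      exact (h1 i hi).2.2 hc
    · rw [← heven i hi j hj.le]
      exact ((h1 i hi).2.1 j hj).2 hv he (by rw [hodd i hi j hj]; exact hxj)
  · intro q hq hne
    obtain ⟨i, hi⟩ : ∃ i, i = q / (2 * m + 1) := ⟨_, rfl⟩
    obtain ⟨c, hc⟩ : ∃ c, c = q % (2 * m + 1) := ⟨_, rfl⟩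
    have hqc : q = cell m i c := by rw [hi, hc, cell_div_mod]
    have hc' : c < 2 * m + 1 := by rw [hc]; exact Nat.mod_lt _ (by omega)
    rcases Nat.even_or_odd' c with ⟨j, rfl | rfl⟩
    · rcases lt_trichotomy i rows.length with hlt | rfl | hgt
      · rw [hqc, heven i hlt j (by omega), scan_even hlt (by omega)]
      · rw [hqc, scan_control (by omega), ← hctl (m - j) (by omega)]
        congr 2
        omega
      · rw [scan_of_lt (by omega)]
        by_cases h7 : i = rows.length + 1
        · rw [hqc, h7]
          exact h5 j (by omega)
        · have h8 : cell m (rows.length + 2) 0 ≤ q := by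
            have : (rows.length + 2) * (2 * m + 1) ≤ i * (2 * m + 1) :=
              Nat.mul_le_mul_right _ (by omega)
            rw [hqc]
            simp only [cell]
            omega
          have := h6 (q - cell m (rows.length + 2) 0) (by omega)
          rwa [Nat.add_sub_cancel' h8] at this
    · by_cases hlt : i < rows.length
      · rw [hqc, hodd i hlt j (by omega), scan_odd hlt (by omega)]
      · have hn1 : i ≠ rows.length := by
          rintro rfl
          exact (hne j (by omega)).1 hqc
        have hn2 : i ≠ rows.length + 1 := by
          rintro rfl
          exact (hne j (by omega)).2 hqc
        rw [scan_of_lt (by omega)]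
        have h8 : cell m (rows.length + 2) 0 ≤ q := by
          have : (rows.length + 2) * (2 * m + 1) ≤ i * (2 * m + 1) :=
            Nat.mul_le_mul_right _ (by omega)
          rw [hqc]
          simp only [cell]
          omega
        have := h6 (q - cell m (rows.length + 2) 0) (by omega)
        rwa [Nat.add_sub_cancel' h8] at this

end scan

/-! ### The Hamiltonian of a system of rows -/

/-- The pairs of the grid with `R` scanned rows, and their control qubits. -/
def gridPairs {n m R : ℕ} (hn : cell m (R + 2) 0 ≤ n) : PairSys n m where
  b j := ⟨cell m R (2 * j + 2), cell_lt hn (by omega) (by omega)⟩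
  p j := ⟨cell m R (2 * j + 1), cell_lt hn (by omega) (by omega)⟩
  q j := ⟨cell m (R + 1) (2 * j + 1), cell_lt hn (by omega) (by omega)⟩
  p_inj i j h := by
    have := congrArg Fin.val h
    simp only [cell] at this
    exact Fin.ext (by omega)
  q_inj i j h := by
    have := congrArg Fin.val h
    simp only [cell] at this
    exact Fin.ext (by omega)
  p_ne_q i j h := by
    have := congrArg Fin.val h
    simp only at this
    rw [cell_inj (by omega) (by omega)] at this
    omega
  b_ne_p i j h := by
    have := congrArg Fin.val h
    simp only at this
    rw [cell_inj (by omega) (by omega)] at this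
    omega
  b_ne_q i j h := by
    have := congrArg Fin.val h
    simp only at this
    rw [cell_inj (by omega) (by omega)] at this
    omega

/-- The Hamiltonian of a system of rows; its qubits fill the square lattice row by row. If there are
too few qubits, it is zero. -/
noncomputable def gridHam (n m : ℕ) (rows : List Row) : Ham n where
  pos q := (q / (2 * m + 1), q % (2 * m + 1))
  pos_inj a b h := by
    have h1 := (Prod.ext_iff.1 h).1
    have h2 := (Prod.ext_iff.1 h).2
    simp only at h1 h2
    have := cell_div_mod m a
    rw [h1, h2, cell_div_mod] at this
    exact Fin.ext this.symm
  terms := if hn : cell m (rows.length + 2) 0 ≤ n then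
      ((gridClauses n m rows).filterMap (toClause n (2 * m + 1))).map Clause.term ++
        (List.finRange m).map (gridPairs hn).bellTerm
    else []

/-- The cut through all pairs: the odd columns of row `R + 1` of the grid, where the second
qubits of the pairs stand. -/
def gridCut (n m R : ℕ) : Finset (Fin n) :=
  Finset.univ.filter fun q => q.val / (2 * m + 1) = R + 1 ∧ q.val % (2 * m + 1) % 2 = 1

theorem gridCut_eq {n m R : ℕ} (hn : cell m (R + 2) 0 ≤ n) :
    gridCut n m R = (gridPairs hn).cut := by
  ext q
  simp only [gridCut, PairSys.cut, Finset.mem_filter, Finset.mem_univ, true_and, Finset.mem_image]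
  have hq : q.val % (2 * m + 1) < 2 * m + 1 := Nat.mod_lt _ (by omega)
  constructor
  · rintro ⟨h1, h2⟩
    refine ⟨⟨q.val % (2 * m + 1) / 2, by omega⟩, Fin.ext ?_⟩
    simp only [gridPairs]
    rw [show 2 * (q.val % (2 * m + 1) / 2) + 1 = q.val % (2 * m + 1) by omega, ← h1, cell_div_mod]
  · rintro ⟨j, rfl⟩
    simp only [gridPairs]
    rw [cell_div (by omega), cell_mod (by omega)]
    omega

theorem gridHam_isLocal (n m : ℕ) (rows : List Row) : (gridHam n m rows).IsLocal2D 3 := by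
  intro h hh
  simp only [gridHam] at hh
  split_ifs at hh with hn
  · rw [List.mem_append, List.mem_map, List.mem_map] at hh
    rcases hh with ⟨c, hc, rfl⟩ | ⟨j, -, rfl⟩
    · obtain ⟨r, -, hr⟩ := List.mem_filterMap.1 hc
      obtain ⟨⟨h1, -, -, h4⟩, h5, -⟩ := toClause_spec hr
      change c.supp.length ≤ 3 ∧ ∀ i ∈ c.supp, ∀ j ∈ c.supp, _
      refine ⟨?_, fun i hi j hj => h4 i ?_ j ?_⟩
      · rw [← List.length_map (f := Fin.val), h5, h1]
        exact kindLen_le _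
      · rw [← h5]; exact List.mem_map_of_mem hi
      · rw [← h5]; exact List.mem_map_of_mem hj
    · change [_, _, _].length ≤ 3 ∧ ∀ i ∈ [_, _, _], ∀ k ∈ [_, _, _], _
      refine ⟨le_rfl, ?_⟩
      simp only [List.mem_cons, List.not_mem_nil, or_false]
      have h2 : 2 * j.val + 2 ≤ 2 * m := by omega
      have h1 : 2 * j.val + 1 ≤ 2 * m := by omega
      rintro a (rfl | rfl | rfl) b (rfl | rfl | rfl) <;>
        simp only [gridHam, gridPairs, cell_div h2, cell_mod h2, cell_div h1, cell_mod h1,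
          latticeDist, Nat.dist] <;> omega
  · exact absurd hh List.not_mem_nil

/-- If the rows have a unique solution, then the Hamiltonian is frustration-free with a unique ground
state and spectral gap `1`, and the entropy tells the final state of the last row. -/
theorem gridHam_spec {n m : ℕ} {rows : List Row} {x : ℕ → Bool} {c : Bool}
    (hn : cell m (rows.length + 2) 0 ≤ n) (hm : 0 < m) (hrows : rows ≠ [])
    (hok : ∀ row ∈ rows, Row.Ok m row x)
    (huniq : ∀ y : ℕ → Bool, (∀ row ∈ rows, Row.Ok m row y) → ∀ j < m, y j = x j)
    (hc : (rows.getD (rows.length - 1) nullRow).state x m = c) :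
    (gridHam n m rows).GroundStructure ∧ ∃ φ, (gridHam n m rows).IsUniqueGroundState φ ∧
      entanglementEntropy (gridCut n m rows.length) φ = ((if c then m else 0 : ℕ) : ℝ) := by
  have hwp := wellPlaced_gridClauses hn hrows
  have hT : (gridHam n m rows).terms =
      ((gridClauses n m rows).filterMap (toClause n (2 * m + 1))).map Clause.term ++
        (List.finRange m).map (gridPairs hn).bellTerm := by
    simp only [gridHam, dif_pos hn]
  have hz : extend (fun i : Fin n => scan m rows x i) = fun i =>
      if i < n then scan m rows x i else false := by
    funext i
    simp [extend]
  have hscan : ∀ c ∈ (gridClauses n m rows).filterMap (toClause n (2 * m + 1)),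
      c.violated (fun i : Fin n => scan m rows x i) = false := by
    rw [holds_iff _ hwp, hz]
    intro r hr
    rw [← holds_scan hrows hok r hr]
    congr 1
    exact List.map_congr_left fun i hi => if_pos ((hwp r hr).2.1 i hi)
  have hpq : ∀ j : Fin m, ∀ r ∈ gridClauses n m rows, cell m rows.length (2 * j + 1) ∉ r.2 ∧
      cell m (rows.length + 1) (2 * j + 1) ∉ r.2 := by
    have hR : 0 < rows.length := List.length_pos_iff.2 hrows
    intro j r hr
    have key : ∀ i', rows.length ≤ i' → i' < rows.length + 2 → cell m i' (2 * j + 1) ∉ r.2 := by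
      intro i' hi1 hi2 hmem
      simp only [gridClauses, rowClauses, List.mem_append, List.mem_flatMap, List.mem_range,
        List.mem_map, List.mem_singleton] at hr
      rcases hr with ⟨i, hi, (rfl | ⟨k, hk, hr⟩) | hr⟩ | ⟨i, hi, k, hk, hr⟩ | ⟨k, hk, rfl⟩ | rfl |
        ⟨k, hk, rfl⟩ | ⟨q, hq, rfl⟩
      · rw [List.mem_singleton, cell_inj (by omega) (by omega)] at hmem
        omega
      · revert hr
        cases (rows.getD i nullRow).2.2.2.getD k false <;> cases (rows.getD i nullRow).2.2.1 <;>
          simp only [cond_true, cond_false, List.mem_cons, List.not_mem_nil, or_false]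
        all_goals
          intro hr
          rcases hr with rfl | rfl <;>
            simp (discharger := omega) only [List.mem_cons, List.not_mem_nil, or_false,
              cell_inj] at hmem <;> omega
      · cases h : (rows.getD i nullRow).2.1 <;> rw [h] at hr
        · simp at hr
        · rw [cond_true, List.mem_singleton] at hr
          subst hr
          rw [List.mem_singleton, cell_inj (by omega) (by omega)] at hmem
          omega
      · cases h : decide (i + 1 < rows.length) <;> rw [h] at hr
        · simp at hr
        · rw [cond_true, List.mem_singleton] at hr
          have := of_decide_eq_true h
          subst hr
          simp (discharger := omega) only [List.mem_cons, List.not_mem_nil, or_false,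
              cell_inj] at hmem
          omega
      · simp (discharger := omega) only [List.mem_cons, List.not_mem_nil, or_false,
              cell_inj] at hmem
        omega
      · simp (discharger := omega) only [List.mem_cons, List.not_mem_nil, or_false,
              cell_inj] at hmem
        omega
      · simp (discharger := omega) only [List.mem_cons, List.not_mem_nil, or_false,
              cell_inj] at hmem
        omega
      · rw [List.mem_singleton] at hmem
        have := cell_lt (n := cell m (rows.length + 2) 0) le_rfl hi2 (show 2 * j.val + 1 ≤ 2 * m by omega)
        omega
    exact ⟨key _ le_rfl (by omega), key _ (by omega) (by omega)⟩
  suffices h : (gridHam n m rows).GroundStructure ∧ (gridHam n m rows).IsUniqueGroundState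
      ((gridPairs hn).groundState (fun i => scan m rows x i) c) by
    refine ⟨h.1, _, h.2, ?_⟩
    rw [gridCut_eq hn]
    exact (gridPairs hn).entropy_groundState _ c
  refine (gridPairs hn).groundStructure hT ?_ hm (fun i => scan m rows x i) c hscan ?_ ?_ ?_
  · intro c hc j
    obtain ⟨r, hr, hrc⟩ := List.mem_filterMap.1 hc
    obtain ⟨-, h5, -⟩ := toClause_spec hrc
    obtain ⟨h6, h7⟩ := hpq j r hr
    rw [← h5] at h6 h7
    exact ⟨fun h => h6 (List.mem_map_of_mem h), fun h => h7 (List.mem_map_of_mem h)⟩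
  · intro y hy i hi
    rw [holds_iff _ hwp] at hy
    obtain ⟨h3, h4⟩ := of_holds hrows hy
    have h5 := h4 i i.2 fun j hj =>
      ⟨fun h => (hi ⟨j, hj⟩).1 (Fin.ext h), fun h => (hi ⟨j, hj⟩).2 (Fin.ext h)⟩
    rw [scan_congr (huniq _ h3)] at h5
    simpa [extend] using h5
  · intro j
    have := scan_control (m := m) (rows := rows) (x := x) (show j.val + 1 ≤ m by omega)
    rw [Nat.mul_add] at this
    rw [← hc]
    exact this
  · intro j
    refine ⟨scan_pair_left (m := m) (rows := rows) (x := x) j.2, ?_⟩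
    refine scan_of_lt ?_
    simp only [gridPairs]
    rw [cell_div (by omega)]
    exact Nat.lt_succ_self _

/-! ### The code of the Hamiltonian -/

/-- The code of the term on the pair `j`. -/
noncomputable def bellCode (m R j : ℕ) : Val :=
  .cons (PCode.enc [cell m R (2 * j + 2), cell m R (2 * j + 1), cell m (R + 1) (2 * j + 1)])
    (entriesCode 3 bellTable)

/-- The code of the Hamiltonian of a system of rows. -/
noncomputable def gridCode (n m : ℕ) (rows : List Row) : Val :=
  PCode.enc (n, ((List.range n).map fun q => (q / (2 * m + 1), q % (2 * m + 1))),
    (gridClauses n m rows).map clauseCode ++ (List.range m).map fun j => bellCode m rows.length j)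

theorem gridHam_code {n m : ℕ} {rows : List Row} (hn : cell m (rows.length + 2) 0 ≤ n)
    (hrows : rows ≠ []) : (gridHam n m rows).code = gridCode n m rows := by
  have hT : (gridHam n m rows).terms =
      ((gridClauses n m rows).filterMap (toClause n (2 * m + 1))).map Clause.term ++
        (List.finRange m).map (gridPairs hn).bellTerm := by
    simp only [gridHam, dif_pos hn]
  have h1 : (List.ofFn fun i : Fin n => Val.cons (.ofNat (i.val / (2 * m + 1)))
      (.ofNat (i.val % (2 * m + 1)))) =
      ((List.range n).map fun q => (q / (2 * m + 1), q % (2 * m + 1))).map PCode.enc := by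
    rw [List.map_map, ← List.map_coe_finRange_eq_range, List.map_map, List.ofFn_eq_map]
    rfl
  have h2 : ((List.finRange m).map (gridPairs hn).bellTerm).map LocalTerm.code =
      (List.range m).map fun j => bellCode m rows.length j := by
    rw [List.map_map, ← List.map_coe_finRange_eq_range, List.map_map]
    refine List.map_congr_left fun j _ => ?_
    simp only [Function.comp_apply, PairSys.bellTerm, tableTerm_code]
    rfl
  rw [Ham.code, hT, List.map_append, filterMap_toClause_code _ (wellPlaced_gridClauses hn hrows), h2]
  simp only [gridCode, enc_pair, enc_nat, enc_list, ← h1]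
  congr 3
  exact (List.map_id _).symm

@[fun_prop] theorem PF.gridCode {α : Type} [PCode α] {n m : α → ℕ} {rows : α → List Row}
    (hn : PF n) (hm : PF m) (hr : PF rows) : PF fun a => gridCode (n a) (m a) (rows a) := by
  have h : PF fun p : (ℕ × ℕ) × ℕ => bellCode p.1.1 p.1.2 p.2 := by
    unfold bellCode cell
    exact PF.valCons (by fun_prop) (by fun_prop)
  have h' : PF fun p : α × ℕ => bellCode (m p.1) (rows p.1).length p.2 :=
    PF.comp (f := fun p : α × ℕ => ((m p.1, (rows p.1).length), p.2)) h (by fun_prop)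
  unfold HamLearn.gridCode
  fun_prop

/-- The code of the cut. -/
noncomputable def gridCutCode (n m R : ℕ) : Val :=
  PCode.enc ((List.range n).map fun q => decide (q / (2 * m + 1) = R + 1) &&
    decide (q % (2 * m + 1) % 2 = 1))

theorem gridCut_code (n m R : ℕ) : cutCode (gridCut n m R) = gridCutCode n m R := by
  rw [cutCode, ofBits_eq_enc, gridCutCode, ← List.map_coe_finRange_eq_range, List.map_map,
    List.ofFn_eq_map]
  congr 1
  refine List.map_congr_left fun j _ => ?_
  simp [gridCut]

@[fun_prop] theorem PF.gridCutCode {α : Type} [PCode α] {n m R : α → ℕ}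
    (hn : PF n) (hm : PF m) (hr : PF R) : PF fun a => gridCutCode (n a) (m a) (R a) := by
  unfold HamLearn.gridCutCode
  fun_prop

/-! ### Random indices -/

/-- One random bit doubles the range of a random index, as long as it does not exceed `B`. -/
def randStep (B : ℕ) (s : ℕ × ℕ) (bit : Bool) : ℕ × ℕ :=
  bif decide (2 * s.1 ≤ B) then (2 * s.1, bif bit then s.2 + s.1 else s.2) else s

/-- A power of two `g ≤ B`, and a random index below `g`. -/
def randIdx (B : ℕ) (u : List Bool) : ℕ × ℕ := u.foldl (randStep B) (1, 0)

/-- The size of the range after `k` steps, starting from `g`. -/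
def growth (B k g : ℕ) : ℕ := (fun g => if 2 * g ≤ B then 2 * g else g)^[k] g

theorem growth_succ (B k g : ℕ) : growth B (k + 1) g = growth B k (if 2 * g ≤ B then 2 * g else g) :=
  Function.iterate_succ_apply _ _ _

theorem randStep_foldl_fst (B : ℕ) (u : List Bool) (s : ℕ × ℕ) :
    (u.foldl (randStep B) s).1 = growth B u.length s.1 := by
  induction u generalizing s with
  | nil => rfl
  | cons b u ih =>
    rw [List.foldl_cons, ih, List.length_cons, growth_succ]
    congr 1
    unfold randStep
    by_cases h : 2 * s.1 ≤ B <;> simp [h]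

theorem randStep_foldl_lt (B : ℕ) (u : List Bool) (s : ℕ × ℕ) (h : s.2 < s.1) :
    (u.foldl (randStep B) s).2 < (u.foldl (randStep B) s).1 := by
  induction u generalizing s with
  | nil => exact h
  | cons b u ih =>
    rw [List.foldl_cons]
    refine ih _ ?_
    unfold randStep
    by_cases h : 2 * s.1 ≤ B <;> cases b <;> simp [h] <;> omega

theorem randIdx_lt (B : ℕ) (u : List Bool) : (randIdx B u).2 < (randIdx B u).1 :=
  randStep_foldl_lt B u _ (by simp)

theorem randIdx_fst (B : ℕ) (u : List Bool) : (randIdx B u).1 = growth B u.length 1 :=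
  randStep_foldl_fst B u _

theorem le_growth (B k g : ℕ) : g ≤ growth B k g := by
  induction k generalizing g with
  | zero => exact le_rfl
  | succ k ih =>
    rw [growth_succ]
    refine le_trans ?_ (ih _)
    split_ifs <;> omega

theorem growth_le {B k g : ℕ} (h : g ≤ B) : growth B k g ≤ B := by
  induction k generalizing g with
  | zero => exact h
  | succ k ih =>
    rw [growth_succ]
    refine ih ?_
    split_ifs <;> omega

/-- With enough bits, the range exceeds half of `B`. -/
theorem lt_growth {B k g : ℕ} (hg : 0 < g) (h : B ≤ k + g) : B < 2 * growth B k g := by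
  induction k generalizing g with
  | zero => simp only [growth, Function.iterate_zero_apply]; omega
  | succ k ih =>
    rw [growth_succ]
    split_ifs with h2
    · exact ih (by omega) (by omega)
    · exact lt_of_lt_of_le (by omega) (Nat.mul_le_mul_left 2 (le_growth B k g))

/-- The random index is uniform: each bit doubles its range as long as the range is at most half of
`B`, and the later bits determine the higher digits. -/
theorem avg_randStep (B k : ℕ) (s : ℕ × ℕ) (hs : s.2 < s.1) (i : ℕ) :
    avg k (fun u => if (u.foldl (randStep B) s).2 = i then 1 else 0) =
      if i < growth B k s.1 ∧ i % s.1 = s.2 then (s.1 : ℝ) / growth B k s.1 else 0 := by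
  induction k generalizing s with
  | zero =>
    rw [avg_zero]
    simp only [List.foldl_nil, growth, Function.iterate_zero_apply]
    have h1 : (s.1 : ℝ) ≠ 0 := by
      have : s.1 ≠ 0 := by omega
      exact_mod_cast this
    rw [div_self h1]
    congr 1
    refine propext ⟨?_, ?_⟩
    · rintro rfl
      exact ⟨hs, Nat.mod_eq_of_lt hs⟩
    · rintro ⟨h2, h3⟩
      rw [Nat.mod_eq_of_lt h2] at h3
      exact h3.symm
  | succ k ih =>
    have e : ∀ u : List Bool, ∀ c, ([c] ++ u).foldl (randStep B) s = u.foldl (randStep B) (randStep B s c) :=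
      fun u c => rfl
    rw [Nat.add_comm k 1, avg_add, avg_one]
    simp only [e]
    rw [Nat.add_comm 1 k, growth_succ]
    by_cases h : 2 * s.1 ≤ B
    · have e0 : randStep B s false = (2 * s.1, s.2) := by simp [randStep, h]
      have e1 : randStep B s true = (2 * s.1, s.2 + s.1) := by simp [randStep, h]
      rw [e0, e1, ih _ (by simp; omega), ih _ (by simp; omega), if_pos h]
      simp only
      set G := growth B k (2 * s.1)
      have h2 : i % s.1 = s.2 ↔ (i % (2 * s.1) = s.2 ∨ i % (2 * s.1) = s.2 + s.1) := by
        have h3 : i % (2 * s.1) % s.1 = i % s.1 := Nat.mod_mod_of_dvd i ⟨2, by ring⟩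
        have h4 : i % (2 * s.1) < 2 * s.1 := Nat.mod_lt _ (by omega)
        rw [← h3]
        by_cases h5 : i % (2 * s.1) < s.1
        · rw [Nat.mod_eq_of_lt h5]; omega
        · rw [Nat.mod_eq_sub_mod (by omega), Nat.mod_eq_of_lt (by omega)]; omega
      by_cases h6 : i < G
      · by_cases h7 : i % (2 * s.1) = s.2
        · have h8 : ¬ s.2 = s.2 + s.1 := by omega
          simp only [h2, h6, h7, h8, true_and, true_or, if_true, if_false]
          push_cast
          ring
        · by_cases h8 : i % (2 * s.1) = s.2 + s.1
          · have h9 : ¬ s.2 + s.1 = s.2 := by omega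
            simp only [h2, h6, h8, h9, true_and, or_true, if_true, if_false]
            push_cast
            ring
          · simp [h2, h7, h8]
      · simp [h6]
    · have e0 : ∀ c, randStep B s c = s := by intro c; simp [randStep, h]
      rw [e0, e0, ih _ hs, if_neg h]
      ring

theorem avg_randIdx (B k i : ℕ) : avg k (fun u => if (randIdx B u).2 = i then 1 else 0) =
    if i < growth B k 1 then 1 / (growth B k 1 : ℝ) else 0 := by
  have := avg_randStep B k (1, 0) (by simp) i
  simp only [Nat.mod_one, and_true, Nat.cast_one] at this
  refine this.trans ?_
  congr 1

@[fun_prop] theorem PF.randIdx {α : Type} [PCode α] {B : α → ℕ} {u : α → List Bool} (hB : PF B)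
    (hu : PF u) : PF fun a => randIdx (B a) (u a) := by
  obtain ⟨p, hp⟩ := hB.size_le
  refine PF.foldl (f := fun a => randStep (B a)) (s := fun _ => (1, 0)) hu (.const _)
    (by unfold randStep; fun_prop) ⟨4 * p + 10, fun a i => ?_⟩
  have h1 := hp a
  have h2 := randStep_foldl_lt (B a) ((u a).take i) (1, 0) (by simp)
  have h3 := randStep_foldl_fst (B a) ((u a).take i) (1, 0)
  have h4 : growth (B a) ((u a).take i).length 1 ≤ B a + 1 := by
    rcases Nat.eq_zero_or_pos (B a) with h | h
    · rw [h]
      have : ∀ k, growth 0 k 1 = 1 := by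
        intro k
        induction k with
        | zero => rfl
        | succ k ih => rw [growth_succ]; simpa using ih
      rw [this]
    · exact (growth_le h).trans (by omega)
  simp only at h3
  rw [size_enc_nat] at h1
  rw [size_enc_pair, size_enc_nat, size_enc_nat]
  simp only [Polynomial.eval_add, Polynomial.eval_mul, Polynomial.eval_ofNat]
  omega

/-! ### Random strings with one `1` in each block -/

/-- The size of the blocks: a power of two, close to `m / t`. -/
def blockSize (m t : ℕ) : ℕ := growth (m / t) m 1

/-- The position of the `1` in block `κ`; `m` random bits are spent on each block. -/
def blockIdx (m t : ℕ) (u : List Bool) (κ : ℕ) : ℕ := (randIdx (m / t) ((u.drop (κ * m)).take m)).2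

/-- The random string with one `1` in each of `t` blocks of columns. -/
def blockString (m t : ℕ) (u : List Bool) (j : ℕ) : Bool :=
  (List.range t).any fun κ => decide (j = κ * blockSize m t + blockIdx m t u κ)

theorem blockSize_le {m t : ℕ} (h : 0 < m / t) : blockSize m t ≤ m / t := growth_le h

theorem lt_blockSize {m t : ℕ} : m / t < 2 * blockSize m t :=
  lt_growth one_pos ((Nat.div_le_self m t).trans (Nat.le_succ m))

theorem blockSize_eq {m : ℕ} (t : ℕ) {u : List Bool} (h : u.length = m) :
    (randIdx (m / t) u).1 = blockSize m t := by
  rw [randIdx_fst, h, blockSize]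

theorem blockIdx_lt {m t κ : ℕ} {u : List Bool} (hu : u.length = t * m) (hκ : κ < t) :
    blockIdx m t u κ < blockSize m t := by
  have h : κ * m + m ≤ t * m := by
    have := Nat.mul_le_mul_right m (Nat.succ_le_of_lt hκ)
    rwa [Nat.succ_mul] at this
  rw [← blockSize_eq t (u := (u.drop (κ * m)).take m) (by rw [List.length_take, List.length_drop, hu]; omega)]
  exact randIdx_lt _ _

/-- Independent blocks with small point probabilities. -/
theorem avg_blocks_le (K t : ℕ) (F : List Bool → ℕ) (i : ℕ → ℕ) (p : ℝ) (hp : 0 ≤ p)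
    (h : ∀ i, avg K (fun u => if F u = i then 1 else 0) ≤ p) :
    avg (t * K) (fun u => if ∀ κ < t, F ((u.drop (κ * K)).take K) = i κ then 1 else 0) ≤ p ^ t := by
  induction t with
  | zero => simp [avg_const]
  | succ t ih =>
    rw [Nat.succ_mul, avg_add]
    refine le_trans (avg_mono (g := fun u =>
      (if ∀ κ < t, F ((u.drop (κ * K)).take K) = i κ then 1 else 0) * p) ?_) ?_
    · intro u hu
      refine le_trans (b := avg K fun v =>
        (if ∀ κ < t, F ((u.drop (κ * K)).take K) = i κ then 1 else 0) *
          (if F v = i t then (1 : ℝ) else 0)) (avg_congr fun v hv => ?_).le ?_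
      · have h1 : ((u ++ v).drop (t * K)).take K = v := by
          rw [List.drop_append_of_le_length (by omega), List.drop_eq_nil_of_le (by omega),
            List.nil_append, List.take_of_length_le (by omega)]
        have h2 : ∀ κ < t, ((u ++ v).drop (κ * K)).take K = (u.drop (κ * K)).take K := by
          intro κ hκ
          have hκ' : κ * K + K ≤ t * K := by
            have := Nat.mul_le_mul_right K (Nat.succ_le_of_lt hκ)
            rwa [Nat.succ_mul] at this
          rw [List.drop_append_of_le_length (by omega),
            List.take_append_of_le_length (by rw [List.length_drop]; omega)]
        have h3 : (∀ κ < t + 1, F (((u ++ v).drop (κ * K)).take K) = i κ) ↔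
            (∀ κ < t, F ((u.drop (κ * K)).take K) = i κ) ∧ F v = i t := by
          constructor
          · intro h4
            refine ⟨fun κ hκ => ?_, ?_⟩
            · rw [← h2 κ hκ]; exact h4 κ (by omega)
            · rw [← h1]; exact h4 t (by omega)
          · rintro ⟨h4, h5⟩ κ hκ
            rcases Nat.lt_succ_iff_lt_or_eq.1 hκ with h6 | rfl
            · rw [h2 κ h6]; exact h4 κ h6
            · rw [h1]; exact h5
        simp only [h3]
        by_cases h4 : F v = i t <;> simp [h4]
      · unfold avg
        rw [unifE_mul_left]
        refine mul_le_mul_of_nonneg_left (h _) ?_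
        split_ifs <;> norm_num
    · have : (avg (t * K) fun u =>
          (if ∀ κ < t, F ((u.drop (κ * K)).take K) = i κ then 1 else 0) * p) =
          p * avg (t * K) fun u => if ∀ κ < t, F ((u.drop (κ * K)).take K) = i κ then 1 else 0 := by
        unfold avg
        rw [← unifE_mul_left]
        exact unifE_congr fun _ => mul_comm _ _
      rw [this, pow_succ, mul_comm]
      exact mul_le_mul_of_nonneg_right ih hp

theorem block_bound {t g κ i m : ℕ} (hg : g ≤ m / t) (hκ : κ < t) (hi : i < g) : κ * g + i < m := by
  have h1 : (κ + 1) * g ≤ t * (m / t) := Nat.mul_le_mul (by omega) hg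
  have h2 : t * (m / t) ≤ m := Nat.mul_div_le m t
  rw [Nat.succ_mul] at h1
  omega

theorem blockString_iff {m t : ℕ} {u : List Bool} {j : ℕ} : blockString m t u j = true ↔
    ∃ κ < t, j = κ * blockSize m t + blockIdx m t u κ := by
  simp [blockString]

theorem block_unique {g κ κ' i i' : ℕ} (hi : i < g) (hi' : i' < g) (h : κ * g + i = κ' * g + i') :
    κ = κ' ∧ i = i' := by
  have hk : κ = κ' := by
    have h1 : (κ * g + i) / g = κ := by
      rw [Nat.mul_comm, Nat.mul_add_div (by omega), Nat.div_eq_of_lt hi, add_zero]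
    have h2 : (κ' * g + i') / g = κ' := by
      rw [Nat.mul_comm, Nat.mul_add_div (by omega), Nat.div_eq_of_lt hi', add_zero]
    rw [← h1, h, h2]
  subst hk
  exact ⟨rfl, by omega⟩

/-- The min-entropy of the random string. -/
theorem avg_blockString_le {m t : ℕ} (h : 0 < m / t) (x : ℕ → Bool) :
    avg (t * m) (fun u => if ∀ j < m, blockString m t u j = x j then 1 else 0) ≤
      (1 / (blockSize m t : ℝ)) ^ t := by
  classical
  have hp : ∀ i, avg m (fun u => if (randIdx (m / t) u).2 = i then 1 else 0) ≤
      1 / (blockSize m t : ℝ) := by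
    intro i
    rw [avg_randIdx]
    split_ifs
    · exact le_rfl
    · positivity
  by_cases hx : ∃ u0 : List Bool, u0.length = t * m ∧ ∀ j < m, blockString m t u0 j = x j
  · obtain ⟨u0, hu0, hx⟩ := hx
    refine le_trans (avg_mono fun u hu => ?_) (avg_blocks_le m t (fun u => (randIdx (m / t) u).2)
      (fun κ => blockIdx m t u0 κ) _ (by positivity) hp)
    split_ifs with h1 h2
    · exact le_rfl
    · refine absurd (fun κ hκ => ?_) h2
      have h3 : blockString m t u (κ * blockSize m t + blockIdx m t u κ) = true :=
        blockString_iff.2 ⟨κ, hκ, rfl⟩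
      have h4 := block_bound (blockSize_le h) hκ (blockIdx_lt hu hκ)
      rw [h1 _ h4, ← hx _ h4] at h3
      obtain ⟨κ', hκ', h5⟩ := blockString_iff.1 h3
      obtain ⟨rfl, h6⟩ := block_unique (blockIdx_lt hu hκ) (blockIdx_lt hu0 hκ') h5
      exact h6
    · norm_num
    · exact le_rfl
  · have : (avg (t * m) fun u => if ∀ j < m, blockString m t u j = x j then (1 : ℝ) else 0) =
        avg (t * m) fun _ => 0 :=
      avg_congr fun u hu => if_neg fun h => hx ⟨u, hu, h⟩
    rw [this, avg_const]
    positivity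

/-! ### One hashed bit -/

/-- The inner product of a list of bits with a string. -/
def dot (m : ℕ) (v : List Bool) (x : ℕ → Bool) : Bool := xorSum m fun j => v.getD j false && x j

/-- `(-1)^b`. -/
def sgn (b : Bool) : ℝ := if b then -1 else 1

theorem sgn_xor (a b : Bool) : sgn (a ^^ b) = sgn a * sgn b := by
  cases a <;> cases b <;> simp [sgn]

theorem dot_append (m : ℕ) (u : List Bool) (hu : u.length = m) (c : Bool) (x : ℕ → Bool) :
    dot (m + 1) (u ++ [c]) x = (dot m u x ^^ (c && x m)) := by
  rw [dot, xorSum_succ, dot]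
  congr 1
  · refine xorSum_congr fun i hi => ?_
    rw [List.getD_append _ _ _ _ (by omega)]
  · rw [List.getD_append_right _ _ _ _ (by omega), hu]
    simp

/-- Different characters are orthogonal. -/
theorem avg_sgn_dot (m : ℕ) (x y : ℕ → Bool) :
    avg m (fun r => sgn (dot m r x) * sgn (dot m r y)) = if ∀ j < m, x j = y j then 1 else 0 := by
  induction m with
  | zero => simp [avg_zero, dot, sgn]
  | succ m ih =>
    rw [avg_add]
    have : (avg m fun u => avg 1 fun v => sgn (dot (m + 1) (u ++ v) x) * sgn (dot (m + 1) (u ++ v) y)) =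
        avg m fun u => (if x m = y m then 1 else 0) * (sgn (dot m u x) * sgn (dot m u y)) := by
      refine avg_congr fun u hu => ?_
      rw [avg_one, dot_append m u hu, dot_append m u hu, dot_append m u hu, dot_append m u hu]
      simp only [sgn_xor]
      have h0 : sgn false = 1 := rfl
      have h1 : sgn true = -1 := rfl
      cases x m <;> cases y m <;> simp [h0, h1]
    rw [this]
    unfold avg at *
    rw [unifE_mul_left, ih]
    have h1 : (∀ j < m + 1, x j = y j) ↔ x m = y m ∧ ∀ j < m, x j = y j := by
      refine ⟨fun h => ⟨h m (by omega), fun j hj => h j (by omega)⟩, fun h j hj => ?_⟩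
      rcases Nat.lt_succ_iff_lt_or_eq.1 hj with h2 | rfl
      · exact h.2 j h2
      · exact h.1
    simp only [h1]
    by_cases h2 : x m = y m <;> simp [h2]

theorem unifE_sum {Ω ι : Type} [Fintype Ω] (s : Finset ι) (f : ι → Ω → ℝ) :
    unifE (fun ω => ∑ i ∈ s, f i ω) = ∑ i ∈ s, unifE (f i) := by
  simp only [unifE, Finset.sum_div]
  rw [Finset.sum_comm]

open Classical in
/-- A leftover hash lemma for one bit. If the string `X u` has large min-entropy and `f u` takes few
values, then the inner product of `X u` with a random `r` is close to uniform, given `f u` and `r`. -/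
theorem leftover_hash {Y : Type} (N m : ℕ) (X : List Bool → ℕ → Bool) (f : List Bool → Y)
    (S : Finset Y) (P : ℝ) (hS : ∀ u, u.length = N → f u ∈ S)
    (hP : ∀ x : ℕ → Bool, avg N (fun u => if ∀ j < m, X u j = x j then 1 else 0) ≤ P)
    (β : Y → List Bool → Bool → ℝ) (hβ : ∀ y r b, 0 ≤ β y r b ∧ β y r b ≤ 1) :
    (avg N fun u => avg m fun r =>
      β (f u) r (dot m r (X u)) - β (f u) r (!dot m r (X u))) ^ 2 ≤ S.card * P := by
  -- `γ` is the part of `β` that is odd in the hashed bit, and `T y r` is the correlation of the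
  -- character `(-1) ^ ⟨r, X⟩` with the event `f = y`. The Cauchy-Schwarz inequality bounds the
  -- advantage by the second moments of `T`, which are collision probabilities.
  let γ : Y → List Bool → ℝ := fun y r => β y r false - β y r true
  have hγ : ∀ y r, γ y r ^ 2 ≤ 1 := by
    intro y r
    have h1 := hβ y r false
    have h2 := hβ y r true
    simp only [γ]
    rw [sq_le_one_iff_abs_le_one, abs_le]
    constructor <;> linarith
  let T : Y → List Bool → ℝ := fun y r =>
    avg N fun u => (if f u = y then 1 else 0) * sgn (dot m r (X u))
  have h1 : (avg N fun u => avg m fun r =>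
      β (f u) r (dot m r (X u)) - β (f u) r (!dot m r (X u))) =
      avg m fun r => ∑ y ∈ S, γ y r * T y r := by
    unfold avg
    rw [unifE_swap]
    refine unifE_congr fun r => ?_
    simp only [T, avg, ← unifE_mul_left]
    rw [← unifE_sum]
    refine unifE_congr fun u => ?_
    rw [Finset.sum_eq_single (f (List.ofFn u))]
    · simp only [γ, sgn, if_true, one_mul]
      cases dot m (List.ofFn r) (X (List.ofFn u)) <;> simp
    · intro y _ hy
      rw [if_neg hy.symm]
      ring
    · intro h
      exact absurd (hS _ (by simp)) h
  have h2 : ∀ y, (avg m fun r => T y r ^ 2) = avg N fun u => avg N fun u' =>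
      ((if f u = y then 1 else 0) * (if f u' = y then 1 else 0)) *
        (if ∀ j < m, X u j = X u' j then 1 else 0) := by
    intro y
    have e : ∀ r, T y r ^ 2 = avg N fun u => avg N fun u' =>
        ((if f u = y then 1 else 0) * (if f u' = y then 1 else 0)) *
          (sgn (dot m r (X u)) * sgn (dot m r (X u'))) := by
      intro r
      have : ∀ u : List Bool, (avg N fun u' =>
          ((if f u = y then 1 else 0) * (if f u' = y then 1 else 0)) *
          (sgn (dot m r (X u)) * sgn (dot m r (X u')))) =
          T y r * ((if f u = y then 1 else 0) * sgn (dot m r (X u))) := by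
        intro u
        simp only [T, avg]
        rw [mul_comm, ← unifE_mul_left]
        exact unifE_congr fun u' => by ring
      simp only [this]
      rw [sq]
      conv_lhs => rw [show T y r = avg N fun u => (if f u = y then 1 else 0) * sgn (dot m r (X u)) from rfl]
      rw [show (avg N fun u => (if f u = y then 1 else 0) * sgn (dot m r (X u))) = T y r from rfl]
      unfold avg
      rw [unifE_mul_left]
      rfl
    simp only [e]
    unfold avg
    rw [unifE_swap]
    refine unifE_congr fun u => ?_
    rw [unifE_swap]
    refine unifE_congr fun u' => ?_
    rw [unifE_mul_left]
    congr 1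
    exact avg_sgn_dot m _ _
  have h3 : ∑ y ∈ S, (avg m fun r => T y r ^ 2) ≤ P := by
    simp only [h2]
    have e : ∑ y ∈ S, (avg N fun u => avg N fun u' =>
      ((if f u = y then 1 else 0) * (if f u' = y then 1 else 0)) *
        (if ∀ j < m, X u j = X u' j then (1 : ℝ) else 0)) = avg N fun u => avg N fun u' =>
        ∑ y ∈ S, ((if f u = y then 1 else 0) * (if f u' = y then 1 else 0)) *
        (if ∀ j < m, X u j = X u' j then (1 : ℝ) else 0) := by
      unfold avg
      rw [← unifE_sum]
      refine unifE_congr fun u => ?_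
      rw [← unifE_sum]
    rw [e]
    refine le_trans (avg_mono (g := fun _ => P) fun u hu => ?_) (avg_const _ _).le
    refine le_trans (avg_mono fun u' hu' => ?_) (hP (X u))
    rw [← Finset.sum_mul]
    have hle : ∑ y ∈ S, (if f u = y then (1 : ℝ) else 0) * (if f u' = y then 1 else 0) ≤ 1 := by
      rw [Finset.sum_eq_single (f u)]
      · rw [if_pos rfl, one_mul]; split_ifs <;> norm_num
      · intro y _ hy
        rw [if_neg hy.symm, zero_mul]
      · intro h
        exact absurd (hS u hu) h
    by_cases hX : ∀ j < m, X u j = X u' j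
    · rw [if_pos hX, if_pos fun j hj => (hX j hj).symm, mul_one]
      exact hle
    · rw [if_neg hX, mul_zero]
      split_ifs <;> norm_num
  rw [h1]
  calc (avg m fun r => ∑ y ∈ S, γ y r * T y r) ^ 2
      ≤ avg m fun r => (∑ y ∈ S, γ y r * T y r) ^ 2 := sq_unifE_le _
    _ ≤ avg m fun r => S.card * ∑ y ∈ S, T y r ^ 2 := by
        refine avg_mono fun r _ => ?_
        refine (Finset.sum_mul_sq_le_sq_mul_sq _ _ _).trans ?_
        refine mul_le_mul_of_nonneg_right ?_ (Finset.sum_nonneg fun _ _ => sq_nonneg _)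
        refine (Finset.sum_le_sum fun y _ => hγ y r).trans ?_
        simp
    _ = S.card * ∑ y ∈ S, (avg m fun r => T y r ^ 2) := by
        unfold avg
        rw [unifE_mul_left, unifE_sum]
    _ ≤ S.card * P := mul_le_mul_of_nonneg_left h3 (Nat.cast_nonneg _)

/-! ### Negligible functions -/

theorem Negligible.of_le {f g : ℕ → ℝ} (hg : Negligible g) (h : ∀ᶠ n in atTop, |f n| ≤ g n) :
    Negligible f := by
  intro c
  filter_upwards [hg c, h] with n h1 h2
  exact h2.trans ((le_abs_self _).trans h1)

theorem Negligible.mul_pow {f : ℕ → ℝ} (hf : Negligible f) (k : ℕ) :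
    Negligible fun n => (n : ℝ) ^ k * f n := by
  intro c
  filter_upwards [hf (k + c), eventually_gt_atTop 0] with n h1 h2
  have h3 : (0 : ℝ) < n := by exact_mod_cast h2
  rw [abs_mul, abs_of_nonneg (by positivity : (0 : ℝ) ≤ (n : ℝ) ^ k)]
  calc (n : ℝ) ^ k * |f n| ≤ (n : ℝ) ^ k * ((n : ℝ) ^ (k + c))⁻¹ := by gcongr
    _ = ((n : ℝ) ^ c)⁻¹ := by
      rw [pow_add]
      field_simp

/-- A constant and a power are eventually below a higher power. -/
theorem const_mul_pow_le (C : ℝ) (k : ℕ) :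
    ∀ᶠ n : ℕ in atTop, C * (n : ℝ) ^ k ≤ (n : ℝ) ^ (k + 1) := by
  filter_upwards [eventually_ge_atTop ⌈C⌉₊] with n hn
  have : C ≤ n := (Nat.le_ceil C).trans (by exact_mod_cast hn)
  rw [pow_succ, mul_comm]
  gcongr

theorem Negligible.abs {f : ℕ → ℝ} (hf : Negligible f) : Negligible fun n => |f n| := fun c =>
  (hf c).mono fun n h => by rwa [abs_abs]

theorem Negligible.const_mul {f : ℕ → ℝ} (hf : Negligible f) (C : ℝ) :
    Negligible fun n => C * f n := by
  refine (hf.abs.mul_pow 1).of_le ?_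
  filter_upwards [const_mul_pow_le |C| 0] with n h
  rw [abs_mul]
  refine mul_le_mul_of_nonneg_right ?_ (abs_nonneg _)
  simpa using h

theorem Negligible.add {f g : ℕ → ℝ} (hf : Negligible f) (hg : Negligible g) :
    Negligible fun n => f n + g n := by
  intro c
  filter_upwards [hf (c + 1), hg (c + 1), const_mul_pow_le 2 c, eventually_gt_atTop 0]
    with n h1 h2 h3 h4
  have h5 : (0 : ℝ) < n := by exact_mod_cast h4
  have h6 : 2 * ((n : ℝ) ^ (c + 1))⁻¹ ≤ ((n : ℝ) ^ c)⁻¹ := by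
    rw [← div_eq_mul_inv, div_le_iff₀ (by positivity), ← div_eq_inv_mul, le_div_iff₀ (by positivity)]
    exact h3
  exact (abs_add_le _ _).trans (by linarith)

theorem Negligible.of_sq_le {f g : ℕ → ℝ} (hg : Negligible g) (h : ∀ᶠ n in atTop, f n ^ 2 ≤ g n) :
    Negligible f := by
  intro c
  filter_upwards [hg (2 * c), h] with n h1 h2
  refine abs_le_of_sq_le_sq ?_ (by positivity)
  rw [← inv_pow, ← pow_mul, mul_comm c 2, inv_pow]
  exact h2.trans ((le_abs_self _).trans h1)

/-- A polynomial is eventually bounded by a power. -/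
theorem exists_eval_le_pow (p : Polynomial ℕ) : ∃ k, ∀ᶠ l : ℕ in atTop, p.eval l ≤ l ^ k := by
  induction p using Polynomial.induction_on' with
  | add p q hp hq =>
    obtain ⟨k, hk⟩ := hp
    obtain ⟨k', hk'⟩ := hq
    refine ⟨max k k' + 1, ?_⟩
    filter_upwards [hk, hk', eventually_ge_atTop 2] with l h1 h2 h3
    have h4 : l ^ k ≤ l ^ max k k' := Nat.pow_le_pow_right (by omega) (le_max_left _ _)
    have h5 : l ^ k' ≤ l ^ max k k' := Nat.pow_le_pow_right (by omega) (le_max_right _ _)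
    have h6 : l ^ max k k' * 2 ≤ l ^ max k k' * l := Nat.mul_le_mul_left _ h3
    rw [Polynomial.eval_add, pow_succ]
    omega
  | monomial j a =>
    refine ⟨j + 1, ?_⟩
    filter_upwards [eventually_ge_atTop a] with l h
    rw [Polynomial.eval_monomial, pow_succ, mul_comm]
    exact Nat.mul_le_mul_left _ h

theorem Negligible.mul_poly {f : ℕ → ℝ} (hf : Negligible f) (p : Polynomial ℕ) :
    Negligible fun n => ((p.eval n : ℕ) : ℝ) * f n := by
  obtain ⟨k, hk⟩ := exists_eval_le_pow p
  refine (hf.abs.mul_pow k).of_le ?_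
  filter_upwards [hk] with n h
  rw [abs_mul, Nat.abs_cast]
  refine mul_le_mul_of_nonneg_right ?_ (abs_nonneg _)
  exact_mod_cast h

theorem tendsto_of_le_eval {s : ℕ → ℕ} {p : Polynomial ℕ} (h : ∀ᶠ n in atTop, n ≤ p.eval (s n)) :
    Tendsto s atTop atTop := by
  refine tendsto_atTop.2 fun M => ?_
  filter_upwards [h, eventually_gt_atTop (p.eval M)] with n h1 h2
  by_contra h3
  have : p.eval (s n) ≤ p.eval M := poly_mono p (show s n ≤ M by omega)
  omega

/-- Negligible functions remain so after a polynomially bounded change of the parameter. -/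
theorem Negligible.comp_of_le_eval {f : ℕ → ℝ} (hf : Negligible f) {s : ℕ → ℕ} {p : Polynomial ℕ}
    (h : ∀ᶠ n in atTop, n ≤ p.eval (s n)) : Negligible fun n => f (s n) := by
  intro c
  obtain ⟨k, hk⟩ := exists_eval_le_pow p
  have ht := tendsto_of_le_eval h
  filter_upwards [ht.eventually (hf (k * c)), ht.eventually hk, h, eventually_gt_atTop 0]
    with n h1 h2 h3 h4
  refine h1.trans ?_
  have h5 : (n : ℝ) ≤ (s n : ℝ) ^ k := by exact_mod_cast h3.trans h2
  have h6 : (0 : ℝ) < n := by exact_mod_cast h4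
  rw [pow_mul]
  gcongr

/-! ### Counting sparse vectors -/

theorem card_sparse_le (a b : ℕ) :
    (Finset.univ.filter fun v : Fin a → ZMod 2 => hammingNorm v ≤ b).card ≤ ballCard a b := by
  classical
  have hz : ∀ z : ZMod 2, z ≠ 0 → z = 1 := by decide
  have hsub : (Finset.univ.filter fun v : Fin a → ZMod 2 => hammingNorm v ≤ b) ⊆
      (Finset.range (b + 1)).biUnion fun j =>
        Finset.univ.filter fun v : Fin a → ZMod 2 => hammingNorm v = j := by
    intro v hv
    rw [Finset.mem_filter] at hv
    rw [Finset.mem_biUnion]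
    exact ⟨hammingNorm v, Finset.mem_range.2 (by omega), by simp⟩
  refine (Finset.card_le_card hsub).trans (Finset.card_biUnion_le.trans ?_)
  refine Finset.sum_le_sum fun j _ => ?_
  have h1 : (Finset.powersetCard j (Finset.univ : Finset (Fin a))).card = a.choose j := by
    rw [Finset.card_powersetCard, Finset.card_univ, Fintype.card_fin]
  rw [← h1]
  refine Finset.card_le_card_of_injOn (fun v => Finset.univ.filter fun i => v i ≠ 0) ?_ ?_
  · intro v hv
    have hv' : hammingNorm v = j := by simpa using hv
    rw [Finset.mem_coe, Finset.mem_powersetCard]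
    exact ⟨Finset.subset_univ _, by rw [← hv']; rfl⟩
  · intro v _ v' _ h
    funext i
    have : i ∈ (Finset.univ.filter fun i => v i ≠ 0) ↔ i ∈ (Finset.univ.filter fun i => v' i ≠ 0) := by
      simp only at h
      rw [h]
    simp only [Finset.mem_filter, Finset.mem_univ, true_and] at this
    by_cases h0 : v i = 0
    · rw [h0]
      by_contra h2
      exact this.2 (Ne.symm h2) h0
    · rw [hz _ h0, hz _ (this.1 h0)]

theorem ballCard_pos (a b : ℕ) : 0 < ballCard a b :=
  lt_of_lt_of_le (by simp) (Finset.single_le_sum (f := fun j => a.choose j) (fun _ _ => Nat.zero_le _)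
    (Finset.mem_range.2 (Nat.succ_pos b)) : a.choose 0 ≤ ballCard a b)

/-- Each binomial coefficient is weighted with `(t / m) ^ j`, as in the Chernoff bound. -/
theorem ballCard_le {m t : ℕ} (ht : 0 < t) (htm : t ≤ m) :
    (ballCard m t : ℝ) ≤ ((m : ℝ) / t) ^ t * Real.exp t := by
  have hm : (0 : ℝ) < m := by exact_mod_cast ht.trans_le htm
  have ht' : (0 : ℝ) < t := by exact_mod_cast ht
  have h1 : (1 : ℝ) ≤ (m : ℝ) / t := by
    rw [le_div_iff₀ ht', one_mul]
    exact_mod_cast htm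
  have h2 : (ballCard m t : ℝ) ≤ ((m : ℝ) / t) ^ t * ((t : ℝ) / m + 1) ^ m := by
    rw [add_pow, ballCard, Finset.mul_sum]
    push_cast
    have hsub : Finset.range (t + 1) ⊆ Finset.range (m + 1) := Finset.range_mono (by omega)
    refine le_trans (Finset.sum_le_sum fun j hj => ?_)
      (Finset.sum_le_sum_of_subset_of_nonneg hsub fun j _ _ => by positivity)
    have hj' : j ≤ t := by rw [Finset.mem_range] at hj; omega
    have h3 : ((m : ℝ) / t) ^ t = ((m : ℝ) / t) ^ (t - j) * ((m : ℝ) / t) ^ j := by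
      rw [← pow_add]; congr 1; omega
    have h4 : ((m : ℝ) / t) ^ j * ((t : ℝ) / m) ^ j = 1 := by
      rw [← mul_pow, div_mul_div_cancel₀ ht'.ne', div_self hm.ne', one_pow]
    rw [one_pow, mul_one, h3]
    calc ((m.choose j : ℕ) : ℝ) = 1 * (m.choose j : ℝ) := (one_mul _).symm
      _ ≤ ((m : ℝ) / t) ^ (t - j) * (m.choose j : ℝ) := by
        gcongr
        exact one_le_pow₀ h1
      _ = _ := by linear_combination (-((m : ℝ) / t) ^ (t - j) * (m.choose j : ℝ)) * h4
  refine h2.trans ?_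
  gcongr
  calc ((t : ℝ) / m + 1) ^ m ≤ Real.exp ((t : ℝ) / m) ^ m := by
        gcongr
        exact Real.add_one_le_exp _
    _ = Real.exp t := by
        rw [← Real.exp_nat_mul]
        congr 1
        field_simp

/-! ### The parameters -/

namespace DenseSparseFamily
variable {D : DenseSparseFamily}

/-- The number of pairs of a `k t`-sparse and a `w`-sparse vector. -/
def pairCount (D : DenseSparseFamily) (l : ℕ) : ℕ :=
  ballCard (D.d l) (D.k l * D.t l) * ballCard (D.h l) (D.w l)

theorem Suitable.t_pos (hD : D.Suitable) : ∀ᶠ l in atTop, 0 < D.t l := by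
  have h := hD.t_large.bound one_pos
  filter_upwards [h, eventually_gt_atTop 1] with l h1 h2
  rw [Nat.pos_iff_ne_zero]
  intro h3
  rw [h3] at h1
  have h4 : 0 < Real.log l := Real.log_pos (by exact_mod_cast h2)
  simp at h1
  rcases h1 with h1 | h1 | h1
  · omega
  · omega
  · have : (0 : ℝ) ≤ l := Nat.cast_nonneg l
    linarith

theorem Suitable.mul_t_le (hD : D.Suitable) (C : ℝ) (hC : 0 < C) :
    ∀ᶠ l in atTop, C * D.t l ≤ D.m l := by
  filter_upwards [hD.t_small.bound (inv_pos.2 hC)] with l h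
  rw [Real.norm_natCast, Real.norm_natCast, ← div_eq_inv_mul, le_div_iff₀ hC] at h
  linarith

theorem Suitable.div_pos (hD : D.Suitable) : ∀ᶠ l in atTop, 0 < D.m l / D.t l := by
  filter_upwards [hD.t_pos, hD.mul_t_le 1 one_pos] with l h1 h2
  refine Nat.div_pos ?_ h1
  rw [one_mul] at h2
  exact_mod_cast h2

/-- In the regime of the assumption, the random strings have more entropy than their images can
hold. -/
theorem Suitable.compression (hD : D.Suitable) : ∀ᶠ l in atTop,
    (D.pairCount l : ℝ) * (1 / (blockSize (D.m l) (D.t l) : ℝ)) ^ D.t l ≤ (1 / 2) ^ D.t l := by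
  obtain ⟨Γ, hΓ, hreg⟩ := hD.regime
  -- A block size of `2 ^ X` is large enough to absorb, through `Γ > 1`, the rounding of the block
  -- size to a power of two and the factor `e ^ t` in the bound for `V(m, t)`.
  set X : ℝ := (1 + 3 / Γ) / (1 - 1 / Γ) with hX
  have hΓ0 : 0 < Γ := by linarith
  have hΓ1 : 0 < 1 - 1 / Γ := by
    rw [sub_pos, div_lt_one hΓ0]; exact hΓ
  filter_upwards [hreg, hD.t_pos, hD.div_pos, hD.mul_t_le (2 * 2 ^ X) (by positivity)]
    with l h1 h2 h3 h4
  set m := D.m l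
  set t := D.t l
  set g := blockSize m t with hg
  have htm : t ≤ m := by
    by_contra h
    rw [Nat.div_eq_of_lt (by omega)] at h3
    omega
  have ht' : (0 : ℝ) < t := by exact_mod_cast h2
  have hg2 : (m : ℝ) / t ≤ 2 * g := by
    have h5 : m / t + 1 ≤ 2 * g := lt_blockSize
    have h6 : m < t * (m / t + 1) := Nat.lt_mul_div_succ m h2
    have h7 : m ≤ t * (2 * g) := h6.le.trans (Nat.mul_le_mul_left _ h5)
    rw [div_le_iff₀ ht', mul_comm]
    exact_mod_cast h7
  have hgX : (2 : ℝ) ^ X ≤ g := by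
    have h5 : 2 * (2 : ℝ) ^ X ≤ (m : ℝ) / t := by
      rw [le_div_iff₀ ht']; exact h4
    linarith
  have hg0 : (0 : ℝ) < g := lt_of_lt_of_le (by positivity) hgX
  have hm0 : (0 : ℝ) < m := by exact_mod_cast h2.trans_le htm
  have hlX : X ≤ Real.logb 2 g := by
    rw [Real.le_logb_iff_rpow_le (by norm_num) hg0]
    exact hgX
  have hexp : Real.logb 2 (Real.exp 1) ≤ 2 := by
    rw [Real.logb_le_iff_le_rpow (by norm_num) (Real.exp_pos 1)]
    have := Real.exp_one_lt_three
    norm_num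
    linarith
  have hV : Real.logb 2 (ballCard m t : ℝ) ≤ t * (Real.logb 2 g + 3) := by
    calc Real.logb 2 (ballCard m t : ℝ)
        ≤ Real.logb 2 (((m : ℝ) / t) ^ t * Real.exp t) :=
          Real.logb_le_logb_of_le one_lt_two (by exact_mod_cast ballCard_pos m t)
            (ballCard_le h2 htm)
      _ = t * Real.logb 2 ((m : ℝ) / t) + t * Real.logb 2 (Real.exp 1) := by
          rw [Real.logb_mul (by positivity) (by positivity), Real.logb_pow,
            show Real.exp t = Real.exp 1 ^ t by rw [← Real.exp_nat_mul, mul_one], Real.logb_pow]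
      _ ≤ t * Real.logb 2 (2 * g) + t * 2 := by
          exact add_le_add (mul_le_mul_of_nonneg_left
            (Real.logb_le_logb_of_le one_lt_two (by positivity) hg2) ht'.le)
            (mul_le_mul_of_nonneg_left hexp ht'.le)
      _ = t * (Real.logb 2 g + 3) := by
          rw [Real.logb_mul (by norm_num) hg0.ne', Real.logb_self_eq_one one_lt_two]
          ring
  have hL0 : (0 : ℝ) < D.pairCount l := by
    exact_mod_cast Nat.mul_pos (ballCard_pos _ _) (ballCard_pos _ _)
  have hL : Real.logb 2 (D.pairCount l : ℝ) ≤ t * Real.logb 2 g - t := by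
    have h5 : Γ * Real.logb 2 (D.pairCount l : ℝ) ≤ t * (Real.logb 2 g + 3) := by
      rw [pairCount]
      push_cast
      exact h1.trans hV
    have h6 : Real.logb 2 (D.pairCount l : ℝ) ≤ t * (Real.logb 2 g + 3) / Γ := by
      rw [le_div_iff₀ hΓ0, mul_comm]; exact h5
    have h7 : 1 + 3 / Γ ≤ Real.logb 2 g * (1 - 1 / Γ) := by
      rwa [hX, div_le_iff₀ hΓ1] at hlX
    have h8 : (Real.logb 2 g + 3) / Γ ≤ Real.logb 2 g - 1 := by
      rw [add_div]
      have : Real.logb 2 g * (1 - 1 / Γ) = Real.logb 2 g - Real.logb 2 g / Γ := by ring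
      linarith
    rw [mul_div_assoc] at h6
    have := mul_le_mul_of_nonneg_left h8 ht'.le
    linarith
  rw [one_div, inv_pow, ← div_eq_mul_inv, div_le_iff₀ (by positivity)]
  rw [Real.logb_le_iff_le_rpow (by norm_num) hL0] at hL
  refine hL.trans (le_of_eq ?_)
  rw [Real.rpow_sub (by norm_num), mul_comm (t : ℝ), Real.rpow_mul (by norm_num),
    Real.rpow_logb (by norm_num) (by norm_num) hg0, Real.rpow_natCast, Real.rpow_natCast, one_div,
    inv_pow, div_eq_inv_mul]

/-- This is where `t = ω(log λ)` is used. -/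
theorem Suitable.negligible_half_pow (hD : D.Suitable) :
    Negligible fun l => (1 / 2 : ℝ) ^ D.t l := by
  intro c
  have hlog : 0 < Real.log 2 := Real.log_pos (by norm_num)
  filter_upwards [hD.t_large.bound (show 0 < Real.log 2 / (c + 1) by positivity),
    eventually_gt_atTop 1] with l h1 h2
  have hl : (0 : ℝ) < l := by exact_mod_cast (zero_lt_one.trans h2)
  rw [abs_of_nonneg (by positivity), one_div, inv_pow]
  refine inv_anti₀ (by positivity) ?_
  rw [← Real.log_le_log_iff (by positivity) (by positivity), Real.log_pow, Real.log_pow]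
  rw [Real.norm_natCast, Real.norm_of_nonneg (Real.log_nonneg (by exact_mod_cast h2.le)),
    div_mul_eq_mul_div, le_div_iff₀ (by positivity)] at h1
  have h3 : 0 ≤ Real.log l := Real.log_nonneg (by exact_mod_cast h2.le)
  nlinarith

end DenseSparseFamily

/-! ### Matrices as lists of rows -/

/-- The bit that represents an element of `𝔽₂`. -/
def bit (z : ZMod 2) : Bool := decide (z ≠ 0)

theorem bit_add : ∀ a b : ZMod 2, bit (a + b) = (bit a ^^ bit b) := by decide

theorem bit_mul : ∀ a b : ZMod 2, bit (a * b) = (bit a && bit b) := by decide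

theorem bit_inj : ∀ a b : ZMod 2, bit a = bit b → a = b := by decide

theorem bit_ite : ∀ b : Bool, bit (if b = true then 1 else 0) = b := by decide

theorem bit_sum {n : ℕ} (f : Fin n → ZMod 2) (g : ℕ → Bool) (h : ∀ i : Fin n, bit (f i) = g i) :
    bit (∑ i, f i) = xorSum n g := by
  induction n with
  | zero => simp [bit]
  | succ n ih =>
    rw [Fin.sum_univ_castSucc, bit_add, xorSum_succ, h (Fin.last n)]
    congr 1
    exact ih (fun i => f i.castSucc) fun i => h i.castSucc

/-- The list of the rows of a matrix. -/
def matRows {a c : ℕ} (M : Matrix (Fin a) (Fin c) (ZMod 2)) : List (List Bool) :=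
  List.ofFn fun i => List.ofFn fun j => bit (M i j)

theorem ofMatrix_eq_enc {a c : ℕ} (M : Matrix (Fin a) (Fin c) (ZMod 2)) :
    Val.ofMatrix M = PCode.enc (matRows M) := by
  rw [Val.ofMatrix, matRows, enc_list, List.map_ofFn]
  congr 2
  funext i
  exact ofBits_eq_enc _

theorem length_matRows {a c : ℕ} (M : Matrix (Fin a) (Fin c) (ZMod 2)) : (matRows M).length = a := by
  simp [matRows]

/-- An entry of a matrix given by its rows. -/
def entry (X : List (List Bool)) (i j : ℕ) : Bool := (X.getD i []).getD j false

theorem entry_matRows {a c : ℕ} (M : Matrix (Fin a) (Fin c) (ZMod 2)) (i : Fin a) (j : Fin c) :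
    entry (matRows M) i j = bit (M i j) := by
  simp [entry, matRows, List.getD_eq_getElem?_getD]

/-- The rows of a matrix given by its entries. -/
def mkRows (a c : ℕ) (f : ℕ → ℕ → Bool) : List (List Bool) :=
  (List.range a).map fun i => (List.range c).map fun j => f i j

theorem matRows_eq {a c : ℕ} {M : Matrix (Fin a) (Fin c) (ZMod 2)} {f : ℕ → ℕ → Bool}
    (h : ∀ i j, bit (M i j) = f i j) : matRows M = mkRows a c f := by
  simp only [matRows, mkRows, h, List.ofFn_eq_map, ← List.map_coe_finRange_eq_range, List.map_map]
  rfl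

/-- Product of an `a × b` and a `b × c` matrix. -/
def mulRows (a b c : ℕ) (X Y : List (List Bool)) : List (List Bool) :=
  mkRows a c fun i j => xorSum b fun k => entry X i k && entry Y k j

/-- Sum of two `a × c` matrices. -/
def addRows (a c : ℕ) (X Y : List (List Bool)) : List (List Bool) :=
  mkRows a c fun i j => entry X i j ^^ entry Y i j

theorem matRows_mul {a b c : ℕ} (M : Matrix (Fin a) (Fin b) (ZMod 2))
    (N : Matrix (Fin b) (Fin c) (ZMod 2)) :
    matRows (M * N) = mulRows a b c (matRows M) (matRows N) := by
  refine matRows_eq fun i j => ?_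
  rw [Matrix.mul_apply]
  exact bit_sum _ _ fun k => by rw [bit_mul, entry_matRows, entry_matRows]

theorem matRows_add {a c : ℕ} (M N : Matrix (Fin a) (Fin c) (ZMod 2)) :
    matRows (M + N) = addRows a c (matRows M) (matRows N) := by
  refine matRows_eq fun i j => ?_
  rw [Matrix.add_apply, bit_add, entry_matRows, entry_matRows]

/-- The matrix whose entries are listed row by row. -/
def matOf (a c : ℕ) (u : List Bool) : Matrix (Fin a) (Fin c) (ZMod 2) :=
  fun i j => if u.getD (i * c + j) false = true then 1 else 0

theorem matRows_matOf (a c : ℕ) (u : List Bool) :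
    matRows (matOf a c u) = mkRows a c fun i j => u.getD (i * c + j) false :=
  matRows_eq fun _ _ => bit_ite _

/-- Bits are the elements of `𝔽₂`. -/
def boolEquiv : Bool ≃ ZMod 2 where
  toFun b := if b = true then 1 else 0
  invFun := bit
  left_inv := by decide
  right_inv := by decide

/-- Uniformly random matrices come from uniformly random bits. -/
theorem unifE_matrix (a c : ℕ) (f : Matrix (Fin a) (Fin c) (ZMod 2) → ℝ) :
    unifE f = avg (a * c) fun u => f (matOf a c u) := by
  let e : (Fin (a * c) → Bool) ≃ Matrix (Fin a) (Fin c) (ZMod 2) :=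
    (Equiv.arrowCongr finProdFinEquiv.symm boolEquiv).trans (Equiv.curry (Fin a) (Fin c) (ZMod 2))
  rw [← unifE_equiv e f]
  refine unifE_congr fun z => congrArg f ?_
  ext i j
  have h : i.val * c + j.val = (finProdFinEquiv (i, j)).val := by
    simp [finProdFinEquiv, Nat.mul_comm, Nat.add_comm]
  simp only [matOf]
  rw [h, List.getD_eq_getElem _ _ (by rw [List.length_ofFn]; exact Fin.is_lt _), List.getElem_ofFn]
  rfl

section PF
variable {α : Type} [PCode α]

@[fun_prop] theorem PF.dot {m : α → ℕ} {v : α → List Bool} {x : α → ℕ → Bool} (hm : PF m) (hv : PF v)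
    (hx : PF fun p : α × ℕ => x p.1 p.2) : PF fun a => dot (m a) (v a) (x a) := by
  unfold HamLearn.dot
  exact PF.xorSum hm (by fun_prop)

@[fun_prop] theorem PF.mulRows {a b c : α → ℕ} {X Y : α → List (List Bool)} (ha : PF a) (hb : PF b)
    (hc : PF c) (hX : PF X) (hY : PF Y) : PF fun s => mulRows (a s) (b s) (c s) (X s) (Y s) := by
  have h : PF fun p : (α × ℕ) × ℕ => HamLearn.xorSum (b p.1.1) fun k =>
      entry (X p.1.1) p.1.2 k && entry (Y p.1.1) k p.2 := by
    unfold entry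
    exact PF.xorSum (by fun_prop) (by fun_prop)
  unfold HamLearn.mulRows mkRows
  fun_prop

@[fun_prop] theorem PF.addRows {a c : α → ℕ} {X Y : α → List (List Bool)} (ha : PF a)
    (hc : PF c) (hX : PF X) (hY : PF Y) : PF fun s => addRows (a s) (c s) (X s) (Y s) := by
  unfold HamLearn.addRows mkRows entry
  fun_prop

@[fun_prop] theorem PF.blockSize {m t : α → ℕ} (hm : PF m) (ht : PF t) :
    PF fun a => blockSize (m a) (t a) := by
  have h : PF fun a => (HamLearn.randIdx (m a / t a) ((List.range (m a)).map fun _ => false)).1 := by fun_prop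
  exact h.congr fun v => congrArg PCode.enc (blockSize_eq _ (by simp)).symm

@[fun_prop] theorem PF.blockString {m t : α → ℕ} {u : α → List Bool} {j : α → ℕ} (hm : PF m)
    (ht : PF t) (hu : PF u) (hj : PF j) : PF fun a => blockString (m a) (t a) (u a) (j a) := by
  unfold HamLearn.blockString blockIdx
  fun_prop

end PF

/-! ### The rows of an instance -/

/-- The vector over `𝔽₂` of a bit string. -/
def toVec (m : ℕ) (x : ℕ → Bool) : Fin m → ZMod 2 := fun j => if x j = true then 1 else 0

theorem toVec_inj {m : ℕ} {x y : ℕ → Bool} (h : toVec m x = toVec m y) : ∀ j < m, x j = y j := by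
  intro j hj
  have := congrArg bit (congrFun h ⟨j, hj⟩)
  simpa only [toVec, bit_ite] using this

theorem dot_ofFn {m : ℕ} (v : Fin m → ZMod 2) (x : ℕ → Bool) :
    dot m (List.ofFn fun j => bit (v j)) x = bit (∑ j, v j * toVec m x j) := by
  refine (bit_sum _ _ fun j => ?_).symm
  rw [bit_mul, toVec, bit_ite]
  simp [List.getD_eq_getElem?_getD]

/-- The rows that state the values of the inner products of `x` with given vectors. -/
def sysRows (m : ℕ) (L : List (List Bool)) (x : ℕ → Bool) : List Row :=
  L.map fun v => (dot m v x, true, false, v)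

/-- The rows that demand exactly one `1` in each block; the columns that are left over belong to the
last block. -/
def blockRows (m t : ℕ) : List Row :=
  (List.range t).map fun κ => (true, true, true,
    (List.range m).map fun j => decide (min (j / blockSize m t) (t - 1) = κ))

/-- All rows of an instance: a row whose final state is the hidden bit comes last. -/
def instRows (m t : ℕ) (Y : List Row) (r : List Bool) (c : Bool) : List Row :=
  Y ++ (blockRows m t ++ [(c, false, false, r)])

theorem length_instRows (m t : ℕ) (Y : List Row) (r : List Bool) (c : Bool) :
    (instRows m t Y r c).length = Y.length + t + 1 := by
  simp [instRows, blockRows, add_assoc]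

theorem instRows_ne_nil (m t : ℕ) (Y : List Row) (r : List Bool) (c : Bool) :
    instRows m t Y r c ≠ [] := by
  simp [instRows]

theorem instRows_last (m t : ℕ) (Y : List Row) (r : List Bool) (c : Bool) :
    (instRows m t Y r c).getD ((instRows m t Y r c).length - 1) nullRow = (c, false, false, r) := by
  rw [instRows, ← List.append_assoc, List.getD_append_right _ _ _ _ (by simp)]
  simp

@[fun_prop] theorem PF.sysRows {α : Type} [PCode α] {m : α → ℕ} {L : α → List (List Bool)}
    {x : α → ℕ → Bool} (hm : PF m) (hL : PF L) (hx : PF fun p : α × ℕ => x p.1 p.2) :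
    PF fun a => sysRows (m a) (L a) (x a) := by
  have h : PF fun p : α × List Bool => HamLearn.dot (m p.1) p.2 (x p.1) :=
    PF.dot (by fun_prop) (by fun_prop) (PF.comp (g := fun p : α × ℕ => x p.1 p.2)
      (f := fun p : (α × List Bool) × ℕ => (p.1.1, p.2)) hx (by fun_prop))
  unfold HamLearn.sysRows
  fun_prop

theorem PF.min {α : Type} [PCode α] {f g : α → ℕ} (hf : PF f) (hg : PF g) :
    PF fun a => Min.min (f a) (g a) := by
  have h : PF fun a => f a - (f a - g a) := by fun_prop
  exact h.congr fun v => congrArg PCode.enc (by simp only; omega)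

@[fun_prop] theorem PF.instRows {α : Type} [PCode α] {m t : α → ℕ} {Y : α → List Row}
    {r : α → List Bool} {c : α → Bool} (hm : PF m) (ht : PF t) (hY : PF Y) (hr : PF r) (hc : PF c) :
    PF fun a => instRows (m a) (t a) (Y a) (r a) (c a) := by
  have h : PF fun p : (α × ℕ) × ℕ => Min.min (p.2 / HamLearn.blockSize (m p.1.1) (t p.1.1)) (t p.1.1 - 1) :=
    PF.min (by fun_prop) (by fun_prop)
  unfold HamLearn.instRows blockRows
  fun_prop

theorem sysRow_ok {m : ℕ} {s : Bool} {v : List Bool} {y : ℕ → Bool} :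
    Row.Ok m (s, true, false, v) y ↔ s = dot m v y := by
  have : Row.state (s, true, false, v) y m = (s ^^ dot m v y) := rfl
  simp [Row.Ok, this]

/-- A string that satisfies the rows of a matrix has the same image as `x`. -/
theorem mulVec_eq_of_ok {h m : ℕ} {M : Matrix (Fin h) (Fin m) (ZMod 2)} {x y : ℕ → Bool}
    (hy : ∀ row ∈ sysRows m (matRows M) x, Row.Ok m row y) :
    M.mulVec (toVec m x) = M.mulVec (toVec m y) := by
  funext i
  have h1 := hy (dot m (List.ofFn fun j => bit (M i j)) x, true, false, List.ofFn fun j => bit (M i j))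
    (List.mem_map.2 ⟨_, by simp [matRows], rfl⟩)
  rw [sysRow_ok, dot_ofFn, dot_ofFn] at h1
  exact bit_inj _ _ h1

theorem sysRows_ok (m : ℕ) (L : List (List Bool)) (x : ℕ → Bool) :
    ∀ row ∈ sysRows m L x, Row.Ok m row x := by
  intro row hrow
  obtain ⟨v, -, rfl⟩ := List.mem_map.1 hrow
  exact sysRow_ok.2 rfl

/-- The block of column `j`. -/
def blockOf (m t j : ℕ) : ℕ := min (j / blockSize m t) (t - 1)

theorem blockRow_getD {m t κ j : ℕ} (hj : j < m) :
    ((List.range m).map fun j => decide (blockOf m t j = κ)).getD j false =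
      decide (blockOf m t j = κ) := by
  simp [List.getD_eq_getElem?_getD, hj]

theorem state_blockRow {m t κ : ℕ} (y : ℕ → Bool) {j : ℕ} (hj : j ≤ m) :
    Row.state (true, true, true, (List.range m).map fun j => decide (blockOf m t j = κ)) y j =
      !xorSum j fun k => decide (blockOf m t k = κ) && y k := by
  rw [Row.state, Bool.true_xor]
  congr 1
  exact xorSum_congr fun i hi => by rw [blockRow_getD (by omega)]

/-- A string that satisfies an exclusive row has at most one `1` on it. -/
theorem card_le_one_of_ok {m t κ : ℕ} {y : ℕ → Bool}
    (hy : Row.Ok m (true, true, true, (List.range m).map fun j => decide (blockOf m t j = κ)) y) :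
    ((Finset.range m).filter fun j => blockOf m t j = κ ∧ y j = true).card ≤ 1 := by
  have key : ∀ j ≤ m,
      (((Finset.range j).filter fun j => blockOf m t j = κ ∧ y j = true).card = 0 ∧
        (xorSum j fun k => decide (blockOf m t k = κ) && y k) = false) ∨
      (((Finset.range j).filter fun j => blockOf m t j = κ ∧ y j = true).card = 1 ∧
        (xorSum j fun k => decide (blockOf m t k = κ) && y k) = true) := by
    intro j
    induction j with
    | zero => intro _; left; simp
    | succ j ih =>
      intro hj
      rw [Finset.range_add_one, Finset.filter_insert, xorSum_succ]
      by_cases h1 : blockOf m t j = κ ∧ y j = true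
      · have h2 := hy.2 rfl j (by omega) (by rw [blockRow_getD (by omega)]; simpa using h1.1) h1.2
        rw [state_blockRow y (by omega)] at h2
        rw [if_pos h1, Finset.card_insert_of_notMem (by simp)]
        right
        rcases ih (by omega) with h3 | h3
        · rw [h3.1, h3.2]; simp [h1]
        · rw [h3.2] at h2; simp at h2
      · have h2 : (decide (blockOf m t j = κ) && y j) = false := by
          by_contra h3
          refine h1 ?_
          simpa using h3
        rw [if_neg h1, h2, Bool.xor_false]
        exact ih (by omega)
  rcases key m le_rfl with h | h <;> omega

/-- Strings that satisfy the block rows are sparse. -/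
theorem sparse_of_ok {m t : ℕ} (ht : 0 < t) {y : ℕ → Bool}
    (hy : ∀ row ∈ blockRows m t, Row.Ok m row y) : hammingNorm (toVec m y) ≤ t := by
  have h1 : hammingNorm (toVec m y) = ((Finset.range m).filter fun j => y j = true).card := by
    rw [hammingNorm]
    refine Finset.card_bij (fun j _ => j.val) ?_ ?_ ?_
    · intro j hj
      have : bit (toVec m y j) = true := by simpa [bit] using hj
      rw [toVec, bit_ite] at this
      simp [this]
    · intro a _ b _ hab
      exact Fin.ext hab
    · intro j hj
      rw [Finset.mem_filter, Finset.mem_range] at hj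
      exact ⟨⟨j, hj.1⟩, by simp [toVec, hj.2], rfl⟩
  have h2 : ((Finset.range m).filter fun j => y j = true) ⊆ (Finset.range t).biUnion fun κ =>
      (Finset.range m).filter fun j => blockOf m t j = κ ∧ y j = true := by
    intro j hj
    rw [Finset.mem_filter] at hj
    rw [Finset.mem_biUnion]
    refine ⟨blockOf m t j, Finset.mem_range.2 ?_, ?_⟩
    · have : blockOf m t j ≤ t - 1 := min_le_right _ _
      omega
    · rw [Finset.mem_filter]
      exact ⟨hj.1, rfl, hj.2⟩
  rw [h1]
  refine (Finset.card_le_card h2).trans (Finset.card_biUnion_le.trans ?_)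
  refine (Finset.sum_le_sum (g := fun _ => 1) fun κ hκ => ?_).trans (by simp)
  exact card_le_one_of_ok (hy _ (List.mem_map.2 ⟨κ, List.mem_range.2 (Finset.mem_range.1 hκ), rfl⟩))

theorem xorSum_single (p n : ℕ) : (xorSum n fun k => decide (k = p)) = decide (p < n) := by
  induction n with
  | zero => simp
  | succ n ih =>
    rw [xorSum_succ, ih]
    rcases lt_trichotomy p n with h | h | h
    · simp [h, show p < n + 1 by omega, show n ≠ p by omega]
    · simp [h]
    · simp [show ¬ p < n by omega, show ¬ p < n + 1 by omega, show n ≠ p by omega]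

theorem blockRows_ok {m t : ℕ} (h : 0 < m / t) {u : List Bool} (hu : u.length = t * m) :
    ∀ row ∈ blockRows m t, Row.Ok m row (blockString m t u) := by
  intro row hrow
  obtain ⟨κ, hκ, rfl⟩ := List.mem_map.1 hrow
  rw [List.mem_range] at hκ
  set p := κ * blockSize m t + blockIdx m t u κ with hp
  have hpm : p < m := block_bound (blockSize_le h) hκ (blockIdx_lt hu hκ)
  have hblock : ∀ κ' < t, blockOf m t (κ' * blockSize m t + blockIdx m t u κ') = κ' := by
    intro κ' hκ'
    have hlt := blockIdx_lt hu hκ'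
    rw [blockOf, Nat.mul_comm, Nat.mul_add_div (by omega), Nat.div_eq_of_lt hlt]
    omega
  have key : ∀ k, (decide (blockOf m t k = κ) && blockString m t u k) = decide (k = p) := by
    intro k
    rw [Bool.eq_iff_iff, Bool.and_eq_true, decide_eq_true_eq, decide_eq_true_eq, blockString_iff]
    constructor
    · rintro ⟨h1, κ', hκ', rfl⟩
      rw [hblock κ' hκ'] at h1
      subst h1
      rfl
    · rintro rfl
      exact ⟨hblock κ hκ, κ, hκ, rfl⟩
  have hst : ∀ j ≤ m, Row.state (true, true, true,
      (List.range m).map fun j => decide (blockOf m t j = κ)) (blockString m t u) j =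
        !decide (p < j) := by
    intro j hj
    rw [state_blockRow _ hj, xorSum_congr fun k _ => key k, xorSum_single]
  refine ⟨fun _ => ?_, fun _ j hj hv hx => ?_⟩
  · refine (hst m le_rfl).trans ?_
    simp [hpm]
  · refine (hst j hj.le).trans ?_
    have h1 : decide (blockOf m t j = κ) = true := by
      rw [← blockRow_getD hj]; exact hv
    have h2 := key j
    rw [h1, hx] at h2
    have h3 : j = p := by simpa using h2.symm
    simp [h3]

theorem freeRow_ok (m : ℕ) (c : Bool) (r : List Bool) (y : ℕ → Bool) :
    Row.Ok m (c, false, false, r) y := ⟨by simp, by simp⟩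

theorem instRows_ok {m t : ℕ} (h : 0 < m / t) {u : List Bool} (hu : u.length = t * m)
    (L : List (List Bool)) (r : List Bool) (c : Bool) :
    ∀ row ∈ instRows m t (sysRows m L (blockString m t u)) r c, Row.Ok m row (blockString m t u) := by
  intro row hrow
  simp only [instRows, List.mem_append, List.mem_singleton] at hrow
  rcases hrow with hrow | hrow | rfl
  · exact sysRows_ok m L _ row hrow
  · exact blockRows_ok h hu row hrow
  · exact freeRow_ok m c r _

/-- Compressed sensing makes the solution of an instance unique. -/
theorem instRows_unique {h m t w : ℕ} (ht : 0 < t) {A E C : Matrix (Fin h) (Fin m) (ZMod 2)}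
    {S : Matrix (Fin h) (Fin h) (ZMod 2)} (hE : SparseNoise t w E) (hC : CompressedSensing t w C)
    {x : ℕ → Bool} (hx : ∀ row ∈ blockRows m t, Row.Ok m row x) {r : List Bool} {c : Bool}
    {y : ℕ → Bool}
    (hy : ∀ row ∈ instRows m t (sysRows m (matRows A ++ matRows (S * A + E + C)) x) r c,
      Row.Ok m row y) : ∀ j < m, y j = x j := by
  simp only [instRows, sysRows, List.map_append, List.mem_append] at hy
  have h1 : A.mulVec (toVec m x) = A.mulVec (toVec m y) :=
    mulVec_eq_of_ok fun row hrow => hy row (Or.inl (Or.inl hrow))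
  have h2 : (S * A + E + C).mulVec (toVec m x) = (S * A + E + C).mulVec (toVec m y) :=
    mulVec_eq_of_ok fun row hrow => hy row (Or.inl (Or.inr hrow))
  have h3 := sparse_of_ok ht hx
  have h4 := sparse_of_ok ht fun row hrow => hy row (Or.inr (Or.inl hrow))
  have h5 : C.mulVec (toVec m x) + E.mulVec (toVec m x) =
      C.mulVec (toVec m y) + E.mulVec (toVec m y) := by
    simp only [Matrix.add_mulVec, ← Matrix.mulVec_mulVec, h1, add_assoc, add_right_inj] at h2
    rw [add_comm, h2, add_comm]
  exact toVec_inj (hC _ _ _ _ h4 h3 (hE _ h4) (hE _ h3) h5.symm)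

/-! ### The image of the sparse vectors without compressed sensing -/

theorem hammingNorm_mulVec_le {a c k t : ℕ} {K : Matrix (Fin a) (Fin c) (ZMod 2)}
    (hK : ColumnSparse k K) {v : Fin c → ZMod 2} (hv : hammingNorm v ≤ t) :
    hammingNorm (K.mulVec v) ≤ k * t := by
  classical
  have hsub : (Finset.univ.filter fun i => K.mulVec v i ≠ 0) ⊆
      (Finset.univ.filter fun j => v j ≠ 0).biUnion fun j => Finset.univ.filter fun i => K i j ≠ 0 := by
    intro i hi
    rw [Finset.mem_filter] at hi
    have hi' : ∑ j, K i j * v j ≠ 0 := hi.2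
    obtain ⟨j, -, hj⟩ := Finset.exists_ne_zero_of_sum_ne_zero hi'
    rw [Finset.mem_biUnion]
    exact ⟨j, by simpa using right_ne_zero_of_mul hj, by simpa using left_ne_zero_of_mul hj⟩
  refine (Finset.card_le_card hsub).trans (Finset.card_biUnion_le.trans ?_)
  refine (Finset.sum_le_sum (g := fun _ => k) fun j _ => hK j).trans ?_
  rw [Finset.sum_const, smul_eq_mul, mul_comm]
  exact Nat.mul_le_mul_left k hv

open Classical in
/-- Without the compressed sensing matrix, the rows of an instance are determined by two vectors that
are sparse. -/
theorem exists_image_sysRows {h d m t k w : ℕ} {T : Matrix (Fin h) (Fin d) (ZMod 2)}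
    {S : Matrix (Fin h) (Fin h) (ZMod 2)} {K : Matrix (Fin d) (Fin m) (ZMod 2)}
    {E : Matrix (Fin h) (Fin m) (ZMod 2)} (hK : ColumnSparse k K) (hE : SparseNoise t w E) :
    ∃ Y : Finset (List Row), Y.card ≤ ballCard d (k * t) * ballCard h w ∧
      ∀ x : ℕ → Bool, hammingNorm (toVec m x) ≤ t →
        sysRows m (matRows (T * K) ++ matRows (S * (T * K) + E)) x ∈ Y := by
  let row (M : Matrix (Fin h) (Fin m) (ZMod 2)) (y : Fin h → ZMod 2) : List Row :=
    List.ofFn fun i => (bit (y i), true, false, List.ofFn fun j => bit (M i j))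
  have hrow : ∀ (M : Matrix (Fin h) (Fin m) (ZMod 2)) x,
      sysRows m (matRows M) x = row M (M.mulVec (toVec m x)) := by
    intro M x
    simp only [sysRows, matRows, List.map_ofFn, row]
    congr 1
    funext i
    simp only [Function.comp_apply, dot_ofFn]
    rfl
  let φ (p : (Fin d → ZMod 2) × (Fin h → ZMod 2)) : List Row :=
    row (T * K) (T.mulVec p.1) ++ row (S * (T * K) + E) (S.mulVec (T.mulVec p.1) + p.2)
  refine ⟨((Finset.univ.filter fun v => hammingNorm v ≤ k * t) ×ˢ
    (Finset.univ.filter fun v => hammingNorm v ≤ w)).image φ, ?_, fun x hx => ?_⟩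
  · refine Finset.card_image_le.trans ?_
    rw [Finset.card_product]
    exact Nat.mul_le_mul (card_sparse_le _ _) (card_sparse_le _ _)
  · rw [Finset.mem_image]
    refine ⟨(K.mulVec (toVec m x), E.mulVec (toVec m x)), ?_, ?_⟩
    · simp only [Finset.mem_product, Finset.mem_filter, Finset.mem_univ, true_and]
      exact ⟨hammingNorm_mulVec_le hK hx, hE _ hx⟩
    · simp only [φ]
      rw [sysRows, List.map_append]
      refine congrArg₂ _ ?_ ?_
      · refine Eq.trans ?_ (hrow _ x).symm
        rw [Matrix.mulVec_mulVec]
      · refine Eq.trans ?_ (hrow _ x).symm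
        rw [Matrix.add_mulVec, Matrix.mulVec_mulVec, Matrix.mulVec_mulVec, Matrix.mul_assoc]

/-! ### Splitting random bits -/

/-- Consecutive pieces of a list, of the given lengths. -/
def chunks : List ℕ → List Bool → List (List Bool)
  | [], _ => []
  | a :: L, u => u.take a :: chunks L (u.drop a)

/-- The average over independent random pieces of the given lengths. -/
noncomputable def avgs : List ℕ → (List (List Bool) → ℝ) → ℝ
  | [], f => f []
  | a :: L, f => avg a fun v => avgs L fun w => f (v :: w)

theorem avg_chunks (L : List ℕ) (N : ℕ) (h : L.sum ≤ N) (f : List (List Bool) → ℝ) :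
    avg N (fun u => f (chunks L u)) = avgs L f := by
  induction L generalizing N f with
  | nil => exact avg_const N (f [])
  | cons a L ih =>
    rw [List.sum_cons] at h
    obtain ⟨M, rfl⟩ := Nat.exists_eq_add_of_le (show a ≤ N by omega)
    rw [avg_add]
    refine avg_congr fun u hu => ?_
    rw [← ih M (by omega)]
    refine avg_congr fun v _ => ?_
    rw [chunks, List.take_left' hu, List.drop_left' hu]

/-! ### The family of Hamiltonians -/

theorem EffNat.pf {f : ℕ → ℕ} (hf : EffNat f) : PF f := by
  obtain ⟨g, hg, h⟩ := hf
  have h1 : PF fun n : ℕ => g (PCode.enc n) := PF.comp (PF.of_val hg) PF.enc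
  exact h1.congr fun v => (h _).symm

namespace DenseSparseFamily

section PF
variable {D : DenseSparseFamily} [hD : Fact D.Suitable] {α : Type} [PCode α] {l : α → ℕ}

@[fun_prop] theorem pf_m (hl : PF l) : PF fun a => D.m (l a) := PF.comp hD.out.m_eff.pf hl
@[fun_prop] theorem pf_h (hl : PF l) : PF fun a => D.h (l a) := PF.comp hD.out.h_eff.pf hl
@[fun_prop] theorem pf_d (hl : PF l) : PF fun a => D.d (l a) := PF.comp hD.out.d_eff.pf hl
@[fun_prop] theorem pf_t (hl : PF l) : PF fun a => D.t (l a) := PF.comp hD.out.t_eff.pf hl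

end PF

variable (D : DenseSparseFamily)

/-- The number of scanned rows of an instance. -/
def numRows (l : ℕ) : ℕ := D.h l + D.h l + D.t l + 1

/-- The number of qubits of an instance, before padding. -/
def numQubits (l : ℕ) : ℕ := cell (D.m l) (D.numRows l + 2) 0

/-- The security parameter in use with `n` qubits: the largest one whose instances fit. -/
def param (n : ℕ) : ℕ := lastIndex n fun l => decide (D.numQubits l ≤ n)

/-- An upper bound for the numbers of qubits with security parameter `l`. -/
def qubitBound (l : ℕ) : ℕ := D.numQubits (l + 1) + l + 1

theorem numQubits_param_le {n : ℕ} (hn : D.numQubits 0 ≤ n) : D.numQubits (D.param n) ≤ n := by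
  have := (le_lastIndex (p := fun l => decide (D.numQubits l ≤ n)) (Nat.zero_le n)
    (decide_eq_true hn)).2
  exact of_decide_eq_true this

theorem lt_qubitBound (n : ℕ) : n < D.qubitBound (D.param n) := by
  by_contra h
  rw [qubitBound, not_lt] at h
  have := (le_lastIndex (p := fun l => decide (D.numQubits l ≤ n)) (show D.param n + 1 ≤ n by omega)
    (decide_eq_true (by omega))).1
  change D.param n + 1 ≤ D.param n at this
  omega

/-- The lengths of the random strings for `T`, `S`, `K`, `E`, `C`, the solution and the hash. -/
def lens (l : ℕ) : List ℕ :=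
  [D.h l * D.d l, D.h l * D.h l, D.K.coins.eval l, D.E.coins.eval l, D.C.coins.eval l,
    D.t l * D.m l, D.m l]

/-- The rows of the public matrix `A`. -/
noncomputable def sampleA (l : ℕ) (w : List (List Bool)) : List (List Bool) :=
  mulRows (D.h l) (D.d l) (D.m l)
    (mkRows (D.h l) (D.d l) fun i j => (w.getD 0 []).getD (i * D.d l + j) false)
    (PCode.dec (D.K.gen (.cons (.ofNat l) (PCode.enc (w.getD 2 [])))))

/-- The rows of the public matrix `B`, in the high branch. -/
noncomputable def sampleB (l : ℕ) (w : List (List Bool)) : List (List Bool) :=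
  addRows (D.h l) (D.m l) (addRows (D.h l) (D.m l)
    (mulRows (D.h l) (D.h l) (D.m l)
      (mkRows (D.h l) (D.h l) fun i j => (w.getD 1 []).getD (i * D.h l + j) false)
      (D.sampleA l w))
    (PCode.dec (D.E.gen (.cons (.ofNat l) (PCode.enc (w.getD 3 []))))))
    (PCode.dec (D.C.gen (.cons (.ofNat l) (PCode.enc (w.getD 4 [])))))

/-- The rows of an instance that hides the bit `b`. -/
def rowsOf (l : ℕ) (A B : List (List Bool)) (u r : List Bool) (b : Bool) : List Row :=
  instRows (D.m l) (D.t l) (sysRows (D.m l) (A ++ B) (blockString (D.m l) (D.t l) u)) r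
    (dot (D.m l) r (blockString (D.m l) (D.t l) u) ^^ b)

/-- The random Hamiltonian that hides the bit `b`. -/
noncomputable def ham (n : ℕ) (b : Bool) (u : List Bool) : Ham n :=
  gridHam n (D.m (D.param n)) (D.rowsOf (D.param n)
    (D.sampleA (D.param n) (chunks (D.lens (D.param n)) u))
    (D.sampleB (D.param n) (chunks (D.lens (D.param n)) u))
    ((chunks (D.lens (D.param n)) u).getD 5 []) ((chunks (D.lens (D.param n)) u).getD 6 []) b)

/-- The code of the Hamiltonian of given rows, together with the cut. -/
noncomputable def publicCode (n l : ℕ) (rows : List Row) : Val :=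
  .cons (gridCode n (D.m l) rows) (gridCutCode n (D.m l) (D.numRows l))

/-- The code of the random Hamiltonian that hides the bit `b`, together with the cut. -/
noncomputable def code (n : ℕ) (b : Bool) (u : List Bool) : Val :=
  D.publicCode n (D.param n) (D.rowsOf (D.param n)
    (D.sampleA (D.param n) (chunks (D.lens (D.param n)) u))
    (D.sampleB (D.param n) (chunks (D.lens (D.param n)) u))
    ((chunks (D.lens (D.param n)) u).getD 5 []) ((chunks (D.lens (D.param n)) u).getD 6 []) b)

theorem length_mkRows (a c : ℕ) (f : ℕ → ℕ → Bool) : (mkRows a c f).length = a := by simp [mkRows]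

theorem length_rowsOf {l : ℕ} {A B : List (List Bool)} (hA : A.length = D.h l)
    (hB : B.length = D.h l) (u r : List Bool) (b : Bool) :
    (D.rowsOf l A B u r b).length = D.numRows l := by
  rw [rowsOf, length_instRows, sysRows, List.length_map, List.length_append, hA, hB, numRows]

theorem inputCode_ham {n : ℕ} (hn : D.numQubits 0 ≤ n) (b : Bool) (u : List Bool) :
    inputCode (D.ham n b u) (gridCut n (D.m (D.param n)) (D.numRows (D.param n))) = D.code n b u := by
  rw [inputCode, gridCut_code, ham, gridHam_code, code, publicCode]
  · rw [length_rowsOf]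
    · exact D.numQubits_param_le hn
    · exact length_mkRows _ _ _
    · exact length_mkRows _ _ _
  · exact instRows_ne_nil _ _ _ _ _

/-- The random choices behind the public matrices. -/
abbrev Coins (l : ℕ) : Type :=
  Matrix (Fin (D.h l)) (Fin (D.d l)) (ZMod 2) × Matrix (Fin (D.h l)) (Fin (D.h l)) (ZMod 2) ×
    (Fin (D.K.coins.eval l) → Bool) × (Fin (D.E.coins.eval l) → Bool) ×
    (Fin (D.C.coins.eval l) → Bool)

variable {D}

/-- The public matrix `A`. -/
def publicA {l : ℕ} (ω : D.Coins l) : Matrix (Fin (D.h l)) (Fin (D.m l)) (ZMod 2) :=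
  ω.1 * D.K.sample l ω.2.2.1

/-- The public matrix `B`, in the high or the low branch. -/
def publicB {l : ℕ} (high : Bool) (ω : D.Coins l) : Matrix (Fin (D.h l)) (Fin (D.m l)) (ZMod 2) :=
  ω.2.1 * publicA ω + D.E.sample l ω.2.2.2.1 + (if high then D.C.sample l ω.2.2.2.2 else 0)

theorem dec_gen {rows cols : ℕ → ℕ} (M : MatrixSampler rows cols) (l : ℕ)
    (r : Fin (M.coins.eval l) → Bool) :
    (PCode.dec (M.gen (.cons (.ofNat l) (PCode.enc (List.ofFn r)))) : List (List Bool)) =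
      matRows (M.sample l r) := by
  rw [← ofBits_eq_enc, M.gen_eq, ofMatrix_eq_enc, PCode.dec_enc]

/-- The samplers work with the distributions of the assumption, in the high branch. -/
theorem avgs_lens (l : ℕ)
    (Φ : List (List Bool) → List (List Bool) → List Bool → List Bool → ℝ) :
    avgs (D.lens l) (fun w => Φ (D.sampleA l w) (D.sampleB l w) (w.getD 5 []) (w.getD 6 [])) =
      unifE fun ω : D.Coins l => avg (D.t l * D.m l) fun u => avg (D.m l) fun r =>
        Φ (matRows (publicA ω)) (matRows (publicB true ω)) u r := by
  rw [unifE_prod, unifE_matrix]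
  simp only [lens, avgs]
  refine avg_congr fun T hT => ?_
  rw [unifE_prod, unifE_matrix]
  refine avg_congr fun S hS => ?_
  rw [unifE_prod]
  refine unifE_congr fun rK => ?_
  rw [unifE_prod]
  refine unifE_congr fun rE => ?_
  refine unifE_congr fun rC => ?_
  refine avg_congr fun u _ => ?_
  refine avg_congr fun r _ => ?_
  simp only [sampleB, sampleA, List.getD_cons_zero, List.getD_cons_succ, dec_gen, publicA, publicB,
    if_true, matRows_add, matRows_mul, matRows_matOf]

section PF
variable [hD : Fact D.Suitable] {α : Type} [PCode α]

@[fun_prop] theorem pf_numRows {l : α → ℕ} (hl : PF l) : PF fun a => D.numRows (l a) := by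
  unfold numRows
  fun_prop

@[fun_prop] theorem pf_numQubits {l : α → ℕ} (hl : PF l) : PF fun a => D.numQubits (l a) := by
  unfold numQubits cell
  fun_prop

@[fun_prop] theorem pf_param {n : α → ℕ} (hn : PF n) : PF fun a => D.param (n a) := by
  unfold param
  exact PF.lastIndex hn (by fun_prop)

@[fun_prop] theorem pf_qubitBound {l : α → ℕ} (hl : PF l) : PF fun a => D.qubitBound (l a) := by
  unfold qubitBound
  fun_prop

@[fun_prop] theorem pf_rowsOf {l : α → ℕ} {A B : α → List (List Bool)} {u r : α → List Bool}
    {b : α → Bool} (hl : PF l) (hA : PF A) (hB : PF B) (hu : PF u) (hr : PF r) (hb : PF b) :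
    PF fun a => D.rowsOf (l a) (A a) (B a) (u a) (r a) (b a) := by
  unfold rowsOf
  fun_prop

theorem pf_gen {rows cols : ℕ → ℕ} (M : MatrixSampler rows cols) {l : α → ℕ} {u : α → List Bool}
    (hl : PF l) (hu : PF u) :
    PF fun a => (PCode.dec (M.gen (.cons (.ofNat (l a)) (PCode.enc (u a)))) : List (List Bool)) :=
  PF.dec' (PF.comp (PF.of_val M.gen_poly) (PF.valCons (PF.enc' hl) (PF.enc' hu)))

@[fun_prop] theorem pf_sampleA {l : α → ℕ} {w : α → List (List Bool)} (hl : PF l) (hw : PF w) :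
    PF fun a => D.sampleA (l a) (w a) := by
  have h := pf_gen D.K (l := l) (u := fun a => (w a).getD 2 []) hl (by fun_prop)
  unfold sampleA mkRows
  exact PF.mulRows (by fun_prop) (by fun_prop) (by fun_prop) (by fun_prop) h

@[fun_prop] theorem pf_sampleB {l : α → ℕ} {w : α → List (List Bool)} (hl : PF l) (hw : PF w) :
    PF fun a => D.sampleB (l a) (w a) := by
  have h := pf_gen D.E (l := l) (u := fun a => (w a).getD 3 []) hl (by fun_prop)
  have h' := pf_gen D.C (l := l) (u := fun a => (w a).getD 4 []) hl (by fun_prop)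
  unfold sampleB mkRows
  exact PF.addRows (by fun_prop) (by fun_prop)
    (PF.addRows (by fun_prop) (by fun_prop) (by fun_prop) h) h'

theorem pf_publicCode {n l : α → ℕ} {rows : α → List Row} (hn : PF n) (hl : PF l) (hr : PF rows) :
    PF fun a => D.publicCode (n a) (l a) (rows a) := by
  unfold publicCode
  exact PF.valCons (by fun_prop) (by fun_prop)

@[fun_prop] theorem pf_chunks_lens {l : α → ℕ} {u : α → List Bool} (hl : PF l) (hu : PF u) :
    PF fun a => chunks (D.lens (l a)) (u a) := by
  simp only [lens, chunks]
  fun_prop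

theorem pf_code (b : Bool) {n : α → ℕ} {u : α → List Bool} (hn : PF n) (hu : PF u) :
    PF fun a => D.code (n a) b (u a) := by
  unfold code
  exact pf_publicCode (by fun_prop) (by fun_prop) (by fun_prop)

end PF
end DenseSparseFamily

/-! ### The samplable family -/

namespace DenseSparseFamily
variable {D : DenseSparseFamily}

theorem exists_coinPoly (hD : D.Suitable) :
    ∃ p : Polynomial ℕ, ∀ n, (D.lens (D.param n)).sum ≤ p.eval n := by
  have : Fact D.Suitable := ⟨hD⟩
  have h : PF fun n => (D.lens (D.param n)).sum := by
    simp only [lens, List.sum_cons, List.sum_nil]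
    fun_prop
  obtain ⟨p, hp⟩ := h.size_le
  refine ⟨p.comp (2 * Polynomial.X + 1), fun n => ?_⟩
  have := hp n
  rw [size_enc_nat, size_enc_nat] at this
  simp only [Polynomial.eval_comp, Polynomial.eval_add, Polynomial.eval_mul, Polynomial.eval_ofNat,
    Polynomial.eval_X, Polynomial.eval_one]
  omega

/-- A polynomial bound on the number of random bits. -/
noncomputable def coinPoly (hD : D.Suitable) : Polynomial ℕ := (exists_coinPoly hD).choose

theorem sum_lens_le (hD : D.Suitable) (n : ℕ) :
    (D.lens (D.param n)).sum ≤ (coinPoly hD).eval n := (exists_coinPoly hD).choose_spec n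

/-- The samplable family of pairs of Hamiltonians; both Hamiltonians of a pair belong to the same
instance, with compressed sensing, and hide different bits. -/
noncomputable def family (hD : D.Suitable) : HamFamily where
  n₀ := D.numQubits 0
  coins := coinPoly hD
  low n r := D.ham n false (List.ofFn r)
  high n r := D.ham n true (List.ofFn r)
  cut n _ := gridCut n (D.m (D.param n)) (D.numRows (D.param n))
  gen v := (fun p : ℕ × List Bool => Val.cons (D.code p.1 false p.2).hd
    (.cons (D.code p.1 true p.2).hd (D.code p.1 true p.2).tl)) (PCode.dec v)
  gen_poly := by
    have : Fact D.Suitable := ⟨hD⟩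
    have h : PF fun p : ℕ × List Bool => Val.cons (D.code p.1 false p.2).hd
        (.cons (D.code p.1 true p.2).hd (D.code p.1 true p.2).tl) :=
      PF.valCons (PF.hd (pf_code _ (by fun_prop) (by fun_prop)))
        (PF.valCons (PF.hd (pf_code _ (by fun_prop) (by fun_prop)))
          (PF.tl (pf_code _ (by fun_prop) (by fun_prop))))
    exact h
  gen_eq n hn r := by
    have h : Val.cons (.ofNat n) (.ofBits r) = PCode.enc (n, List.ofFn r) := by
      rw [ofBits_eq_enc]; rfl
    rw [h]
    simp only [PCode.dec_enc, ← D.inputCode_ham hn]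
    rfl

/-- Averages over the family, in terms of the distributions of the assumption. -/
theorem avg_code (hD : D.Suitable) (n : ℕ) (b : Bool) (Ψ : Val → ℝ) :
    avg ((coinPoly hD).eval n) (fun u => Ψ (D.code n b u)) =
      unifE fun ω : D.Coins (D.param n) =>
        avg (D.t (D.param n) * D.m (D.param n)) fun u => avg (D.m (D.param n)) fun r =>
          Ψ (D.publicCode n (D.param n)
            (D.rowsOf (D.param n) (matRows (publicA ω)) (matRows (publicB true ω)) u r b)) := by
  have h1 := avg_chunks (D.lens (D.param n)) _ (sum_lens_le hD n) fun w =>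
    Ψ (D.publicCode n (D.param n) (D.rowsOf (D.param n) (D.sampleA (D.param n) w)
      (D.sampleB (D.param n) w) (w.getD 5 []) (w.getD 6 []) b))
  exact h1.trans (avgs_lens (D.param n) fun A B u r =>
    Ψ (D.publicCode n (D.param n) (D.rowsOf (D.param n) A B u r b)))

/-! ### The hidden bit in the low branch -/

/-- The advantage of an algorithm at finding the hidden bit, for given public matrices. -/
noncomputable def bias (D : DenseSparseFamily) (𝒜 : QPT) (n l : ℕ) (A B : List (List Bool)) : ℝ :=
  avg (D.t l * D.m l) fun u => avg (D.m l) fun r =>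
    𝒜.acceptProb (D.publicCode n l (D.rowsOf l A B u r true)) -
      𝒜.acceptProb (D.publicCode n l (D.rowsOf l A B u r false))

theorem acceptProb_mem (𝒜 : QPT) (v : Val) : 0 ≤ 𝒜.acceptProb v ∧ 𝒜.acceptProb v ≤ 1 :=
  ⟨outProb_nonneg _ _ _, outProb_le_one _ _ _⟩

theorem bias_sq_le_one (𝒜 : QPT) (n l : ℕ) (A B : List (List Bool)) : D.bias 𝒜 n l A B ^ 2 ≤ 1 := by
  rw [sq_le_one_iff_abs_le_one, abs_le]
  constructor
  · rw [← avg_const (D.t l * D.m l) (-1)]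
    refine avg_mono fun u _ => ?_
    rw [← avg_const (D.m l) (-1)]
    refine avg_mono fun r _ => ?_
    have h1 := acceptProb_mem 𝒜 (D.publicCode n l (D.rowsOf l A B u r true))
    have h2 := acceptProb_mem 𝒜 (D.publicCode n l (D.rowsOf l A B u r false))
    linarith
  · rw [← avg_const (D.t l * D.m l) 1]
    refine avg_mono fun u _ => ?_
    rw [← avg_const (D.m l) 1]
    refine avg_mono fun r _ => ?_
    have h1 := acceptProb_mem 𝒜 (D.publicCode n l (D.rowsOf l A B u r true))
    have h2 := acceptProb_mem 𝒜 (D.publicCode n l (D.rowsOf l A B u r false))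
    linarith

/-- In the low branch the hidden bit is statistically hidden. -/
theorem bias_low_sq_le (hD : D.Suitable) (𝒜 : QPT) (n : ℕ) {l : ℕ} (ht : 0 < D.t l)
    (hm : 0 < D.m l / D.t l) (ω : D.Coins l)
    (hE : SparseNoise (D.t l) (D.w l) (D.E.sample l ω.2.2.2.1)) :
    D.bias 𝒜 n l (matRows (publicA ω)) (matRows (publicB false ω)) ^ 2 ≤
      D.pairCount l * (1 / (blockSize (D.m l) (D.t l) : ℝ)) ^ D.t l := by
  obtain ⟨Y, hY, himg⟩ := exists_image_sysRows (T := ω.1) (S := ω.2.1) (hD.sparse_K l ω.2.2.1) hE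
  have hB : publicB false ω = ω.2.1 * (ω.1 * D.K.sample l ω.2.2.1) + D.E.sample l ω.2.2.2.1 := by
    simp [publicB, publicA]
  have h := leftover_hash (D.t l * D.m l) (D.m l) (blockString (D.m l) (D.t l))
    (fun u => sysRows (D.m l) (matRows (publicA ω) ++ matRows (publicB false ω))
      (blockString (D.m l) (D.t l) u)) Y _
    (fun u hu => by
      rw [hB]
      exact himg _ (sparse_of_ok ht (blockRows_ok hm hu)))
    (avg_blockString_le hm)
    (fun y r c => 𝒜.acceptProb (D.publicCode n l (instRows (D.m l) (D.t l) y r c)))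
    (fun y r c => acceptProb_mem _ _)
  have e : D.bias 𝒜 n l (matRows (publicA ω)) (matRows (publicB false ω)) ^ 2 =
      (avg (D.t l * D.m l) fun u => avg (D.m l) fun r =>
        𝒜.acceptProb (D.publicCode n l (instRows (D.m l) (D.t l)
          (sysRows (D.m l) (matRows (publicA ω) ++ matRows (publicB false ω))
            (blockString (D.m l) (D.t l) u)) r (dot (D.m l) r (blockString (D.m l) (D.t l) u)))) -
        𝒜.acceptProb (D.publicCode n l (instRows (D.m l) (D.t l)
          (sysRows (D.m l) (matRows (publicA ω) ++ matRows (publicB false ω))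
            (blockString (D.m l) (D.t l) u)) r (!dot (D.m l) r (blockString (D.m l) (D.t l) u))))) ^ 2 := by
    rw [← neg_sq]
    congr 1
    rw [← neg_one_mul]
    simp only [bias, avg, ← unifE_mul_left, rowsOf, Bool.xor_true, Bool.xor_false]
    refine unifE_congr fun u => unifE_congr fun r => ?_
    ring
  rw [e]
  refine h.trans (mul_le_mul_of_nonneg_right ?_ (by positivity))
  exact_mod_cast hY

/-! ### The reduction -/

/-- Whether the output counts as `1`. -/
def isTrue (y : Val) : Bool := PCode.dec y

theorem isTrue_iff (y : Val) : isTrue y = true ↔ y ≠ .nil := by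
  cases y <;> simp [isTrue, PCode.dec]

theorem pf_isTrue {α : Type} [PCode α] {f : α → Val} (hf : PF f) : PF fun a => isTrue (f a) :=
  PF.dec' hf

/-- The probability to guess the hidden bit, when all but the public matrices is random. -/
theorem exists_guess (hD : D.Suitable) (𝒜 : QPT) : ∃ 𝒜' : QPT, ∀ n l A B,
    𝒜'.acceptProb (PCode.enc (n, l, A, B)) = 1 / 2 + D.bias 𝒜 n l A B / 2 := by
  have : Fact D.Suitable := ⟨hD⟩
  let q : Val → ℕ × ℕ × List (List Bool) × List (List Bool) := fun v => PCode.dec v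
  have hq : PF q := PF.dec
  let l : Val → ℕ := fun v => (q v).2.1
  have hl : PF l := by
    simp only [l]
    fun_prop
  let c : Val → ℕ := fun v => D.t (l v) * D.m (l v) + (D.m (l v) + 1)
  have hc : PF c := by
    simp only [c]
    fun_prop
  obtain ⟨p, hp⟩ := hc.size_le
  have hp' : ∀ v, c v ≤ p.eval v.size := by
    intro v
    have := hp v
    rw [size_enc_nat, enc_val] at this
    omega
  let cs : Val × List Bool → List (List Bool) := fun x =>
    chunks [D.t (l x.1) * D.m (l x.1), D.m (l x.1), 1] x.2
  have hcs : PF cs := by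
    simp only [cs, chunks]
    fun_prop
  let bt : Val × List Bool → Bool := fun x => ((cs x).getD 2 []).getD 0 false
  have hbt : PF bt := by
    simp only [bt]
    fun_prop
  have hpre : PF fun x : Val × List Bool => D.publicCode (q x.1).1 (q x.1).2.1
      (D.rowsOf (q x.1).2.1 (q x.1).2.2.1 (q x.1).2.2.2 ((cs x).getD 0 []) ((cs x).getD 1 []) (bt x)) :=
    pf_publicCode (by fun_prop) (by fun_prop) (by fun_prop)
  have htest : PF fun x : (Val × List Bool) × Val => !(isTrue x.2 ^^ bt x.1) := by
    have h1 : PF fun x : (Val × List Bool) × Val => isTrue x.2 := pf_isTrue (by fun_prop)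
    fun_prop
  obtain ⟨𝒜', h𝒜'⟩ := QPT.exists_wrap 𝒜 p _ hpre _ htest
  refine ⟨𝒜', fun n l' A B => ?_⟩
  have hv : q (PCode.enc (n, l', A, B)) = (n, l', A, B) := PCode.dec_enc _
  rw [h𝒜']
  have h1 := avg_chunks [D.t l' * D.m l', D.m l', 1] (p.eval (PCode.enc (n, l', A, B)).size)
    (by
      have := hp' (PCode.enc (n, l', A, B))
      simp only [c, l, hv] at this
      simpa using this)
    fun w => 𝒜.outProb (D.publicCode n l' (D.rowsOf l' A B (w.getD 0 []) (w.getD 1 [])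
      ((w.getD 2 []).getD 0 false))) {y | (!(isTrue y ^^ ((w.getD 2 []).getD 0 false))) = true}
  refine Eq.trans ?_ (h1.trans ?_)
  · refine avg_congr fun u _ => ?_
    simp only [bt, cs, l, hv]
  · simp only [avgs, avg_one, List.getD_cons_zero, List.getD_cons_succ]
    have h2 : ∀ v, 𝒜.outProb v {y | (!(isTrue y ^^ true)) = true} = 𝒜.acceptProb v := by
      intro v
      rw [QPT.acceptProb]
      congr 1
      ext y
      simp [← isTrue_iff]
    have h3 : ∀ v, 𝒜.outProb v {y | (!(isTrue y ^^ false)) = true} = 1 - 𝒜.acceptProb v := by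
      intro v
      rw [QPT.acceptProb, ← outProb_add_compl 𝒜 v {y | y ≠ Val.nil}, add_sub_cancel_left]
      congr 1
      ext y
      simp [← isTrue_iff]
    simp only [h2, h3, bias]
    unfold avg
    have h4 : ∀ {Ω : Type} [Fintype Ω] [Nonempty Ω] (f : Ω → ℝ),
        1 / 2 + unifE f / 2 = unifE fun ω => 1 / 2 + f ω / 2 := by
      intro Ω _ _ f
      rw [unifE_add, unifE_const]
      congr 1
      rw [div_eq_inv_mul, ← unifE_mul_left]
      exact unifE_congr fun ω => by ring
    rw [h4]
    refine unifE_congr fun u => ?_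
    rw [h4]
    refine unifE_congr fun r => ?_
    ring

/-- An adversary that measures the squared advantage for a random number of qubits. Squaring
prevents advantages of different signs from cancelling. -/
theorem exists_reduction (hD : D.Suitable) (𝒜 : QPT) : ∃ (𝒜' : QPT) (N : Val → ℕ), ∀ l A B,
    2 * D.qubitBound l ≤ N (PCode.enc (l, A, B)) ∧
    𝒜'.acceptProb (PCode.enc (l, A, B)) = avg (N (PCode.enc (l, A, B))) fun z =>
      1 / 2 + D.bias 𝒜 (randIdx (2 * D.qubitBound l) z).2 l A B ^ 2 / 2 := by
  have : Fact D.Suitable := ⟨hD⟩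
  obtain ⟨𝒜₁, h₁⟩ := exists_guess hD 𝒜
  obtain ⟨𝒜₂, h₂⟩ := QPT.exists_agree 𝒜₁
  let q : Val → ℕ × List (List Bool) × List (List Bool) := fun v => PCode.dec v
  have hq : PF q := PF.dec
  have hc : PF fun v => 2 * D.qubitBound (q v).1 := by fun_prop
  obtain ⟨p, hp⟩ := hc.size_le
  have hpre : PF fun x : Val × List Bool =>
      PCode.enc ((randIdx (2 * D.qubitBound (q x.1).1) x.2).2, q x.1) := by
    have h : PF fun x : Val × List Bool => q x.1 := PF.comp hq (by fun_prop)
    fun_prop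
  have htest : PF fun x : (Val × List Bool) × Val => isTrue x.2 := pf_isTrue (by fun_prop)
  obtain ⟨𝒜₃, h₃⟩ := QPT.exists_wrap 𝒜₂ p _ hpre _ htest
  refine ⟨𝒜₃, fun v => p.eval v.size, fun l A B => ?_⟩
  have hv : q (PCode.enc (l, A, B)) = (l, A, B) := PCode.dec_enc _
  constructor
  · have := hp (PCode.enc (l, A, B))
    rw [size_enc_nat, enc_val, hv] at this
    simp only at this ⊢
    omega
  · rw [h₃]
    refine avg_congr fun z _ => ?_
    have h4 : ∀ v, 𝒜₂.outProb v {y | isTrue y = true} = 𝒜₂.acceptProb v := by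
      intro v
      rw [QPT.acceptProb]
      congr 1
      ext y
      exact isTrue_iff y
    rw [h4]
    simp only [hv]
    rw [h₂, h₁]
    ring

/-- The expected advantage at finding the hidden bit, with `n` qubits. -/
noncomputable def advantage (D : DenseSparseFamily) (𝒜 : QPT) (n : ℕ) : ℝ :=
  unifE fun ω : D.Coins (D.param n) =>
    D.bias 𝒜 n (D.param n) (matRows (publicA ω)) (matRows (publicB true ω))

/-- The number of qubits is polynomially bounded in the security parameter. -/
theorem le_eval_param (hD : D.Suitable) : ∃ p : Polynomial ℕ, ∀ n, n ≤ p.eval (D.param n) ∧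
    ∀ l, D.qubitBound l ≤ p.eval l := by
  have : Fact D.Suitable := ⟨hD⟩
  have h : PF fun l => D.qubitBound l := by fun_prop
  obtain ⟨p, hp⟩ := h.size_le
  have h2 : ∀ l, D.qubitBound l ≤ (p.comp (2 * Polynomial.X + 1)).eval l := by
    intro l
    have := hp l
    rw [size_enc_nat, size_enc_nat] at this
    simp only [Polynomial.eval_comp, Polynomial.eval_add, Polynomial.eval_mul, Polynomial.eval_ofNat,
      Polynomial.eval_X, Polynomial.eval_one]
    omega
  exact ⟨_, fun n => ⟨(D.lt_qubitBound n).le.trans (h2 _), h2⟩⟩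

theorem unifE_fst {Ω Ω' : Type} [Fintype Ω] [Fintype Ω'] [Nonempty Ω'] (f : Ω → ℝ) :
    unifE (fun p : Ω × Ω' => f p.1) = unifE f := by
  rw [unifE_prod]
  exact unifE_congr fun a => unifE_const (f a)

theorem unifE_snd {Ω Ω' : Type} [Fintype Ω] [Fintype Ω'] [Nonempty Ω] (f : Ω' → ℝ) :
    unifE (fun p : Ω × Ω' => f p.2) = unifE f := by
  rw [unifE_prod]
  exact unifE_const (unifE f)

/-- Averages of functions of the coins of `E` and `C` only. -/
theorem unifE_coins {l : ℕ}
    (f : (Fin (D.E.coins.eval l) → Bool) × (Fin (D.C.coins.eval l) → Bool) → ℝ) :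
    (unifE fun ω : D.Coins l => f ω.2.2.2) = unifE f := by
  have : Nonempty (Matrix (Fin (D.h l)) (Fin (D.d l)) (ZMod 2)) := ⟨0⟩
  have : Nonempty (Matrix (Fin (D.h l)) (Fin (D.h l)) (ZMod 2)) := ⟨0⟩
  exact (unifE_snd fun p : _ × _ × _ => f p.2.2).trans
    ((unifE_snd fun p : _ × _ => f p.2).trans (unifE_snd f))

/-- The hidden bit is computationally hidden. -/
theorem negligible_advantage (hD : D.Suitable)
    (hLPN : ∀ 𝒜 : QPT, Negligible fun l => D.acceptProb 𝒜 true l - D.acceptProb 𝒜 false l)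
    (𝒜 : QPT) : Negligible (D.advantage 𝒜) := by
  classical
  obtain ⟨𝒜', N, h𝒜'⟩ := exists_reduction hD 𝒜
  obtain ⟨p, hp⟩ := le_eval_param hD
  have hacc : ∀ high l, D.acceptProb 𝒜' high l = unifE fun ω : D.Coins l =>
      avg (N (PCode.enc (l, matRows (publicA ω), matRows (publicB high ω)))) fun z =>
        1 / 2 + D.bias 𝒜 (randIdx (2 * D.qubitBound l) z).2 l (matRows (publicA ω))
          (matRows (publicB high ω)) ^ 2 / 2 := by
    intro high l
    rw [DenseSparseFamily.acceptProb]
    refine unifE_congr fun ω => ?_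
    rw [← (h𝒜' l _ _).2]
    simp only [ofMatrix_eq_enc]
    rfl
  -- The bound for the squared advantage, as a function of the security parameter.
  let δ : ℕ → ℝ := fun l => 2 * (D.acceptProb 𝒜' true l - D.acceptProb 𝒜' false l) +
    ((1 / 2 : ℝ) ^ D.t l + unifP fun r => ¬ SparseNoise (D.t l) (D.w l) (D.E.sample l r))
  have hδ : Negligible fun l => ((2 * p).eval l : ℕ) * δ l :=
    (((hLPN 𝒜').const_mul 2).add (hD.negligible_half_pow.add hD.sparse_E)).mul_poly _
  have hlow : ∀ᶠ l in atTop, D.acceptProb 𝒜' false l ≤ 1 / 2 +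
      ((1 / 2 : ℝ) ^ D.t l + unifP fun r => ¬ SparseNoise (D.t l) (D.w l) (D.E.sample l r)) / 2 := by
    filter_upwards [hD.t_pos, hD.div_pos, hD.compression] with l h1 h2 h3
    have hP : (unifP fun r => ¬ SparseNoise (D.t l) (D.w l) (D.E.sample l r)) =
        unifE fun ω : D.Coins l =>
          if ¬ SparseNoise (D.t l) (D.w l) (D.E.sample l ω.2.2.2.1) then 1 else 0 := by
      have h4 := unifE_fst (Ω := Fin (D.E.coins.eval l) → Bool) (Ω' := Fin (D.C.coins.eval l) → Bool)
        fun r => if ¬ SparseNoise (D.t l) (D.w l) (D.E.sample l r) then (1 : ℝ) else 0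
      rw [unifP]
      refine (Eq.trans ?_ h4.symm).trans (unifE_coins fun p =>
        if ¬ SparseNoise (D.t l) (D.w l) (D.E.sample l p.1) then (1 : ℝ) else 0).symm
      exact unifE_congr fun r => by congr
    rw [hacc, hP]
    calc _ ≤ unifE fun ω : D.Coins l => (1 / 2 + (1 / 2 : ℝ) ^ D.t l / 2) + (1 / 2) *
          (if ¬ SparseNoise (D.t l) (D.w l) (D.E.sample l ω.2.2.2.1) then 1 else 0) := by
          refine unifE_mono fun ω => ?_
          rw [← avg_const (N (PCode.enc (l, matRows (publicA ω), matRows (publicB false ω))))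
            ((1 / 2 + (1 / 2 : ℝ) ^ D.t l / 2) + _)]
          refine avg_mono fun z _ => ?_
          by_cases hE : SparseNoise (D.t l) (D.w l) (D.E.sample l ω.2.2.2.1)
          · have := (bias_low_sq_le hD 𝒜 (randIdx (2 * D.qubitBound l) z).2 h1 h2 ω hE).trans h3
            rw [if_neg (not_not.2 hE)]
            linarith
          · have := bias_sq_le_one (D := D) 𝒜 (randIdx (2 * D.qubitBound l) z).2 l
              (matRows (publicA ω)) (matRows (publicB false ω))
            have h0 : (0 : ℝ) ≤ (1 / 2) ^ D.t l := by positivity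
            rw [if_pos hE]
            linarith
      _ = _ := by
          rw [unifE_add, unifE_const, unifE_mul_left]
          ring
  have hhigh : ∀ n, 1 / 2 + D.advantage 𝒜 n ^ 2 / (2 * (2 * D.qubitBound (D.param n))) ≤
      D.acceptProb 𝒜' true (D.param n) := by
    intro n
    set l := D.param n with hl
    have hU : n < D.qubitBound l := D.lt_qubitBound n
    have hU0 : (0 : ℝ) < D.qubitBound l := by exact_mod_cast (by omega : 0 < D.qubitBound l)
    rw [hacc]
    calc 1 / 2 + D.advantage 𝒜 n ^ 2 / (2 * (2 * D.qubitBound l))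
        ≤ 1 / 2 + (1 / (2 * (2 * D.qubitBound l))) * unifE fun ω : D.Coins l =>
          D.bias 𝒜 n l (matRows (publicA ω)) (matRows (publicB true ω)) ^ 2 := by
          have h0 : D.advantage 𝒜 n ^ 2 / (2 * (2 * D.qubitBound l)) =
              1 / (2 * (2 * D.qubitBound l)) * D.advantage 𝒜 n ^ 2 := by ring
          rw [h0]
          gcongr
          exact sq_unifE_le _
      _ = unifE fun ω : D.Coins l => 1 / 2 + (1 / (2 * (2 * D.qubitBound l))) *
          D.bias 𝒜 n l (matRows (publicA ω)) (matRows (publicB true ω)) ^ 2 := by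
          rw [unifE_add, unifE_const, unifE_mul_left]
      _ ≤ _ := by
          refine unifE_mono fun ω => ?_
          set A := matRows (publicA ω)
          set B := matRows (publicB true ω)
          set M := N (PCode.enc (l, A, B))
          have hM : 2 * D.qubitBound l ≤ M := (h𝒜' l A B).1
          set G := growth (2 * D.qubitBound l) M 1 with hG
          have hG1 : 2 * D.qubitBound l < 2 * G := lt_growth one_pos (by omega)
          have hG2 : G ≤ 2 * D.qubitBound l := growth_le (by omega)
          have hG0 : (0 : ℝ) < G := by exact_mod_cast (by omega : 0 < G)
          have h1 : avg M (fun z => 1 / 2 + (D.bias 𝒜 n l A B ^ 2 / 2) *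
              (if (randIdx (2 * D.qubitBound l) z).2 = n then 1 else 0)) =
              1 / 2 + (D.bias 𝒜 n l A B ^ 2 / 2) * (1 / G) := by
            have h2 := avg_randIdx (2 * D.qubitBound l) M n
            rw [← hG, if_pos (by omega)] at h2
            rw [← h2]
            unfold avg
            rw [unifE_add, unifE_const, unifE_mul_left]
          calc 1 / 2 + (1 / (2 * (2 * D.qubitBound l))) * D.bias 𝒜 n l A B ^ 2
              = 1 / 2 + (D.bias 𝒜 n l A B ^ 2 / 2) * (1 / (2 * D.qubitBound l)) := by ring
            _ ≤ 1 / 2 + (D.bias 𝒜 n l A B ^ 2 / 2) * (1 / G) := by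
                gcongr
                exact_mod_cast hG2
            _ = _ := h1.symm
            _ ≤ _ := by
                refine avg_mono fun z _ => ?_
                split_ifs with h2
                · rw [h2, mul_one]
                · have := sq_nonneg (D.bias 𝒜 (randIdx (2 * D.qubitBound l) z).2 l A B)
                  linarith
  refine Negligible.of_sq_le (hδ.comp_of_le_eval (s := D.param) (p := p)
    (Eventually.of_forall fun n => (hp n).1)) ?_
  have ht : Tendsto D.param atTop atTop :=
    tendsto_of_le_eval (Eventually.of_forall fun n => (hp n).1)
  filter_upwards [ht.eventually hlow] with n h1
  have h2 := hhigh n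
  set l := D.param n
  have hU : n < D.qubitBound l := D.lt_qubitBound n
  have hU0 : (0 : ℝ) < D.qubitBound l := by exact_mod_cast (by omega : 0 < D.qubitBound l)
  have hUp : (D.qubitBound l : ℝ) ≤ (p.eval l : ℕ) := by exact_mod_cast (hp n).2 l
  have h3 : D.advantage 𝒜 n ^ 2 / (2 * (2 * D.qubitBound l)) ≤ δ l / 2 := by
    simp only [δ]
    linarith
  rw [div_le_iff₀ (by positivity)] at h3
  have hδ0 : 0 ≤ δ l := by
    have h4 := sq_nonneg (D.advantage 𝒜 n)
    by_contra h5
    have h6 : δ l / 2 * (2 * (2 * D.qubitBound l)) < 0 :=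
      mul_neg_of_neg_of_pos (by linarith) (by positivity)
    linarith
  calc D.advantage 𝒜 n ^ 2 ≤ δ l / 2 * (2 * (2 * D.qubitBound l)) := h3
    _ = 2 * D.qubitBound l * δ l := by ring
    _ ≤ 2 * (p.eval l : ℕ) * δ l := by gcongr
    _ = ((2 * p).eval l : ℕ) * δ l := by
        rw [Polynomial.eval_mul, Polynomial.eval_ofNat]
        push_cast
        ring

end DenseSparseFamily

/-! ### The entropy of a unique ground state -/

theorem entanglementEntropy_smul {n : ℕ} (W : Finset (Fin n)) (φ : QState n) {c : ℂ} (hc : ‖c‖ = 1) :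
    entanglementEntropy W (c • φ) = entanglementEntropy W φ := by
  have h : proj (c • φ) = proj φ := by
    ext x y
    have h1 : c * star c = 1 := by
      rw [Complex.star_def, Complex.mul_conj, Complex.normSq_eq_norm_sq, hc]
      norm_num
    simp only [proj, Matrix.vecMulVec_apply, Pi.smul_apply, Pi.star_apply, smul_eq_mul, star_mul']
    linear_combination (φ x * star (φ y)) * h1
  have h2 : ptrace W (proj (c • φ)) = ptrace W (proj φ) := by rw [h]
  unfold entanglementEntropy
  have key : ∀ (ρ σ : Matrix ({i // i ∉ W} → Bool) ({i // i ∉ W} → Bool) ℂ) (hρ : ρ.IsHermitian)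
      (hσ : σ.IsHermitian), ρ = σ → vonNeumann hρ = vonNeumann hσ := by
    rintro ρ σ hρ hσ rfl
    rfl
  exact key _ _ _ _ h2

theorem entropyIn_iff {n : ℕ} {H : Ham n} {W : Finset (Fin n)} {I : Set ℝ} {φ : QState n}
    (hφ : H.IsUniqueGroundState φ) : EntropyIn H W I ↔ entanglementEntropy W φ ∈ I := by
  constructor
  · rintro ⟨ψ, hψ, hI⟩
    obtain ⟨c, rfl⟩ := hφ.2 ψ hψ.1
    have h1 := hψ.1.1
    have hc : ‖c‖ = 1 := by
      simp only [Pi.smul_apply, smul_eq_mul, norm_mul, mul_pow, ← Finset.mul_sum] at h1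
      rw [hφ.1.1, mul_one] at h1
      exact (pow_eq_one_iff_of_nonneg (norm_nonneg c) two_ne_zero).1 h1
    rwa [entanglementEntropy_smul W φ hc] at hI
  · exact fun h => ⟨φ, hφ, h⟩

theorem Negligible.eventually_le {f : ℕ → ℝ} (hf : Negligible f) {ε : ℝ} (hε : 0 < ε) :
    ∀ᶠ n in atTop, |f n| ≤ ε := by
  filter_upwards [hf 1, eventually_ge_atTop (⌈ε⁻¹⌉₊ + 1)] with n h1 h2
  refine h1.trans ?_
  have h3 : ε⁻¹ ≤ n := (Nat.le_ceil _).trans (by exact_mod_cast (by omega : ⌈ε⁻¹⌉₊ ≤ n))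
  rw [pow_one]
  exact inv_le_of_inv_le₀ hε h3

theorem avg_le {n : ℕ} {f : List Bool → ℝ} {c : ℝ} (h : ∀ u, u.length = n → f u ≤ c) :
    avg n f ≤ c :=
  (avg_mono h).trans_eq (avg_const n c)

namespace DenseSparseFamily
variable {D : DenseSparseFamily}

/-- The Hamiltonian is frustration-free with a unique ground state and spectral gap `1`, and this
ground state has the given entropy across the cut. -/
def HasEntropy {n : ℕ} (H : Ham n) (W : Finset (Fin n)) (s : ℝ) : Prop :=
  H.GroundStructure ∧ ∃ φ, H.IsUniqueGroundState φ ∧ entanglementEntropy W φ = s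

/-- Instances with compressed sensing and sparse noise have a unique solution, and the hidden bit
decides about the entropy. -/
theorem hasEntropy_of_good {n l : ℕ} (hn : D.numQubits l ≤ n) (ht : 0 < D.t l)
    (hm : 0 < D.m l / D.t l) {ω : D.Coins l}
    (hE : SparseNoise (D.t l) (D.w l) (D.E.sample l ω.2.2.2.1))
    (hC : CompressedSensing (D.t l) (D.w l) (D.C.sample l ω.2.2.2.2))
    {u : List Bool} (hu : u.length = D.t l * D.m l) (r : List Bool) (b : Bool) :
    HasEntropy (gridHam n (D.m l) (D.rowsOf l (matRows (publicA ω)) (matRows (publicB true ω)) u r b))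
      (gridCut n (D.m l) (D.numRows l)) (if b then D.m l else 0 : ℕ) := by
  have hlen := D.length_rowsOf (A := matRows (publicA ω)) (B := matRows (publicB true ω))
    (length_matRows _) (length_matRows _) u r b
  have hx := blockRows_ok hm hu
  have hB : publicB true ω = ω.2.1 * publicA ω + D.E.sample l ω.2.2.2.1 + D.C.sample l ω.2.2.2.2 := by
    simp [publicB]
  have hrows : D.rowsOf l (matRows (publicA ω)) (matRows (publicB true ω)) u r b =
      instRows (D.m l) (D.t l) (sysRows (D.m l) (matRows (publicA ω) ++ matRows (publicB true ω))
        (blockString (D.m l) (D.t l) u)) r (dot (D.m l) r (blockString (D.m l) (D.t l) u) ^^ b) := rfl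
  rw [← hlen]
  rw [hrows] at hlen ⊢
  have h := gridHam_spec (n := n) (m := D.m l)
    (rows := instRows (D.m l) (D.t l)
      (sysRows (D.m l) (matRows (publicA ω) ++ matRows (publicB true ω))
        (blockString (D.m l) (D.t l) u)) r (dot (D.m l) r (blockString (D.m l) (D.t l) u) ^^ b))
    (x := blockString (D.m l) (D.t l) u) (c := b) ?_ ?_ (instRows_ne_nil _ _ _ _ _)
    (instRows_ok hm hu _ _ _) ?_ ?_
  · exact h
  · rw [hlen]
    exact hn
  · exact Nat.pos_of_ne_zero fun h => by rw [h] at hm; simp at hm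
  · intro y hy
    refine instRows_unique (A := publicA ω) (S := ω.2.1) ht hE hC hx (r := r)
      (c := dot (D.m l) r (blockString (D.m l) (D.t l) u) ^^ b) ?_
    rw [← hB]
    exact hy
  · rw [instRows_last]
    change ((dot (D.m l) r (blockString (D.m l) (D.t l) u) ^^ b) ^^
      dot (D.m l) r (blockString (D.m l) (D.t l) u)) = b
    cases dot (D.m l) r (blockString (D.m l) (D.t l) u) <;> cases b <;> rfl

/-! ### Properties of the family -/

theorem tendsto_param (hD : D.Suitable) : Tendsto D.param atTop atTop := by
  obtain ⟨p, hp⟩ := le_eval_param hD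
  exact tendsto_of_le_eval (Eventually.of_forall fun n => (hp n).1)

/-- What holds for all Hamiltonians with the right entropies holds for the family with overwhelming
probability. -/
theorem overwhelming (hD : D.Suitable) {P : ∀ n, Ham n → Ham n → Finset (Fin n) → Prop}
    (hP : ∀ᶠ n in atTop, ∀ H H' W, H.IsLocal2D 3 → H'.IsLocal2D 3 → HasEntropy H W 0 →
      HasEntropy H' W (D.m (D.param n)) → P n H H' W) : (family hD).Overwhelming P := by
  classical
  obtain ⟨p, hp⟩ := le_eval_param hD
  refine ((hD.sparse_E.add hD.sensing_C).comp_of_le_eval (s := D.param) (p := p)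
    (Eventually.of_forall fun n => (hp n).1)).of_le ?_
  filter_upwards [hP, eventually_ge_atTop (D.numQubits 0), (tendsto_param hD).eventually hD.t_pos,
    (tendsto_param hD).eventually hD.div_pos] with n h1 h2 h3 h4
  set l := D.param n with hl
  have e1 : (unifP fun r => ¬ P n ((family hD).low n r) ((family hD).high n r)
      ((family hD).cut n r)) = unifE fun ω : D.Coins l =>
        avg (D.t l * D.m l) fun u => avg (D.m l) fun r =>
          if ¬ P n (gridHam n (D.m l) (D.rowsOf l (matRows (publicA ω)) (matRows (publicB true ω)) u r false))
            (gridHam n (D.m l) (D.rowsOf l (matRows (publicA ω)) (matRows (publicB true ω)) u r true))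
            (gridCut n (D.m l) (D.numRows l)) then 1 else 0 := by
    have h5 := avg_chunks (D.lens l) _ (sum_lens_le hD n) fun w =>
      if ¬ P n (gridHam n (D.m l) (D.rowsOf l (D.sampleA l w) (D.sampleB l w)
          (w.getD 5 []) (w.getD 6 []) false))
        (gridHam n (D.m l) (D.rowsOf l (D.sampleA l w) (D.sampleB l w)
          (w.getD 5 []) (w.getD 6 []) true))
        (gridCut n (D.m l) (D.numRows l)) then (1 : ℝ) else 0
    refine Eq.trans ?_ (h5.trans (avgs_lens l fun A B u r =>
      if ¬ P n (gridHam n (D.m l) (D.rowsOf l A B u r false))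
        (gridHam n (D.m l) (D.rowsOf l A B u r true))
        (gridCut n (D.m l) (D.numRows l)) then (1 : ℝ) else 0))
    unfold unifP avg
    exact unifE_congr fun r => by congr
  have e2 : (unifP fun r => ¬ SparseNoise (D.t l) (D.w l) (D.E.sample l r)) +
      (unifP fun r => ¬ CompressedSensing (D.t l) (D.w l) (D.C.sample l r)) =
      unifE fun ω : D.Coins l =>
        (if ¬ SparseNoise (D.t l) (D.w l) (D.E.sample l ω.2.2.2.1) then (1 : ℝ) else 0) +
        (if ¬ CompressedSensing (D.t l) (D.w l) (D.C.sample l ω.2.2.2.2) then (1 : ℝ) else 0) := by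
    rw [unifE_add]
    refine congrArg₂ (· + ·) ?_ ?_
    · have h4 := unifE_fst (Ω := Fin (D.E.coins.eval l) → Bool) (Ω' := Fin (D.C.coins.eval l) → Bool)
        fun r => if ¬ SparseNoise (D.t l) (D.w l) (D.E.sample l r) then (1 : ℝ) else 0
      rw [unifP]
      refine (Eq.trans ?_ h4.symm).trans (unifE_coins fun p =>
        if ¬ SparseNoise (D.t l) (D.w l) (D.E.sample l p.1) then (1 : ℝ) else 0).symm
      exact unifE_congr fun r => by congr
    · have h4 := unifE_snd (Ω := Fin (D.E.coins.eval l) → Bool) (Ω' := Fin (D.C.coins.eval l) → Bool)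
        fun r => if ¬ CompressedSensing (D.t l) (D.w l) (D.C.sample l r) then (1 : ℝ) else 0
      rw [unifP]
      refine (Eq.trans ?_ h4.symm).trans (unifE_coins fun p =>
        if ¬ CompressedSensing (D.t l) (D.w l) (D.C.sample l p.2) then (1 : ℝ) else 0).symm
      exact unifE_congr fun r => by congr
  rw [abs_of_nonneg (show 0 ≤ unifP _ from unifE_nonneg fun r => by split_ifs <;> norm_num), e1, e2]
  refine unifE_mono fun ω => ?_
  by_cases hE : SparseNoise (D.t l) (D.w l) (D.E.sample l ω.2.2.2.1)
  · by_cases hC : CompressedSensing (D.t l) (D.w l) (D.C.sample l ω.2.2.2.2)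
    · refine le_trans (b := 0) ?_ (by positivity)
      refine avg_le fun u hu => avg_le fun r _ => (if_neg (not_not.2 ?_)).le
      have h5 := hasEntropy_of_good (D.numQubits_param_le h2) h3 h4 hE hC hu r false
      have h6 := hasEntropy_of_good (D.numQubits_param_le h2) h3 h4 hE hC hu r true
      refine h1 _ _ _ (gridHam_isLocal _ _ _) (gridHam_isLocal _ _ _) ?_ h6
      simpa using h5
    · refine le_trans ?_ (le_of_le_of_eq (b := (0 : ℝ) + 1) (by norm_num)
        (by rw [if_neg (not_not.2 hE), if_pos hC]) : (1 : ℝ) ≤ _)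
      exact avg_le fun u _ => avg_le fun r _ => by split_ifs <;> norm_num
  · refine le_trans (b := 1) ?_ ?_
    · exact avg_le fun u _ => avg_le fun r _ => by split_ifs <;> norm_num
    · rw [if_pos hE]
      split_ifs <;> norm_num

/-- The two distributions of Hamiltonians are computationally indistinguishable. -/
theorem indistinguishable (hD : D.Suitable)
    (hLPN : ∀ 𝒜 : QPT, Negligible fun l => D.acceptProb 𝒜 true l - D.acceptProb 𝒜 false l)
    (𝒜 : QPT) : Negligible fun n =>
      unifE (fun r => 𝒜.acceptProb (inputCode ((family hD).high n r) ((family hD).cut n r)))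
        - unifE (fun r => 𝒜.acceptProb (inputCode ((family hD).low n r) ((family hD).cut n r))) := by
  refine (negligible_advantage hD hLPN 𝒜).abs.of_le ?_
  filter_upwards [eventually_ge_atTop (D.numQubits 0)] with n hn
  refine le_of_eq (congrArg _ ?_)
  have h : ∀ b, (unifE fun r : Fin ((coinPoly hD).eval n) → Bool => 𝒜.acceptProb (inputCode
      (D.ham n b (List.ofFn r)) (gridCut n (D.m (D.param n)) (D.numRows (D.param n))))) =
      unifE fun ω : D.Coins (D.param n) =>
        avg (D.t (D.param n) * D.m (D.param n)) fun u => avg (D.m (D.param n)) fun r =>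
          𝒜.acceptProb (D.publicCode n (D.param n)
            (D.rowsOf (D.param n) (matRows (publicA ω)) (matRows (publicB true ω)) u r b)) := by
    intro b
    rw [← avg_code hD n b]
    exact unifE_congr fun r => by rw [D.inputCode_ham hn]
  refine (congrArg₂ (· - ·) (h true) (h false)).trans ?_
  simp only [advantage, bias, avg, unifE_sub]

/-- `m` grows without bound, as `t` is positive and of smaller order. -/
theorem eventually_le_m (hD : D.Suitable) (C : ℕ) : ∀ᶠ n in atTop, C ≤ D.m (D.param n) := by
  have h : ∀ᶠ l in atTop, C ≤ D.m l := by
    filter_upwards [hD.t_pos, hD.mul_t_le (C + 1) (by positivity)] with l h1 h2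
    have h3 : (1 : ℝ) ≤ D.t l := by exact_mod_cast h1
    have h4 : ((C : ℝ) + 1) * 1 ≤ (C + 1) * D.t l := by gcongr
    have h5 : (C : ℝ) ≤ D.m l := by linarith
    exact_mod_cast h5
  exact (tendsto_param hD).eventually h

/-- The number of pairs outgrows the logarithm of the number of qubits, which is polynomially
related to the security parameter. -/
theorem log_isLittleO (hD : D.Suitable) :
    (fun n : ℕ => Real.log n) =o[atTop] fun n => max 1 (D.m (D.param n) : ℝ) := by
  obtain ⟨p, hp⟩ := le_eval_param hD
  obtain ⟨k, hk⟩ := exists_eval_le_pow p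
  rw [isLittleO_iff]
  intro c hc
  have h : ∀ᶠ l : ℕ in atTop, 0 < l ∧ p.eval l ≤ l ^ k ∧ k * Real.log l ≤ c * D.m l := by
    filter_upwards [hk, hD.t_large.bound (show 0 < c / (k + 1) by positivity),
      hD.mul_t_le 1 one_pos, eventually_gt_atTop 0] with l h1 h2 h3 h4
    refine ⟨h4, h1, ?_⟩
    have h5 : 0 ≤ Real.log l := Real.log_nonneg (by exact_mod_cast h4)
    rw [Real.norm_of_nonneg h5, Real.norm_natCast, div_mul_eq_mul_div, le_div_iff₀ (by positivity)] at h2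
    have h6 : c * D.t l ≤ c * D.m l := by
      refine mul_le_mul_of_nonneg_left ?_ hc.le
      linarith
    nlinarith
  filter_upwards [(tendsto_param hD).eventually h, eventually_gt_atTop 0] with n h1 h2
  have h3 : (1 : ℝ) ≤ n := by exact_mod_cast h2
  rw [Real.norm_of_nonneg (Real.log_nonneg h3), Real.norm_of_nonneg (by positivity)]
  have h4 : (n : ℝ) ≤ (D.param n : ℝ) ^ k := by exact_mod_cast (hp n).1.trans h1.2.1
  calc Real.log n ≤ Real.log ((D.param n : ℝ) ^ k) := Real.log_le_log (by linarith) h4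
    _ = k * Real.log (D.param n) := Real.log_pow _ _
    _ ≤ c * D.m (D.param n) := h1.2.2
    _ ≤ c * max 1 (D.m (D.param n) : ℝ) := by
        gcongr
        exact le_max_right _ _

/-! ### Learning the entropy is hard -/

/-- An algorithm that tells low from high entropy in the worst case distinguishes the family. -/
theorem not_decides (hD : D.Suitable)
    (hLPN : ∀ 𝒜 : QPT, Negligible fun l => D.acceptProb 𝒜 true l - D.acceptProb 𝒜 false l)
    (𝒜 : QPT) : ∀ᶠ n in atTop,
      ¬ DecidesEntropyAt 𝒜 3 (fun _ => 0) (fun n => max 1 (D.m (D.param n) : ℝ)) n := by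
  classical
  have hbad := overwhelming hD (P := fun n H H' W => H.IsLocal2D 3 ∧ H'.IsLocal2D 3 ∧
    HasEntropy H W 0 ∧ HasEntropy H' W (D.m (D.param n)))
    (Eventually.of_forall fun n H H' W h1 h2 h3 h4 => ⟨h1, h2, h3, h4⟩)
  filter_upwards [Negligible.eventually_le hbad (show (0 : ℝ) < 1 / 10 by norm_num),
    Negligible.eventually_le (indistinguishable hD hLPN 𝒜) (show (0 : ℝ) < 1 / 10 by norm_num),
    eventually_le_m hD 1] with n h1 h2 h3 hdec
  have h4 := (abs_le.1 h1).2
  have h5 := (abs_le.1 h2).2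
  rw [← unifE_sub] at h5
  have h6 : 1 / 3 - 4 / 3 * (unifP fun r => ¬ ((((family hD).low n r).IsLocal2D 3 ∧
      ((family hD).high n r).IsLocal2D 3 ∧ HasEntropy ((family hD).low n r) ((family hD).cut n r) 0 ∧
      HasEntropy ((family hD).high n r) ((family hD).cut n r) (D.m (D.param n))))) ≤
      unifE fun r => 𝒜.acceptProb (inputCode ((family hD).high n r) ((family hD).cut n r)) -
        𝒜.acceptProb (inputCode ((family hD).low n r) ((family hD).cut n r)) := by
    have h7 := unifE_const (Ω := Fin ((family hD).coins.eval n) → Bool) (1 / 3)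
    rw [unifP, ← unifE_mul_left, ← h7, ← unifE_sub]
    refine unifE_mono fun r => ?_
    have hl := acceptProb_mem 𝒜 (inputCode ((family hD).low n r) ((family hD).cut n r))
    have hh := acceptProb_mem 𝒜 (inputCode ((family hD).high n r) ((family hD).cut n r))
    split_ifs with hgood
    · obtain ⟨g1, g2, ⟨g3, φ, g4, g5⟩, ⟨g6, ψ, g7, g8⟩⟩ := hgood
      have k1 := (hdec _ ((family hD).cut n r) g1 g3).1 ⟨φ, g4, by rw [g5, Set.mem_Iic]⟩
      have k2 := (hdec _ ((family hD).cut n r) g2 g6).2 ⟨ψ, g7, by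
        rw [g8, Set.mem_Ici]
        exact max_le (by exact_mod_cast h3) le_rfl⟩
      linarith
    · linarith
  linarith

/-- Whether the real number named by `y` exceeds `c`. -/
def exceeds (c : ℕ) (y : Val) : Bool :=
  decide (0 < y.tl.toNat) && decide (c * y.tl.toNat < y.hd.toNat)

theorem exceeds_iff (c : ℕ) (y : Val) : exceeds c y = true ↔ (c : ℝ) < y.toReal := by
  rw [exceeds, Bool.and_eq_true, decide_eq_true_eq, decide_eq_true_eq, Val.toReal]
  rcases Nat.eq_zero_or_pos y.tl.toNat with h | h
  · simp only [h, lt_irrefl, false_and, Nat.cast_zero, div_zero, false_iff, not_lt]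
    positivity
  · have h' : (0 : ℝ) < y.tl.toNat := by exact_mod_cast h
    rw [lt_div_iff₀ h']
    simp only [h, true_and]
    exact_mod_cast Iff.rfl

/-- The average probability to estimate the entropy, over the family and the two branches. -/
noncomputable def estimateProb (hD : D.Suitable) (𝒜 : QPT) (ε : ℝ) (n : ℕ) : ℝ :=
  (unifE (fun r => 𝒜.outProb (inputCode ((family hD).low n r) ((family hD).cut n r))
      (goodEstimates ((family hD).low n r) ((family hD).cut n r) ε))
    + unifE (fun r => 𝒜.outProb (inputCode ((family hD).high n r) ((family hD).cut n r))
      (goodEstimates ((family hD).high n r) ((family hD).cut n r) ε))) / 2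

/-- An algorithm that estimates the entropy distinguishes the family, by a threshold. -/
theorem estimateProb_le (hD : D.Suitable)
    (hLPN : ∀ 𝒜 : QPT, Negligible fun l => D.acceptProb 𝒜 true l - D.acceptProb 𝒜 false l)
    (𝒜 : QPT) (ε : ℝ) : ∃ μ : ℕ → ℝ, Negligible μ ∧
      ∀ᶠ n in atTop, estimateProb hD 𝒜 ε n ≤ 1 / 2 + μ n := by
  classical
  obtain ⟨c, hc⟩ := exists_nat_ge ε
  have htest : PF fun x : (Val × List Bool) × Val => exceeds c x.2 := by
    unfold exceeds
    have h1 : PF fun x : (Val × List Bool) × Val => x.2.tl.toNat := PF.toNat (PF.tl (by fun_prop))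
    have h2 : PF fun x : (Val × List Bool) × Val => x.2.hd.toNat := PF.toNat (PF.hd (by fun_prop))
    fun_prop
  obtain ⟨𝒜', h𝒜'⟩ := QPT.exists_wrap 𝒜 0 (fun x => x.1) (by fun_prop) _ htest
  have hacc : ∀ v, 𝒜'.acceptProb v = 𝒜.outProb v {y | exceeds c y = true} := fun v => by
    rw [h𝒜']
    exact avg_const ((0 : Polynomial ℕ).eval v.size) (𝒜.outProb v {y | exceeds c y = true})
  have hbad := overwhelming hD (P := fun n H H' W =>
    HasEntropy H W 0 ∧ HasEntropy H' W (D.m (D.param n)))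
    (Eventually.of_forall fun n H H' W _ _ h3 h4 => ⟨h3, h4⟩)
  refine ⟨_, ((indistinguishable hD hLPN 𝒜').const_mul (1 / 2)).add hbad, ?_⟩
  filter_upwards [eventually_le_m hD (2 * c + 1)] with n hm
  have hm' : (2 * c + 1 : ℝ) ≤ D.m (D.param n) := by exact_mod_cast hm
  have key : ∀ r, 𝒜.outProb (inputCode ((family hD).low n r) ((family hD).cut n r))
      (goodEstimates ((family hD).low n r) ((family hD).cut n r) ε) +
      𝒜.outProb (inputCode ((family hD).high n r) ((family hD).cut n r))
      (goodEstimates ((family hD).high n r) ((family hD).cut n r) ε) ≤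
      1 + (𝒜'.acceptProb (inputCode ((family hD).high n r) ((family hD).cut n r)) -
        𝒜'.acceptProb (inputCode ((family hD).low n r) ((family hD).cut n r))) +
      2 * (if ¬ (HasEntropy ((family hD).low n r) ((family hD).cut n r) 0 ∧
        HasEntropy ((family hD).high n r) ((family hD).cut n r) (D.m (D.param n))) then 1 else 0) := by
    intro r
    have hl := acceptProb_mem 𝒜' (inputCode ((family hD).low n r) ((family hD).cut n r))
    have hh := acceptProb_mem 𝒜' (inputCode ((family hD).high n r) ((family hD).cut n r))
    by_cases hgood : HasEntropy ((family hD).low n r) ((family hD).cut n r) 0 ∧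
        HasEntropy ((family hD).high n r) ((family hD).cut n r) (D.m (D.param n))
    · obtain ⟨⟨-, φ, g1, g2⟩, ⟨-, ψ, g3, g4⟩⟩ := hgood
      have k1 : 𝒜.outProb (inputCode ((family hD).low n r) ((family hD).cut n r))
          (goodEstimates ((family hD).low n r) ((family hD).cut n r) ε) ≤
          1 - 𝒜'.acceptProb (inputCode ((family hD).low n r) ((family hD).cut n r)) := by
        rw [hacc, ← outProb_add_compl 𝒜 _ {y | exceeds c y = true}, add_sub_cancel_left]
        refine outProb_mono _ _ fun y hy => ?_
        have hy' := (entropyIn_iff g1).1 hy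
        rw [g2, Set.mem_Icc] at hy'
        rw [Set.mem_compl_iff, Set.mem_ofPred_eq, exceeds_iff, not_lt]
        linarith [hy'.1]
      have k2 : 𝒜.outProb (inputCode ((family hD).high n r) ((family hD).cut n r))
          (goodEstimates ((family hD).high n r) ((family hD).cut n r) ε) ≤
          𝒜'.acceptProb (inputCode ((family hD).high n r) ((family hD).cut n r)) := by
        rw [hacc]
        refine outProb_mono _ _ fun y hy => ?_
        have hy' := (entropyIn_iff g3).1 hy
        rw [g4, Set.mem_Icc] at hy'
        rw [Set.mem_ofPred_eq, exceeds_iff]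
        have : (0 : ℝ) ≤ c := Nat.cast_nonneg c
        linarith [hy'.2]
      have k3 : (0 : ℝ) ≤ 2 * (if ¬ (HasEntropy ((family hD).low n r) ((family hD).cut n r) 0 ∧
        HasEntropy ((family hD).high n r) ((family hD).cut n r) (D.m (D.param n))) then 1 else 0) := by
        split_ifs <;> norm_num
      linarith
    · have k1 := outProb_le_one 𝒜 (inputCode ((family hD).low n r) ((family hD).cut n r))
        (goodEstimates ((family hD).low n r) ((family hD).cut n r) ε)
      have k2 := outProb_le_one 𝒜 (inputCode ((family hD).high n r) ((family hD).cut n r))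
        (goodEstimates ((family hD).high n r) ((family hD).cut n r) ε)
      rw [if_pos hgood]
      linarith
  have h1 := unifE_mono key
  rw [unifE_add, unifE_add, unifE_add, unifE_const, unifE_sub, unifE_mul_left] at h1
  have h2 : (unifE fun r => if ¬ (HasEntropy ((family hD).low n r) ((family hD).cut n r) 0 ∧
        HasEntropy ((family hD).high n r) ((family hD).cut n r) (D.m (D.param n))) then (1 : ℝ) else 0) =
      unifP fun r => ¬ (HasEntropy ((family hD).low n r) ((family hD).cut n r) 0 ∧
        HasEntropy ((family hD).high n r) ((family hD).cut n r) (D.m (D.param n))) := by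
    unfold unifP
    exact unifE_congr fun r => by congr
  rw [h2] at h1
  rw [estimateProb]
  linarith

/-- An algorithm that estimates the entropy in the worst case does so on the family, where this is
impossible with probability much more than `1 / 2`. -/
theorem not_learns (hD : D.Suitable)
    (hLPN : ∀ 𝒜 : QPT, Negligible fun l => D.acceptProb 𝒜 true l - D.acceptProb 𝒜 false l)
    (𝒜 : QPT) (ε : ℝ) : ∀ᶠ n in atTop, ¬ LearnsEntropyAt 𝒜 3 ε n := by
  classical
  obtain ⟨μ, hμ, hle⟩ := estimateProb_le hD hLPN 𝒜 ε
  have hbad := overwhelming hD (P := fun n H H' W => H.IsLocal2D 3 ∧ H'.IsLocal2D 3 ∧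
    H.GroundStructure ∧ H'.GroundStructure)
    (Eventually.of_forall fun n H H' W h1 h2 h3 h4 => ⟨h1, h2, h3.1, h4.1⟩)
  filter_upwards [Negligible.eventually_le hbad (show (0 : ℝ) < 1 / 20 by norm_num),
    Negligible.eventually_le hμ (show (0 : ℝ) < 1 / 20 by norm_num), hle] with n h1 h2 h3 hlearn
  have h4 := (abs_le.1 h1).2
  have h5 := (abs_le.1 h2).2
  have key : ∀ r, 4 / 3 - 4 / 3 * (if ¬ (((family hD).low n r).IsLocal2D 3 ∧
      ((family hD).high n r).IsLocal2D 3 ∧ ((family hD).low n r).GroundStructure ∧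
      ((family hD).high n r).GroundStructure) then 1 else 0) ≤
      𝒜.outProb (inputCode ((family hD).low n r) ((family hD).cut n r))
      (goodEstimates ((family hD).low n r) ((family hD).cut n r) ε) +
      𝒜.outProb (inputCode ((family hD).high n r) ((family hD).cut n r))
      (goodEstimates ((family hD).high n r) ((family hD).cut n r) ε) := by
    intro r
    by_cases hgood : ((family hD).low n r).IsLocal2D 3 ∧
      ((family hD).high n r).IsLocal2D 3 ∧ ((family hD).low n r).GroundStructure ∧
      ((family hD).high n r).GroundStructure
    · rw [if_neg (not_not.2 hgood)]
      obtain ⟨g1, g2, g3, g4⟩ := hgood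
      have k1 := hlearn _ ((family hD).cut n r) g1 g3
      have k2 := hlearn _ ((family hD).cut n r) g2 g4
      linarith
    · rw [if_pos hgood]
      have k1 := outProb_nonneg 𝒜 (inputCode ((family hD).low n r) ((family hD).cut n r))
        (goodEstimates ((family hD).low n r) ((family hD).cut n r) ε)
      have k2 := outProb_nonneg 𝒜 (inputCode ((family hD).high n r) ((family hD).cut n r))
        (goodEstimates ((family hD).high n r) ((family hD).cut n r) ε)
      linarith
  have h6 := unifE_mono key
  rw [unifE_sub, unifE_const, unifE_mul_left, unifE_add] at h6
  have h7 : (unifE fun r => if ¬ (((family hD).low n r).IsLocal2D 3 ∧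
      ((family hD).high n r).IsLocal2D 3 ∧ ((family hD).low n r).GroundStructure ∧
      ((family hD).high n r).GroundStructure) then (1 : ℝ) else 0) =
      unifP fun r => ¬ (((family hD).low n r).IsLocal2D 3 ∧
      ((family hD).high n r).IsLocal2D 3 ∧ ((family hD).low n r).GroundStructure ∧
      ((family hD).high n r).GroundStructure) := by
    unfold unifP
    exact unifE_congr fun r => by congr
  rw [h7] at h6
  rw [estimateProb] at h3
  linarith

end DenseSparseFamily

end HamLearn

theorem theorem3 (hLPN : DenseSparseLPN) :
    ∃ (k : ℕ) (F : HamFamily) (Δ : ℕ → ℝ), 0 < k ∧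
      (∀ n ≥ F.n₀, ∀ r, (F.low n r).IsLocal2D k ∧ (F.high n r).IsLocal2D k) ∧
      -- ground-state structure
      F.Overwhelming (fun _ Hlow Hhigh _ => Hlow.GroundStructure ∧ Hhigh.GroundStructure) ∧
      -- entanglement entropy difference
      (∀ n, 1 ≤ Δ n) ∧
      ((fun n : ℕ => Real.log n) =o[atTop] Δ) ∧
      F.Overwhelming (fun n Hlow Hhigh W =>
        ∃ φlow φhigh, Hlow.IsUniqueGroundState φlow ∧ Hhigh.IsUniqueGroundState φhigh ∧
          entanglementEntropy W φlow + Δ n ≤ entanglementEntropy W φhigh) ∧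
      -- indistinguishability
      (∀ 𝒜 : QPT, Negligible fun n =>
        unifE (fun r => 𝒜.acceptProb (inputCode (F.high n r) (F.cut n r)))
          - unifE (fun r => 𝒜.acceptProb (inputCode (F.low n r) (F.cut n r)))) ∧
      -- hardness of deciding low against high entropy: on this family, and in the worst case
      (∃ a b : ℕ → ℝ, (∀ n, 0 ≤ a n ∧ a n + Δ n ≤ b n) ∧
        F.Overwhelming (fun n Hlow Hhigh W =>
          EntropyIn Hlow W (Set.Iic (a n)) ∧ EntropyIn Hhigh W (Set.Ici (b n))) ∧
        ∀ 𝒜 : QPT, ∀ᶠ n in atTop, ¬ DecidesEntropyAt 𝒜 k a b n) ∧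
      -- hardness of learning the entropy up to a constant: on this family, and in the worst case
      (∀ ε : ℝ, 0 < ε → ∀ 𝒜 : QPT,
        (∃ μ : ℕ → ℝ, Negligible μ ∧ ∀ n,
          (unifE (fun r => 𝒜.outProb (inputCode (F.low n r) (F.cut n r))
              (goodEstimates (F.low n r) (F.cut n r) ε))
            + unifE (fun r => 𝒜.outProb (inputCode (F.high n r) (F.cut n r))
              (goodEstimates (F.high n r) (F.cut n r) ε))) / 2 ≤ 1 / 2 + μ n) ∧
        ∀ᶠ n in atTop, ¬ LearnsEntropyAt 𝒜 k ε n) := by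
  obtain ⟨D, hD, hLPN⟩ := hLPN
  refine ⟨3, DenseSparseFamily.family hD, fun n => max 1 (D.m (D.param n) : ℝ), by norm_num,
    fun n _ r => ⟨gridHam_isLocal _ _ _, gridHam_isLocal _ _ _⟩, ?_, fun n => le_max_left _ _,
    DenseSparseFamily.log_isLittleO hD, ?_, DenseSparseFamily.indistinguishable hD hLPN,
    ⟨fun _ => 0, fun n => max 1 (D.m (D.param n) : ℝ), fun n => ⟨le_rfl, (zero_add _).le⟩, ?_,
      DenseSparseFamily.not_decides hD hLPN⟩,
    fun ε _ 𝒜 => ⟨?_, DenseSparseFamily.not_learns hD hLPN 𝒜 ε⟩⟩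
  · exact DenseSparseFamily.overwhelming hD
      (Eventually.of_forall fun n H H' W _ _ h h' => ⟨h.1, h'.1⟩)
  · refine DenseSparseFamily.overwhelming hD ?_
    filter_upwards [DenseSparseFamily.eventually_le_m hD 1] with n hn
    rintro H H' W - - ⟨-, φ, hφ, hs⟩ ⟨-, ψ, hψ, hs'⟩
    refine ⟨φ, ψ, hφ, hψ, ?_⟩
    rw [hs, hs', zero_add]
    exact max_le (by exact_mod_cast hn) le_rfl
  · refine DenseSparseFamily.overwhelming hD ?_
    filter_upwards [DenseSparseFamily.eventually_le_m hD 1] with n hn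
    rintro H H' W - - ⟨-, φ, hφ, hs⟩ ⟨-, ψ, hψ, hs'⟩
    refine ⟨⟨φ, hφ, hs.le⟩, ψ, hψ, ?_⟩
    rw [hs', Set.mem_Ici]
    exact max_le (by exact_mod_cast hn) le_rfl
  · obtain ⟨μ, hμ, hle⟩ := DenseSparseFamily.estimateProb_le hD hLPN 𝒜 ε
    -- the bound holds eventually, and the positive part of the excess covers the other `n`
    refine ⟨fun n => max 0 (DenseSparseFamily.estimateProb hD 𝒜 ε n - 1 / 2), hμ.abs.of_le ?_, fun n => ?_⟩
    · filter_upwards [hle] with n hn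
      rw [abs_of_nonneg (le_max_left _ _)]
      exact max_le (abs_nonneg _) (by linarith [le_abs_self (μ n)])
    · have h := le_max_right 0 (DenseSparseFamily.estimateProb hD 𝒜 ε n - 1 / 2)
      change DenseSparseFamily.estimateProb hD 𝒜 ε n ≤ _
      linarith
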